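/- Let $\alpha\in(0,1)$, $a<A$, $x_A\in\mathbb R$ and $(M,N)\in\mathbb R^2\setminus\{(0,0)\}$. Let $L,f:[a,+\infty)\times\mathbb R^2\to\mathbb R$ be continuously differentiable and $\varphi:[a,+\infty)\times\mathbb R\to\mathbb R$ be differentiable. Write $${}_a^CD_t^\alpha x(t)=\frac1{\Gamma(1-\alpha)}\int_a^t(t-\tau)^{-\alpha}\dot x(\tau)\,d\tau,\qquad {}_tI_b^{1-\alpha}\lambda(t)=\frac1{\Gamma(1-\alpha)}\int_t^b(\tau-t)^{-\alpha}\lambda(\tau)\,d\tau,\qquad {}_tD_b^{\alpha}\lambda(t)=-\frac{d}{dt}\,{}_tI_b^{1-\alpha}\lambda(t)$$ (derivatives at end points of intervals are one-sided). Call $(x,u,T)$ admissible if $T>A$, $x\in C^1([a,T])$, $u\in C([A,T])$, $x(A)=x_A$ and $$M\dot x(t)+N\,{}_a^CD_t^\alpha x(t)=f(t,x(t),u(t))\qquad\text{for all }t\in[A,T].$$ Let $(x,u,T)$ minimize $$J(x,u,T)=\int_A^TL(t,x(t),u(t))\,dt+\varphi(T,x(T))$$ among all admissible triplets, and put $H(t,x,u,\lambda)=L(t,x,u)+\lambda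 f(t,x,u)$. Then there is a continuous function $\lambda:[a,T]\to\mathbb R$, differentiable on $[A,T]$ if $M\neq0$, and such that ${}_tD_T^\alpha\lambda$ exists on $[a,T]$ and ${}_tD_A^\alpha\lambda$ exists on $[a,A]$ if $N\ne0$, for which the following hold (a term with coefficient $M=0$ or $N=0$ being absent). (i) For all $t\in[A,T]$, $$M\dot\lambda(t)-N\,{}_tD_T^\alpha\lambda(t)=-\frac{\partial H}{\partial x}(t,x(t),u(t),\lambda(t)),\qquad M\dot x(t)+N\,{}_a^CD_t^\alpha x(t)=\frac{\partial H}{\partial\lambda}(t,x(t),u(t),\lambda(t)),$$ and, if $N\neq0$, ${}_tD_T^\alpha\lambda(t)-{}_tD_A^\alpha\lambda(t)=0$ for all $t\in[a,A]$. (ii) $\dfrac{\partial H}{\partial u}(t,x(t),u(t),\lambda(t))=0$ for all $t\in[A,T]$. (iii) The transversality conditions $$\Big[H(t,x(t),u(t),\lambda(t))-N\lambda(t)\,{}_a^CD_t^\alpha x(t)+N\dot x(t)\,{}_tI_T^{1-\alpha}\lambda(t)+\frac{\partial\varphi}{\partial t}(t,x(t))\Big]_{t=T}=0,$$ $$\Big[M\lambda(t)+N\,{}_tI_T^{1-\alpha}\lambda(t)-\frac{\partial\varphi}{\partial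 x}(t,x(t))\Big]_{t=T}=0,$$ and, if $N\ne0$, $$\Big[{}_tI_T^{1-\alpha}\lambda(t)-{}_tI_A^{1-\alpha}\lambda(t)\Big]_{t=a}=0.$$ -/

import Mathlib

open Set

noncomputable section

namespace FracOC

/-- Left Caputo fractional derivative of order `α ∈ (0,1)` with base point `a`:
`(1 / Γ(1-α)) ∫_a^t (t-τ)^(-α) x'(τ) dτ`. -/
def caputoLeft (α a : ℝ) (x : ℝ → ℝ) (t : ℝ) : ℝ :=
  1 / Real.Gamma (1 - α) * ∫ τ in a..t, (t - τ) ^ (-α) * deriv x τ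

/-- Right Riemann-Liouville fractional integral of order `β > 0` with end point `b`:
`(1 / Γ(β)) ∫_t^b (τ-t)^(β-1) p(τ) dτ`. -/
def rightRLI (β b : ℝ) (p : ℝ → ℝ) (t : ℝ) : ℝ :=
  1 / Real.Gamma β * ∫ τ in t..b, (τ - t) ^ (β - 1) * p τ

/-- Right Riemann-Liouville fractional derivative of order `α ∈ (0,1)` with end point `b`,
of a function on `[a,b]`: minus the derivative in `t` of the right fractional integral of order
`1-α`; the derivative is one-sided at the two end points of `[a,b]`. -/
def rightRLD (α a b : ℝ) (p : ℝ → ℝ) (t : ℝ) : ℝ :=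
  -derivWithin (rightRLI (1 - α) b p) (Icc a b) t

/-- The right Riemann-Liouville derivative of order `α` of `p` exists at every point of
`[a,b]`. -/
def HasRightRLDOn (α a b : ℝ) (p : ℝ → ℝ) : Prop :=
  DifferentiableOn ℝ (rightRLI (1 - α) b p) (Icc a b)

/-- The Hamiltonian `H(t,x,u,p) = L(t,x,u) + p f(t,x,u)`. -/
def hamiltonian (L f : ℝ → ℝ → ℝ → ℝ) (t x u p : ℝ) : ℝ :=
  L t x u + p * f t x u

/-- Admissible triplets `(x,u,T)`: a final time `T > A`, a state of class `C¹` on `[a,T]`, a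
continuous control on `[A,T]`, the dynamics `M x' + N (Caputo derivative of x, base a) = f(t,x,u)`
on `[A,T]`, and the condition `x(A) = xA`. -/
structure IsAdmissible (α a A xA M N : ℝ) (f : ℝ → ℝ → ℝ → ℝ)
    (x u : ℝ → ℝ) (T : ℝ) : Prop where
  lt_final : A < T
  state : ContDiffOn ℝ 1 x (Icc a T)
  control : ContinuousOn u (Icc A T)
  dynamics : ∀ t ∈ Icc A T,
    M * derivWithin x (Icc a T) t + N * caputoLeft α a x t = f t (x t) (u t)
  start : x A = xA

/-- The cost `J(x,u,T) = ∫_A^T L(t,x(t),u(t)) dt + φ(T,x(T))`. -/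
def cost (A : ℝ) (L : ℝ → ℝ → ℝ → ℝ) (φ : ℝ → ℝ → ℝ) (x u : ℝ → ℝ) (T : ℝ) : ℝ :=
  (∫ t in A..T, L t (x t) (u t)) + φ T (x T)

/-- `(x,u,T)` is admissible and minimizes the cost among all admissible triplets. -/
def IsMinimizer (α a A xA M N : ℝ) (L f : ℝ → ℝ → ℝ → ℝ) (φ : ℝ → ℝ → ℝ)
    (x u : ℝ → ℝ) (T : ℝ) : Prop :=
  IsAdmissible α a A xA M N f x u T ∧
    ∀ (y v : ℝ → ℝ) (S : ℝ), IsAdmissible α a A xA M N f y v S →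
      cost A L φ x u T ≤ cost A L φ y v S

end FracOC

end

namespace FracOC

open MeasureTheory intervalIntegral Filter Topology

/-! The cases `N ≠ 0` and `N = 0` are of different natures.

Let `N ≠ 0`. No equation constrains the state on `[a,A)`, yet its derivative there enters the Caputo
derivative at `t ≥ A` through the history term `∫_a^A (t-τ)^(-α) x'(τ) dτ`. History terms are
uniformly dense in `C([A,S])`: concentrated histories produce `(t-τ)^(-α)`, difference quotients in
`τ` produce `(t-τ)^(-α-n)`, and the Weierstrass theorem in the variable `1/(t-τ)` does the rest
(`historyApprox_of_continuous`). A smooth state with zero derivative at `A` therefore satisfies the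
dynamics up to a small residual once the history is well chosen, and a fixed point argument absorbs
the residual into a small change of the state (`exists_admissible_near`). So admissible pairs are
dense among all continuous pairs starting at `xA`, and the minimizer minimizes the cost with no
dynamics at all (`cost_le_of_continuous`). Hence `L_x` and `L_u` vanish along it, as do `φ_x` and `L
+ φ_t` at `T`, and the multiplier `0` meets every condition (`stationary_of_frac`).

Let `N = 0`, so `M ≠ 0`. The dynamics are an ordinary differential equation. The multiplier solves
the linear adjoint equation with `M p(T) = φ_x`, and varying the control in the direction `-H_u`
changes the cost by `-ε ∫ H_u² + o(ε)`, which forces `H_u = 0` (`pontryagin_of_ode`).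

Both cases need exact solutions near approximate ones. Volterra operators have small norm for the
weight `exp(l(t-A))` with `l` large (`exists_volterra_exp_bound`), so Picard iteration converges on
the whole interval. For `M = 0` the equation is of the first kind; composing the kernels of orders
`α` and `1-α` brings it to the second kind (`exists_solution_of_kernel`). -/

/-! ### Abel kernels and Volterra operators. -/

lemma intervalIntegrable_sub_rpow {β : ℝ} (hβ : 0 < β) (a b t : ℝ) :
    IntervalIntegrable (fun s => (t - s) ^ (β - 1)) volume a b := by
  have h := (intervalIntegrable_rpow' (a := t - a) (b := t - b) (r := β - 1)
    (by linarith)).comp_sub_left t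
  simpa using h

lemma intervalIntegrable_kernel_mul {β : ℝ} (hβ : 0 < β) (a b t : ℝ) {z : ℝ → ℝ}
    (hz : ContinuousOn z (uIcc a b)) :
    IntervalIntegrable (fun s => (t - s) ^ (β - 1) * z s) volume a b :=
  (intervalIntegrable_sub_rpow hβ a b t).mul_continuousOn hz

/-- The left Riemann-Liouville integral of order `β` and base point `A`, without the factor
`1 / Γ(β)`, written in scaled form so that it is defined and continuous on the whole line. -/
noncomputable def volterra (β A : ℝ) (z : ℝ → ℝ) (t : ℝ) : ℝ :=
  (t - A) ^ β * ∫ r in (0 : ℝ)..1, (1 - r) ^ (β - 1) * z (A + r * (t - A))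

lemma volterra_eq {β : ℝ} (hβ : 0 < β) {A t : ℝ} (hAt : A ≤ t) (z : ℝ → ℝ) :
    volterra β A z t = ∫ s in A..t, (t - s) ^ (β - 1) * z s := by
  rcases hAt.eq_or_lt with rfl | hlt
  · simp [volterra, Real.zero_rpow hβ.ne']
  · have hc : 0 < t - A := sub_pos.2 hlt
    have h := intervalIntegral.smul_integral_comp_add_mul
      (a := 0) (b := 1) (fun s => (t - s) ^ (β - 1) * z s) (t - A) A
    simp only [mul_zero, add_zero, mul_one, add_sub_cancel, smul_eq_mul] at h
    rw [← h, volterra, ← intervalIntegral.integral_const_mul,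
      ← intervalIntegral.integral_const_mul]
    refine intervalIntegral.integral_congr fun r hr => ?_
    rw [uIcc_of_le zero_le_one] at hr
    have e : t - (A + (t - A) * r) = (t - A) * (1 - r) := by ring
    have e2 : (t - A) ^ β = (t - A) * (t - A) ^ (β - 1) := by
      rw [Real.rpow_sub_one hc.ne']; field_simp
    simp only [e, e2, Real.mul_rpow hc.le (sub_nonneg.2 hr.2), mul_comm r]
    ring

/-- In the scaled form the singularity stays at `r = 1` whatever `t` is, so dominated convergence
applies with a multiple of `(1-r)^(β-1)` as bound. -/
lemma continuous_volterra {β : ℝ} (hβ : 0 < β) (A : ℝ) {z : ℝ → ℝ} (hz : Continuous z) :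
    Continuous (volterra β A z) := by
  refine Continuous.mul ((continuous_id.sub continuous_const).rpow_const fun _ => Or.inr hβ.le) ?_
  rw [continuous_iff_continuousAt]
  intro t₀
  have hcomp : IsCompact ((fun p : ℝ × ℝ => A + p.1 * (p.2 - A)) ''
      (Icc 0 1 ×ˢ Icc (t₀ - 1) (t₀ + 1))) :=
    (isCompact_Icc.prod isCompact_Icc).image (by fun_prop)
  obtain ⟨C, hC⟩ := hcomp.exists_bound_of_continuousOn (f := z) hz.continuousOn
  refine continuousAt_of_dominated_interval
    (bound := fun r => (1 - r) ^ (β - 1) * C) ?_ ?_ ?_ ?_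
  · refine Eventually.of_forall fun t => ?_
    refine Measurable.aestronglyMeasurable ?_
    have := hz.measurable
    fun_prop
  · filter_upwards [Icc_mem_nhds (sub_one_lt t₀) (lt_add_one t₀)] with t ht
    refine Eventually.of_forall fun r hr => ?_
    rw [uIoc_of_le zero_le_one] at hr
    have h1 : 0 ≤ (1 - r) ^ (β - 1) := Real.rpow_nonneg (by linarith [hr.2]) _
    rw [norm_mul, Real.norm_of_nonneg h1]
    exact mul_le_mul_of_nonneg_left (hC _ ⟨(r, t), ⟨⟨hr.1.le, hr.2⟩, ht⟩, rfl⟩) h1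
  · exact (intervalIntegrable_sub_rpow hβ 0 1 1).mul_const C
  · exact Eventually.of_forall fun r _ => by fun_prop

lemma volterra_one {A t : ℝ} (hAt : A ≤ t) (z : ℝ → ℝ) :
    volterra 1 A z t = ∫ s in A..t, z s := by
  simp [volterra_eq one_pos hAt]

lemma volterra_sub {β : ℝ} (hβ : 0 < β) {A t : ℝ} {z w : ℝ → ℝ}
    (hz : Continuous z) (hw : Continuous w) :
    volterra β A (fun s => z s - w s) t = volterra β A z t - volterra β A w t := by
  unfold volterra
  rw [← mul_sub, ← intervalIntegral.integral_sub]
  · simp only [mul_sub]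
  · exact (intervalIntegrable_sub_rpow hβ 0 1 1).mul_continuousOn (by fun_prop)
  · exact (intervalIntegrable_sub_rpow hβ 0 1 1).mul_continuousOn (by fun_prop)

lemma volterra_const_mul {β A t : ℝ} (c : ℝ) (z : ℝ → ℝ) :
    volterra β A (fun s => c * z s) t = c * volterra β A z t := by
  unfold volterra
  simp only [mul_left_comm _ c, intervalIntegral.integral_const_mul]

lemma abs_volterra_le {β : ℝ} (hβ : 0 < β) {A t : ℝ} (hAt : A ≤ t) {z w : ℝ → ℝ}
    (hw : Continuous w) (h : ∀ s ∈ Icc A t, |z s| ≤ w s) :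
    |volterra β A z t| ≤ volterra β A w t := by
  rw [volterra_eq hβ hAt, volterra_eq hβ hAt, ← Real.norm_eq_abs]
  refine intervalIntegral.norm_integral_le_of_norm_le hAt ?_
    (intervalIntegrable_kernel_mul hβ A t t hw.continuousOn)
  refine Eventually.of_forall fun s hs => ?_
  have h1 : 0 ≤ (t - s) ^ (β - 1) := Real.rpow_nonneg (by linarith [hs.2]) _
  rw [norm_mul, Real.norm_of_nonneg h1]
  exact mul_le_mul_of_nonneg_left (h s ⟨hs.1.le, hs.2⟩) h1

/-- With `ρ = t - s` the weight `exp(l(t-A))` factors out; enlarging the range of `ρ` to the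
half-line leaves a Gamma integral. -/
lemma integral_kernel_mul_exp_le {β : ℝ} (hβ : 0 < β) {l : ℝ} (hl : 0 < l) {A t : ℝ}
    (hAt : A ≤ t) :
    volterra β A (fun s => Real.exp (l * (s - A))) t ≤
      (1 / l) ^ β * Real.Gamma β * Real.exp (l * (t - A)) := by
  rw [volterra_eq hβ hAt]
  have h1 := intervalIntegral.integral_comp_sub_left (a := A) (b := t)
    (fun ρ => ρ ^ (β - 1) * Real.exp (l * (t - ρ - A))) t
  simp only [sub_self, sub_sub_cancel] at h1
  rw [h1, ← Real.integral_rpow_mul_exp_neg_mul_Ioi hβ hl, mul_comm,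
    ← MeasureTheory.integral_const_mul, intervalIntegral.integral_of_le (by linarith)]
  have e : ∀ ρ : ℝ, ρ ^ (β - 1) * Real.exp (l * (t - ρ - A)) =
      Real.exp (l * (t - A)) * (ρ ^ (β - 1) * Real.exp (-(l * ρ))) := by
    intro ρ
    rw [show l * (t - ρ - A) = l * (t - A) + -(l * ρ) by ring, Real.exp_add]; ring
  simp only [e]
  refine setIntegral_mono_set (Integrable.const_mul ?_ _) ?_
    (Ioc_subset_Ioi_self.eventuallyLE)
  · refine (MeasureTheory.Integrable.of_integral_ne_zero ?_)
    rw [Real.integral_rpow_mul_exp_neg_mul_Ioi hβ hl]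
    have := Real.Gamma_pos_of_pos hβ
    positivity
  · refine (ae_restrict_mem measurableSet_Ioi).mono fun ρ hρ => ?_
    have := Real.rpow_nonneg (le_of_lt hρ) (β - 1)
    show (0 : ℝ) ≤ _
    positivity

/-- The weighted norm of the operator is at most `Γ(β) / l^β`, which tends to `0`. This makes the
later iterations contractive without shortening the interval. -/
lemma exists_volterra_exp_bound {β : ℝ} (hβ : 0 < β) {ε : ℝ} (hε : 0 < ε) :
    ∃ l₀ > 0, ∀ l ≥ l₀, ∀ (A t r : ℝ) (z : ℝ → ℝ), A ≤ t →
      (∀ s ∈ Icc A t, |z s| ≤ r * Real.exp (l * (s - A))) →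
      |volterra β A z t| ≤ ε * r * Real.exp (l * (t - A)) := by
  have hlim : Tendsto (fun l : ℝ => (1 / l) ^ β * Real.Gamma β) atTop (𝓝 0) := by
    have h := (tendsto_rpow_neg_atTop hβ).mul_const (Real.Gamma β)
    rw [zero_mul] at h
    refine h.congr' ?_
    filter_upwards [eventually_gt_atTop 0] with l hl
    rw [Real.rpow_neg hl.le, one_div, Real.inv_rpow hl.le]
  obtain ⟨l₁, hl₁⟩ := eventually_atTop.1 (hlim.eventually (gt_mem_nhds hε))
  refine ⟨max l₁ 1, by positivity, fun l hl A t r z hAt hz => ?_⟩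
  have hl0 : 0 < l := lt_of_lt_of_le (by positivity) hl
  have hr : 0 ≤ r := by
    have := (abs_nonneg _).trans (hz A ⟨le_rfl, hAt⟩)
    simpa using this
  calc |volterra β A z t| ≤ volterra β A (fun s => r * Real.exp (l * (s - A))) t :=
        abs_volterra_le hβ hAt (by fun_prop) hz
    _ = r * volterra β A (fun s => Real.exp (l * (s - A))) t := volterra_const_mul _ _
    _ ≤ r * ((1 / l) ^ β * Real.Gamma β * Real.exp (l * (t - A))) :=
        mul_le_mul_of_nonneg_left (integral_kernel_mul_exp_le hβ hl0 hAt) hr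
    _ ≤ r * (ε * Real.exp (l * (t - A))) := by
        gcongr
        exact (hl₁ l ((le_max_left _ _).trans hl)).le
    _ = _ := by ring

lemma intervalIntegrable_beta {β : ℝ} (hβ : β ∈ Ioo (0 : ℝ) 1) :
    IntervalIntegrable (fun r : ℝ => (1 - r) ^ (β - 1) * r ^ (-β)) volume 0 1 := by
  have h := (Complex.betaIntegral_convergent (u := ((1 - β : ℝ) : ℂ)) (v := (β : ℂ))
    (by simpa using hβ.2) (by simpa using hβ.1)).norm
  refine h.congr_ae ?_
  rw [uIoc_of_le zero_le_one]
  have h1 : ∀ᵐ r : ℝ ∂(volume.restrict (Ioc (0 : ℝ) 1)), r ≠ 1 :=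
    ae_restrict_of_ae (by simp [ae_iff])
  filter_upwards [ae_restrict_mem measurableSet_Ioc, h1] with r hr hr1
  have hlt : r < 1 := lt_of_le_of_ne hr.2 hr1
  rw [norm_mul, Complex.norm_cpow_eq_rpow_re_of_pos hr.1]
  have e : (1 - (r : ℂ)) = ((1 - r : ℝ) : ℂ) := by push_cast; ring
  rw [e, Complex.norm_cpow_eq_rpow_re_of_pos (by linarith)]
  simp only [Complex.sub_re, Complex.ofReal_re, Complex.one_re]
  rw [mul_comm]
  congr 2
  ring

/-- The Beta integral `∫₀¹ (1-r)^(β-1) r^(-β) dr`. -/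
noncomputable def betaConst (β : ℝ) : ℝ := ∫ r in (0 : ℝ)..1, (1 - r) ^ (β - 1) * r ^ (-β)

lemma betaConst_pos {β : ℝ} (hβ : β ∈ Ioo (0 : ℝ) 1) : 0 < betaConst β := by
  refine intervalIntegral_pos_of_pos_on (intervalIntegrable_beta hβ) (fun r hr => ?_) one_pos
  exact mul_pos (Real.rpow_pos_of_pos (by linarith [hr.2]) _) (Real.rpow_pos_of_pos hr.1 _)

/-- The exponents add up to `-1`, so the scaling factor of the kernels cancels the length of the
interval and the value depends on neither end point. -/
lemma integral_kernel_mul_kernel {β : ℝ} {σ t : ℝ} (h : σ < t) :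
    ∫ s in σ..t, (t - s) ^ (β - 1) * (s - σ) ^ (-β) = betaConst β := by
  have hc : 0 < t - σ := sub_pos.2 h
  have h := intervalIntegral.smul_integral_comp_add_mul
    (a := 0) (b := 1) (fun s => (t - s) ^ (β - 1) * (s - σ) ^ (-β)) (t - σ) σ
  simp only [mul_zero, add_zero, mul_one, add_sub_cancel, smul_eq_mul] at h
  rw [← h, ← intervalIntegral.integral_const_mul, betaConst]
  refine intervalIntegral.integral_congr fun r hr => ?_
  rw [uIcc_of_le zero_le_one] at hr
  have e : t - (σ + (t - σ) * r) = (t - σ) * (1 - r) := by ring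
  have e2 : σ + (t - σ) * r - σ = (t - σ) * r := by ring
  have e3 : (t - σ) * ((t - σ) ^ (β - 1) * (t - σ) ^ (-β)) = 1 := by
    rw [← Real.rpow_add hc, show β - 1 + -β = -1 by ring, Real.rpow_neg_one]
    field_simp
  simp only [e, e2, Real.mul_rpow hc.le (sub_nonneg.2 hr.2), Real.mul_rpow hc.le hr.1]
  linear_combination ((1 - r) ^ (β - 1) * r ^ (-β)) * e3

/-- Composing the kernels of orders `β` and `1-β` gives a multiple of the primitive. -/
lemma volterra_volterra {β : ℝ} (hβ : β ∈ Ioo (0 : ℝ) 1) {A t : ℝ} (hAt : A ≤ t) {z : ℝ → ℝ}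
    (hz : Continuous z) :
    volterra β A (volterra (1 - β) A z) t = betaConst β * ∫ s in A..t, z s := by
  have hβ' : 0 < 1 - β := sub_pos.2 hβ.2
  obtain ⟨C, hC⟩ := (isCompact_Icc (a := A) (b := t)).exists_bound_of_continuousOn hz.continuousOn
  set w : ℝ → ℝ := (Ioc A t).indicator fun s => (t - s) ^ (β - 1) with hw
  set k : ℝ → ℝ := (Ioc 0 (t - A)).indicator fun ρ => ρ ^ (-β) with hk
  set ζ : ℝ → ℝ := (Ioc A t).indicator z with hζ
  have hwi : Integrable w := by
    rw [hw, integrable_indicator_iff measurableSet_Ioc]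
    exact ((intervalIntegrable_sub_rpow hβ.1 A t t).1)
  have hki : Integrable k := by
    rw [hk, integrable_indicator_iff measurableSet_Ioc]
    exact ((intervalIntegrable_rpow' (a := 0) (b := t - A) (r := -β) (by linarith [hβ.2])).1)
  -- The cut-off kernels are integrable on the line, so the integrand of their convolution is
  -- jointly integrable. This supplies the hypothesis of Fubini despite the singularities; the
  -- reflection of `k` matches the sign convention of convolution.
  have hint0 : Integrable (fun p : ℝ × ℝ => w p.2 * k (-(p.1 - p.2))) (volume.prod volume) :=
    Integrable.convolution_integrand (ContinuousLinearMap.mul ℝ ℝ) hwi hki.comp_neg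
  have hζm : Measurable ζ := hz.measurable.indicator measurableSet_Ioc
  have hint : Integrable (fun p : ℝ × ℝ => ζ p.1 * (w p.2 * k (p.2 - p.1)))
      (volume.prod volume) := by
    simp only [neg_sub] at hint0
    refine hint0.bdd_mul (c := max C 0) ((hζm.comp measurable_fst).aestronglyMeasurable)
      (Eventually.of_forall fun p => ?_)
    by_cases hp : p.1 ∈ Ioc A t
    · rw [hζ]; simp only [indicator_of_mem hp]
      exact (hC _ ⟨hp.1.le, hp.2⟩).trans (le_max_left _ _)
    · rw [hζ]; simp [indicator_of_notMem hp]
  have hswap := integral_integral_swap (f := fun σ s => ζ σ * (w s * k (s - σ))) hint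
  have hL : ∫ σ, ∫ s, ζ σ * (w s * k (s - σ)) = betaConst β * ∫ s in A..t, z s := by
    rw [intervalIntegral.integral_of_le hAt, ← MeasureTheory.integral_const_mul,
      ← MeasureTheory.integral_indicator measurableSet_Ioc]
    refine integral_congr_ae ?_
    have hne : ∀ᵐ σ : ℝ, σ ≠ t := by simp [ae_iff]
    filter_upwards [hne] with σ hσt
    by_cases hσ : σ ∈ Ioc A t
    · have hlt : σ < t := lt_of_le_of_ne hσ.2 hσt
      rw [indicator_of_mem hσ, MeasureTheory.integral_const_mul, hζ, indicator_of_mem hσ,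
        ← integral_kernel_mul_kernel hlt, intervalIntegral.integral_of_le hlt.le,
        ← MeasureTheory.integral_indicator measurableSet_Ioc, mul_comm]
      congr 1
      refine integral_congr_ae (Eventually.of_forall fun s => ?_)
      by_cases hs : s ∈ Ioc σ t
      · have h1 : s ∈ Ioc A t := ⟨hσ.1.trans hs.1, hs.2⟩
        have h2 : s - σ ∈ Ioc 0 (t - A) := ⟨by linarith [hs.1], by linarith [hs.2, hσ.1]⟩
        simp only [hw, hk, indicator_of_mem hs, indicator_of_mem h1, indicator_of_mem h2]
      · simp only [indicator_of_notMem hs]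
        by_cases h1 : s ∈ Ioc A t
        · have h2 : s - σ ∉ Ioc 0 (t - A) := fun h => hs ⟨by linarith [h.1], h1.2⟩
          simp only [hk, indicator_of_notMem h2, mul_zero]
        · simp only [hw, indicator_of_notMem h1, zero_mul]
    · simp only [hζ, indicator_of_notMem hσ, zero_mul, MeasureTheory.integral_zero]
  have hR : ∫ s, ∫ σ, ζ σ * (w s * k (s - σ)) = volterra β A (volterra (1 - β) A z) t := by
    rw [volterra_eq hβ.1 hAt, intervalIntegral.integral_of_le hAt,
      ← MeasureTheory.integral_indicator measurableSet_Ioc]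
    refine integral_congr_ae (Eventually.of_forall fun s => ?_)
    by_cases hs : s ∈ Ioc A t
    · simp only [indicator_of_mem hs]
      have e : ∀ σ, ζ σ * (w s * k (s - σ)) = (t - s) ^ (β - 1) * (k (s - σ) * ζ σ) := by
        intro σ; simp only [hw, indicator_of_mem hs]; ring
      simp only [e]
      rw [MeasureTheory.integral_const_mul, volterra_eq hβ' hs.1.le,
        intervalIntegral.integral_of_le hs.1.le,
        ← MeasureTheory.integral_indicator measurableSet_Ioc]
      congr 1
      have hne : ∀ᵐ σ : ℝ, σ ≠ s := by simp [ae_iff]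
      refine integral_congr_ae ?_
      filter_upwards [hne] with σ hne
      by_cases hσ : σ ∈ Ioc A s
      · have hlt : σ < s := lt_of_le_of_ne hσ.2 hne
        have h1 : σ ∈ Ioc A t := ⟨hσ.1, hσ.2.trans hs.2⟩
        have h2 : s - σ ∈ Ioc 0 (t - A) := ⟨by linarith, by linarith [hs.2, hσ.1]⟩
        simp only [hζ, hk, indicator_of_mem hσ, indicator_of_mem h1, indicator_of_mem h2]
        congr 2; ring
      · simp only [indicator_of_notMem hσ]
        by_cases h1 : σ ∈ Ioc A t
        · have h2 : s - σ ∉ Ioc 0 (t - A) := fun h => hσ ⟨h1.1, by linarith [h.1]⟩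
          simp only [hk, indicator_of_notMem h2, zero_mul]
        · simp only [hζ, indicator_of_notMem h1, mul_zero]
    · simp only [indicator_of_notMem hs, hw, zero_mul, mul_zero, MeasureTheory.integral_zero]
  rw [← hR, ← hL]
  exact hswap.symm

/-! ### Uniform limits of Picard iterates. -/

/-- `z n` converges to `w` uniformly on `[A,S]`. -/
def UnifConv (A S : ℝ) (z : ℕ → ℝ → ℝ) (w : ℝ → ℝ) : Prop :=
  ∀ ε > 0, ∃ K, ∀ n ≥ K, ∀ t ∈ Icc A S, |z n t - w t| ≤ ε

/-- `z` is uniformly Cauchy on `[A,S]`. -/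
def UnifCauchy (A S : ℝ) (z : ℕ → ℝ → ℝ) : Prop :=
  ∀ ε > 0, ∃ K, ∀ n ≥ K, ∀ m ≥ K, ∀ t ∈ Icc A S, |z n t - z m t| ≤ ε

lemma UnifConv.tendsto {A S : ℝ} {z : ℕ → ℝ → ℝ} {w : ℝ → ℝ} (h : UnifConv A S z w) {t : ℝ}
    (ht : t ∈ Icc A S) : Tendsto (fun n => z n t) atTop (𝓝 (w t)) := by
  rw [Metric.tendsto_atTop]
  intro ε hε
  obtain ⟨K, hK⟩ := h (ε / 2) (half_pos hε)
  exact ⟨K, fun n hn => by rw [Real.dist_eq]; linarith [hK n hn t ht]⟩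

lemma UnifCauchy.exists_unifConv {A S : ℝ} (hAS : A ≤ S) {z : ℕ → ℝ → ℝ}
    (hz : ∀ n, Continuous (z n)) (h : UnifCauchy A S z) :
    ∃ w, Continuous w ∧ UnifConv A S z w := by
  have hc : ∀ t ∈ Icc A S, ∃ l, Tendsto (fun n => z n t) atTop (𝓝 l) := by
    intro t ht
    refine cauchySeq_tendsto_of_complete (Metric.cauchySeq_iff'.2 fun ε hε => ?_)
    obtain ⟨K, hK⟩ := h (ε / 2) (half_pos hε)
    exact ⟨K, fun n hn => by rw [Real.dist_eq]; linarith [hK n hn K le_rfl t ht]⟩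
  choose! w hw using hc
  have hconv : UnifConv A S z w := by
    intro ε hε
    obtain ⟨K, hK⟩ := h ε hε
    refine ⟨K, fun n hn t ht => ?_⟩
    refine le_of_tendsto ((tendsto_const_nhds.sub (hw t ht)).abs)
      ((eventually_ge_atTop K).mono fun m hm => hK n hn m hm t ht)
  have hwc : ContinuousOn w (Icc A S) := by
    refine TendstoUniformlyOn.continuousOn (F := z) (p := atTop) ?_
      (Frequently.of_forall fun n => (hz n).continuousOn)
    rw [Metric.tendstoUniformlyOn_iff]
    intro ε hε
    obtain ⟨K, hK⟩ := hconv (ε / 2) (half_pos hε)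
    filter_upwards [eventually_ge_atTop K] with n hn t ht
    rw [dist_comm, Real.dist_eq]; linarith [hK n hn t ht]
  -- Constant extension beyond the end points makes the limit continuous on the line, as the results
  -- on `volterra` require.
  refine ⟨IccExtend hAS ((Icc A S).domRestrict w), ?_, ?_⟩
  · exact (continuousOn_iff_continuous_domRestrict.1 hwc).Icc_extend'
  · intro ε hε
    obtain ⟨K, hK⟩ := hconv ε hε
    refine ⟨K, fun n hn t ht => ?_⟩
    rw [IccExtend_of_mem hAS _ ht]
    exact hK n hn t ht

/-- A sequence whose weighted oscillation is halved at each step, up to errors that become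
arbitrarily small, is uniformly Cauchy. -/
lemma unifCauchy_of_recursion {A S l R : ℝ} (hl : 0 ≤ l) {z : ℕ → ℝ → ℝ}
    (hR : ∀ n m, ∀ t ∈ Icc A S, |z n t - z m t| ≤ R * Real.exp (l * (t - A)))
    (h : ∀ ε > 0, ∃ K₀, ∀ K ≥ K₀, ∀ r, 
      (∀ n ≥ K, ∀ m ≥ K, ∀ t ∈ Icc A S, |z n t - z m t| ≤ r * Real.exp (l * (t - A))) →
      ∀ n ≥ K, ∀ m ≥ K, ∀ t ∈ Icc A S,
        |z (n + 1) t - z (m + 1) t| ≤ (ε + r / 2) * Real.exp (l * (t - A))) :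
    UnifCauchy A S z := by
  intro ε hε
  set E := Real.exp (l * (S - A)) with hE
  have hEpos : 0 < E := Real.exp_pos _
  obtain ⟨K₀, hK₀⟩ := h (ε / (4 * E)) (by positivity)
  -- The coefficient is preserved by `r ↦ ε' + r/2` with `ε' = ε/(4E)`: `2ε' + R/2^j` becomes `2ε' +
  -- R/2^(j+1)`. The weight being at most `E`, the fixed part costs `ε/2` in the end.
  have hstep : ∀ j : ℕ, ∀ n ≥ K₀ + j, ∀ m ≥ K₀ + j, ∀ t ∈ Icc A S,
      |z n t - z m t| ≤ (2 * (ε / (4 * E)) + R / 2 ^ j) * Real.exp (l * (t - A)) := by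
    intro j
    induction j with
    | zero =>
      intro n _ m _ t ht
      refine (hR n m t ht).trans (mul_le_mul_of_nonneg_right ?_ (Real.exp_pos _).le)
      have : 0 < ε / (4 * E) := by positivity
      simp; linarith
    | succ j ih =>
      intro n hn m hm t ht
      obtain ⟨n, rfl⟩ : ∃ n', n = n' + 1 := ⟨n - 1, by omega⟩
      obtain ⟨m, rfl⟩ : ∃ m', m = m' + 1 := ⟨m - 1, by omega⟩
      refine (hK₀ (K₀ + j) (by omega) _ ih n (by omega) m (by omega) t ht).trans (le_of_eq ?_)
      rw [pow_succ]; ring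
  have hlim : Tendsto (fun j : ℕ => R * (1 / 2 : ℝ) ^ j) atTop (𝓝 0) := by
    simpa using (tendsto_pow_atTop_nhds_zero_of_lt_one (r := (1 / 2 : ℝ)) (by norm_num)
      (by norm_num)).const_mul R
  obtain ⟨j, hj⟩ := (hlim.eventually (gt_mem_nhds (show 0 < ε / (2 * E) by positivity))).exists
  refine ⟨K₀ + j, fun n hn m hm t ht => (hstep j n hn m hm t ht).trans ?_⟩
  have h1 : R / 2 ^ j ≤ ε / (2 * E) := by
    rw [one_div, inv_pow, ← div_eq_mul_inv] at hj; exact hj.le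
  have h2 : Real.exp (l * (t - A)) ≤ E := Real.exp_le_exp.2 (by
    apply mul_le_mul_of_nonneg_left _ hl; linarith [ht.2])
  calc _ ≤ (2 * (ε / (4 * E)) + ε / (2 * E)) * Real.exp (l * (t - A)) := by gcongr
    _ ≤ (2 * (ε / (4 * E)) + ε / (2 * E)) * E := by gcongr
    _ = ε := by field_simp; ring

lemma volterra_tendsto {β : ℝ} (hβ : 0 < β) {A S : ℝ} {z : ℕ → ℝ → ℝ} {w : ℝ → ℝ}
    (hz : ∀ n, Continuous (z n)) (hw : Continuous w) (h : UnifConv A S z w) {t : ℝ}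
    (ht : t ∈ Icc A S) :
    Tendsto (fun n => volterra β A (z n) t) atTop (𝓝 (volterra β A w t)) := by
  rw [Metric.tendsto_atTop]
  intro ε hε
  set c := volterra β A (fun _ => 1) t with hc
  have hc0 : 0 ≤ c := (abs_nonneg _).trans
    (abs_volterra_le (z := fun _ => 1) hβ ht.1 continuous_const fun s _ => by simp)
  obtain ⟨K, hK⟩ := h (ε / (2 * (c + 1))) (by positivity)
  refine ⟨K, fun n hn => ?_⟩
  rw [Real.dist_eq, ← volterra_sub hβ (hz n) hw]
  calc _ ≤ volterra β A (fun _ => ε / (2 * (c + 1)) * 1) t :=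
        abs_volterra_le hβ ht.1 continuous_const fun s hs => by
          simpa using hK n hn s ⟨hs.1, hs.2.trans ht.2⟩
    _ = ε / (2 * (c + 1)) * c := volterra_const_mul _ _
    _ < ε := by
      rw [div_mul_eq_mul_div, div_lt_iff₀ (by positivity)]
      nlinarith

lemma integral_tendsto {A S : ℝ} {z : ℕ → ℝ → ℝ} {w : ℝ → ℝ}
    (hz : ∀ n, Continuous (z n)) (hw : Continuous w) (h : UnifConv A S z w) {t : ℝ}
    (ht : t ∈ Icc A S) :
    Tendsto (fun n => ∫ s in A..t, z n s) atTop (𝓝 (∫ s in A..t, w s)) := by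
  simpa only [volterra_one ht.1] using volterra_tendsto one_pos hz hw h ht

lemma continuous_primitive' {z : ℝ → ℝ} (hz : Continuous z) (A c : ℝ) :
    Continuous fun t => c + ∫ s in A..t, z s :=
  continuous_const.add (intervalIntegral.continuous_primitive
    (fun a b => hz.intervalIntegrable a b) A)

/-! ### Exact solutions near approximate ones. -/

/-- Solvability of `M z + k V z = F(t, c + ∫ z)` near an approximate solution, for `M ≠ 0`. -/
lemma exists_solution_of_ne_zero {M k β A S₀ Λ : ℝ} (hM : M ≠ 0) (hβ : 0 < β)
    (hΛ : 0 ≤ Λ) :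
    ∃ C > 0, ∀ (S : ℝ), A ≤ S → S ≤ S₀ → ∀ (F : ℝ → ℝ → ℝ) (ζ : ℝ → ℝ) (c e : ℝ),
      Continuous (fun q : ℝ × ℝ => F q.1 q.2) → Continuous ζ →
      (∀ t ∈ Icc A S, ∀ η η', |η - (c + ∫ s in A..t, ζ s)| ≤ 1 →
        |η' - (c + ∫ s in A..t, ζ s)| ≤ 1 → |F t η - F t η'| ≤ Λ * |η - η'|) →
      (∀ t ∈ Icc A S, |M * ζ t + k * volterra β A ζ t - F t (c + ∫ s in A..t, ζ s)| ≤ e) →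
      C * e ≤ 1 →
      ∃ z, Continuous z ∧
        (∀ t ∈ Icc A S, M * z t + k * volterra β A z t = F t (c + ∫ s in A..t, z s)) ∧
        (∀ t ∈ Icc A S, |z t - ζ t| ≤ C * e) ∧
        ∀ t ∈ Icc A S, |(∫ s in A..t, z s) - ∫ s in A..t, ζ s| ≤ C * e := by
  have hM' : 0 < |M| := abs_pos.2 hM
  -- This makes `(Λ + |k|) ε₁ ≤ |M|/4`, hence `Φ` below contracts by `1/4` in the weighted norm. The
  -- primitive is the Volterra operator of order `1`, so it obeys the same kind of bound as the
  -- kernel.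
  set ε₁ := |M| / (4 * (|k| + Λ + |M|)) with hε₁
  have hden : 0 < 4 * (|k| + Λ + |M|) := by positivity
  have hε₁pos : 0 < ε₁ := by positivity
  have hε₁le : ε₁ ≤ 1 := by
    rw [hε₁, div_le_one hden]; linarith [abs_nonneg k]
  have hkey : (Λ + |k|) * ε₁ ≤ |M| / 4 := by
    rw [hε₁, mul_div_assoc', div_le_div_iff₀ hden (by norm_num)]
    nlinarith [abs_nonneg k]
  obtain ⟨l₁, hl₁, hV₁⟩ := exists_volterra_exp_bound hβ hε₁pos
  obtain ⟨l₂, hl₂, hV₂⟩ := exists_volterra_exp_bound one_pos hε₁pos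
  set l := max l₁ l₂ with hl
  have hlpos : 0 < l := lt_max_of_lt_left hl₁
  specialize hV₁ l (le_max_left _ _)
  specialize hV₂ l (le_max_right _ _)
  -- The weight is bounded over `[A,S₀]` rather than `[A,S]`: the constant then serves every `S ≤
  -- S₀`, and `S` may be chosen after it.
  set E := Real.exp (l * (S₀ - A)) with hE
  have hEpos : 0 < E := Real.exp_pos _
  refine ⟨2 * E / |M|, by positivity, fun S hAS hSS F ζ c e hF hζ hLip hres he => ?_⟩
  have hexp : ∀ t ∈ Icc A S, Real.exp (l * (t - A)) ≤ E := fun t ht =>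
    Real.exp_le_exp.2 (mul_le_mul_of_nonneg_left (by linarith [ht.2]) hlpos.le)
  have hexp1 : ∀ t ∈ Icc A S, 1 ≤ Real.exp (l * (t - A)) := fun t ht =>
    Real.one_le_exp (mul_nonneg hlpos.le (by linarith [ht.1]))
  have he0 : 0 ≤ e := (abs_nonneg _).trans (hres A ⟨le_rfl, hAS⟩)
  set y₀ : ℝ → ℝ := fun t => c + ∫ s in A..t, ζ s with hy₀
  set Φ : (ℝ → ℝ) → ℝ → ℝ := fun z t =>
    (F t (c + ∫ s in A..t, z s) - k * volterra β A z t) / M with hΦ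
  have hΦc : ∀ z, Continuous z → Continuous (Φ z) := fun z hz =>
    ((hF.comp (continuous_id.prodMk (continuous_primitive' hz A c))).sub
      ((continuous_volterra hβ A hz).const_mul k)).div_const M
  set z : ℕ → ℝ → ℝ := fun n => Φ^[n] ζ with hz
  have hzs : ∀ n, z (n + 1) = Φ (z n) := fun n => Function.iterate_succ_apply' _ _ _
  have hzc : ∀ n, Continuous (z n) := by
    intro n
    induction n with
    | zero => exact hζ
    | succ n ih => rw [hzs]; exact hΦc _ ih
  have hInt : ∀ p q : ℝ → ℝ, Continuous p → Continuous q → ∀ r, ∀ t ∈ Icc A S,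
      (∀ s ∈ Icc A t, |p s - q s| ≤ r * Real.exp (l * (s - A))) →
      |(∫ s in A..t, p s) - ∫ s in A..t, q s| ≤ ε₁ * r * Real.exp (l * (t - A)) := by
    intro p q hp hq r t ht h
    rw [← volterra_one ht.1, ← volterra_one ht.1, ← volterra_sub one_pos hp hq]
    exact hV₂ A t r _ ht.1 h
  have hcontr : ∀ p q : ℝ → ℝ, Continuous p → Continuous q → ∀ r,
      (∀ t ∈ Icc A S, |p t - q t| ≤ r * Real.exp (l * (t - A))) →
      (∀ t ∈ Icc A S, |(c + ∫ s in A..t, p s) - y₀ t| ≤ 1) →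
      (∀ t ∈ Icc A S, |(c + ∫ s in A..t, q s) - y₀ t| ≤ 1) →
      ∀ t ∈ Icc A S, |Φ p t - Φ q t| ≤ r / 4 * Real.exp (l * (t - A)) := by
    intro p q hp hq r h hp1 hq1 t ht
    have hr : 0 ≤ r := by
      have := (abs_nonneg _).trans (h A ⟨le_rfl, hAS⟩)
      simpa using this
    have hsub : ∀ s ∈ Icc A t, |p s - q s| ≤ r * Real.exp (l * (s - A)) :=
      fun s hs => h s ⟨hs.1, hs.2.trans ht.2⟩
    have h1 := hInt p q hp hq r t ht hsub
    have h2 : |volterra β A p t - volterra β A q t| ≤ ε₁ * r * Real.exp (l * (t - A)) := by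
      rw [← volterra_sub hβ hp hq]
      exact hV₁ A t r _ ht.1 hsub
    have h3 := hLip t ht _ _ (hp1 t ht) (hq1 t ht)
    rw [add_sub_add_left_eq_sub] at h3
    have e1 : Φ p t - Φ q t = ((F t (c + ∫ s in A..t, p s) - F t (c + ∫ s in A..t, q s)) -
        k * (volterra β A p t - volterra β A q t)) / M := by
      simp only [hΦ]; ring
    rw [e1, abs_div, div_le_iff₀ hM']
    calc _ ≤ Λ * (ε₁ * r * Real.exp (l * (t - A))) + |k| * (ε₁ * r * Real.exp (l * (t - A))) := by
          refine (abs_sub _ _).trans (add_le_add (h3.trans (by gcongr)) ?_)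
          rw [abs_mul]; gcongr
      _ = ((Λ + |k|) * ε₁) * (r * Real.exp (l * (t - A))) := by ring
      _ ≤ |M| / 4 * (r * Real.exp (l * (t - A))) := by gcongr
      _ = _ := by ring
  have h0 : ∀ t ∈ Icc A S, |Φ ζ t - ζ t| ≤ e / |M| := by
    intro t ht
    have e1 : Φ ζ t - ζ t =
        -(M * ζ t + k * volterra β A ζ t - F t (c + ∫ s in A..t, ζ s)) / M := by
      simp only [hΦ]; field_simp; ring
    rw [e1, abs_div, abs_neg]
    gcongr
    exact hres t ht
  have hsmall : ε₁ * (2 * (e / |M|)) * E ≤ 2 * E / |M| * e := by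
    have : 0 ≤ 2 * (e / |M|) * E := by positivity
    calc _ = ε₁ * (2 * (e / |M|) * E) := by ring
      _ ≤ 1 * (2 * (e / |M|) * E) := by gcongr
      _ = _ := by ring
  have htube : ∀ p : ℝ → ℝ, Continuous p →
      (∀ t ∈ Icc A S, |p t - ζ t| ≤ 2 * (e / |M|) * Real.exp (l * (t - A))) →
      ∀ t ∈ Icc A S, |(∫ s in A..t, p s) - ∫ s in A..t, ζ s| ≤ 2 * E / |M| * e := by
    intro p hp h t ht
    refine (hInt p ζ hp hζ _ t ht fun s hs => h s ⟨hs.1, hs.2.trans ht.2⟩).trans ?_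
    refine le_trans ?_ hsmall
    gcongr
    exact hexp t ht
  have hy₀t : ∀ t ∈ Icc A S, |(c + ∫ s in A..t, ζ s) - y₀ t| ≤ 1 := fun t _ => by
    simp [hy₀]
  -- The Lipschitz bound is known only in the unit tube around the approximate state, so the
  -- iterates must be kept there. The first step moves `ζ` by at most `e/|M|`, and `(2e/|M|)/4 +
  -- e/|M| ≤ 2e/|M|` closes the induction.
  have hclose : ∀ n, ∀ t ∈ Icc A S, |z n t - ζ t| ≤ 2 * (e / |M|) * Real.exp (l * (t - A)) := by
    intro n
    induction n with
    | zero => intro t _; simp only [hz, Function.iterate_zero, id, sub_self, abs_zero]; positivity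
    | succ n ih =>
      intro t ht
      have h1 := hcontr (z n) ζ (hzc n) hζ _ ih (fun t ht => by
        rw [hy₀]; simp only [add_sub_add_left_eq_sub]
        exact (htube (z n) (hzc n) ih t ht).trans he) hy₀t t ht
      rw [hzs]
      have h2 := abs_sub_le (Φ (z n) t) (Φ ζ t) (ζ t)
      have h3 : e / |M| ≤ e / |M| * Real.exp (l * (t - A)) :=
        le_mul_of_one_le_right (by positivity) (hexp1 t ht)
      have h4 := h0 t ht
      have h5 : 0 ≤ e / |M| * Real.exp (l * (t - A)) := by positivity
      linarith
  have htz : ∀ n, ∀ t ∈ Icc A S, |(c + ∫ s in A..t, z n s) - y₀ t| ≤ 1 := by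
    intro n t ht
    rw [hy₀]; simp only [add_sub_add_left_eq_sub]
    exact (htube (z n) (hzc n) (hclose n) t ht).trans he
  have hcauchy : UnifCauchy A S z := by
    refine unifCauchy_of_recursion (l := l) (R := 4 * (e / |M|)) hlpos.le ?_ ?_
    · intro n m t ht
      have h1 := abs_sub_le (z n t) (ζ t) (z m t)
      have h2 := hclose n t ht
      have h3 := hclose m t ht
      rw [abs_sub_comm] at h3
      linarith
    · intro ε hε
      refine ⟨0, fun K _ r hr n hn m hm t ht => ?_⟩
      have hr0 : 0 ≤ r := by
        have := (abs_nonneg _).trans (hr K le_rfl K le_rfl A ⟨le_rfl, hAS⟩)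
        simpa using this
      rw [hzs, hzs]
      refine (hcontr _ _ (hzc n) (hzc m) r (fun t ht => hr n hn m hm t ht) (htz n) (htz m)
        t ht).trans ?_
      gcongr
      linarith
  obtain ⟨w, hwc, hw⟩ := hcauchy.exists_unifConv hAS hzc
  refine ⟨w, hwc, fun t ht => ?_, fun t ht => ?_, fun t ht => ?_⟩
  · have l1 : Tendsto (fun n => z (n + 1) t) atTop (𝓝 (w t)) :=
      (hw.tendsto ht).comp (tendsto_add_atTop_nat 1)
    have l2 : Tendsto (fun n => z (n + 1) t) atTop (𝓝 (Φ w t)) := by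
      simp only [hzs, hΦ]
      refine Tendsto.div_const (Tendsto.sub ?_ ?_) M
      · exact (hF.tendsto (t, c + ∫ s in A..t, w s)).comp (tendsto_const_nhds.prodMk_nhds
          ((integral_tendsto hzc hwc hw ht).const_add c))
      · exact (volterra_tendsto hβ hzc hwc hw ht).const_mul k
    have h := tendsto_nhds_unique l1 l2
    simp only [hΦ] at h
    rw [eq_div_iff hM] at h
    linarith
  · refine le_of_tendsto (((hw.tendsto ht).sub_const (ζ t)).abs)
      (Eventually.of_forall fun n => (hclose n t ht).trans ?_)
    calc _ ≤ 2 * (e / |M|) * E := by gcongr; exact hexp t ht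
      _ = _ := by ring
  · refine le_of_tendsto (((integral_tendsto hzc hwc hw ht).sub_const _).abs)
      (Eventually.of_forall fun n => htube (z n) (hzc n) (hclose n) t ht)

lemma exists_unif_modulus {G : ℝ → ℝ → ℝ} (hG : Continuous fun q : ℝ × ℝ => G q.1 q.2)
    (A S m : ℝ) {ε : ℝ} (hε : 0 < ε) :
    ∃ δ > 0, ∀ t ∈ Icc A S, ∀ η ∈ Icc (-m) m, ∀ η' ∈ Icc (-m) m,
      |η - η'| ≤ δ → |G t η - G t η'| ≤ ε := by
  have hK : IsCompact (Icc A S ×ˢ Icc (-m) m) := isCompact_Icc.prod isCompact_Icc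
  have hu := hK.uniformContinuousOn_of_continuous hG.continuousOn
  rw [Metric.uniformContinuousOn_iff] at hu
  obtain ⟨δ, hδ, h⟩ := hu ε hε
  refine ⟨δ / 2, half_pos hδ, fun t ht η hη η' hη' hd => ?_⟩
  have := h (t, η) ⟨ht, hη⟩ (t, η') ⟨ht, hη'⟩ (by
    rw [Prod.dist_eq, dist_self, Real.dist_eq]
    exact max_lt hδ (by linarith))
  exact this.le

/-- Solvability of `k V z = F(t, c + ∫ z)`, `V` the kernel of order `1-α`, near an approximate
solution, for `F` continuously differentiable. -/
lemma exists_solution_of_kernel {k α A S Λ : ℝ} (hk : k ≠ 0) (hα : α ∈ Ioo (0 : ℝ) 1)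
    (hAS : A ≤ S) (hΛ : 0 ≤ Λ) :
    ∃ C > 0, ∀ (F Ft Fη : ℝ → ℝ → ℝ) (ζ : ℝ → ℝ) (c e : ℝ),
      Continuous (fun q : ℝ × ℝ => F q.1 q.2) → Continuous (fun q : ℝ × ℝ => Ft q.1 q.2) →
      Continuous (fun q : ℝ × ℝ => Fη q.1 q.2) → Continuous ζ → F A c = 0 →
      (∀ z : ℝ → ℝ, Continuous z → ∀ t ∈ Icc A S, F t (c + ∫ s in A..t, z s) - F A c =
        ∫ s in A..t, (Ft s (c + ∫ r in A..s, z r) + Fη s (c + ∫ r in A..s, z r) * z s)) →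
      (∀ t ∈ Icc A S, ∀ η η', |η - (c + ∫ s in A..t, ζ s)| ≤ 1 →
        |η' - (c + ∫ s in A..t, ζ s)| ≤ 1 → |F t η - F t η'| ≤ Λ * |η - η'|) →
      (∀ t ∈ Icc A S, ∀ η, |η - (c + ∫ s in A..t, ζ s)| ≤ 1 → |Fη t η| ≤ Λ) →
      (∀ t ∈ Icc A S, |k * volterra (1 - α) A ζ t - F t (c + ∫ s in A..t, ζ s)| ≤ e) →
      C * e ≤ 1 →
      ∃ z, Continuous z ∧ z A = 0 ∧
        (∀ t ∈ Icc A S, k * volterra (1 - α) A z t = F t (c + ∫ s in A..t, z s)) ∧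
        ∀ t ∈ Icc A S, |(∫ s in A..t, z s) - ∫ s in A..t, ζ s| ≤ C * e := by
  have hk' : 0 < |k| := abs_pos.2 hk
  have hα' : 1 - α ∈ Ioo (0 : ℝ) 1 := ⟨by linarith [hα.2], by linarith [hα.1]⟩
  set B := betaConst (1 - α) with hB
  set B₂ := betaConst α with hB₂
  have hBpos : 0 < B := betaConst_pos hα'
  have hB₂pos : 0 < B₂ := betaConst_pos hα
  -- The two constants agree by the symmetry `r ↦ 1 - r`; the minimum makes that identity
  -- unnecessary.
  set b := min B B₂ with hb
  have hbpos : 0 < b := lt_min hBpos hB₂pos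
  set ε₁ := |k| * b / (4 * (Λ + 1)) with hε₁
  have hε₁pos : 0 < ε₁ := by positivity
  have hkey : (Λ + 1) * ε₁ = |k| * b / 4 := by
    rw [hε₁]; field_simp
  obtain ⟨l, hlpos, hV⟩ := exists_volterra_exp_bound hα.1 hε₁pos
  specialize hV l le_rfl
  set E := Real.exp (l * (S - A)) with hE
  have hEpos : 0 < E := Real.exp_pos _
  have hexp : ∀ t ∈ Icc A S, Real.exp (l * (t - A)) ≤ E := fun t ht =>
    Real.exp_le_exp.2 (mul_le_mul_of_nonneg_left (by linarith [ht.2]) hlpos.le)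
  have hexp1 : ∀ t, A ≤ t → 1 ≤ Real.exp (l * (t - A)) := fun t ht =>
    Real.one_le_exp (mul_nonneg hlpos.le (by linarith))
  refine ⟨E, hEpos, fun F Ft Fη ζ c e hF hFt hFη hζ hFA hFTC hLip hΛη hres he => ?_⟩
  have he0 : 0 ≤ e := (abs_nonneg _).trans (hres A ⟨le_rfl, hAS⟩)
  set Y : (ℝ → ℝ) → ℝ → ℝ := fun z t => c + ∫ s in A..t, z s with hY
  have hYc : ∀ z, Continuous z → Continuous (Y z) := fun z hz => continuous_primitive' hz A c
  set g : (ℝ → ℝ) → ℝ → ℝ := fun z s => Ft s (Y z s) + Fη s (Y z s) * z s with hg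
  have hgc : ∀ z, Continuous z → Continuous (g z) := fun z hz =>
    (hFt.comp (continuous_id.prodMk (hYc z hz))).add
      ((hFη.comp (continuous_id.prodMk (hYc z hz))).mul hz)
  -- Since `F` vanishes at `(A,c)`, along the path it is the primitive of `g z`. The kernel of order
  -- `1-α` sends `volterra α A (g z)` to `B` times that primitive, so a fixed point of `Φ` solves
  -- the equation of the first kind.
  set Φ : (ℝ → ℝ) → ℝ → ℝ := fun z t => volterra α A (g z) t / (k * B) with hΦ
  have hΦc : ∀ z, Continuous z → Continuous (Φ z) := fun z hz =>
    (continuous_volterra hα.1 A (hgc z hz)).div_const _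
  set z : ℕ → ℝ → ℝ := fun n => Φ^[n] ζ with hz
  have hzs : ∀ n, z (n + 1) = Φ (z n) := fun n => Function.iterate_succ_apply' _ _ _
  have hzc : ∀ n, Continuous (z n) := by
    intro n
    induction n with
    | zero => exact hζ
    | succ n ih => rw [hzs]; exact hΦc _ ih
  -- the kernel applied to the new iterate
  have hVΦ : ∀ p, Continuous p → ∀ t ∈ Icc A S,
      k * volterra (1 - α) A (Φ p) t = F t (Y p t) := by
    intro p hp t ht
    have h1 : volterra (1 - α) A (Φ p) t = (1 / (k * B)) * (B * ∫ s in A..t, g p s) := by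
      have h2 := volterra_volterra hα' ht.1 (hgc p hp)
      rw [show 1 - (1 - α) = α by ring] at h2
      rw [hB, ← h2, ← volterra_const_mul]
      refine congrArg (fun q => volterra (1 - α) A q t) (funext fun s => ?_)
      simp only [hΦ, hB]; ring
    have h3 := hFTC p hp t ht
    rw [h1, ← h3, hFA]
    field_simp; ring
  -- differences of primitives through the kernel
  have hYdiff : ∀ p q, Continuous p → Continuous q → ∀ t ∈ Icc A S,
      Y p t - Y q t = volterra α A
        (fun s => volterra (1 - α) A p s - volterra (1 - α) A q s) t / B₂ := by
    intro p q hp hq t ht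
    rw [volterra_sub hα.1 (continuous_volterra hα'.1 A hp) (continuous_volterra hα'.1 A hq),
      volterra_volterra hα ht.1 hp, volterra_volterra hα ht.1 hq, ← hB₂]
    simp only [hY]; field_simp; ring
  -- The primitives contract on their own: applying the kernel of order `1-α` to a new iterate gives
  -- `F` at the old primitive, where only the Lipschitz bound on `F` is needed, and the kernel of
  -- order `α` recovers the new primitive.
  have hYbound : ∀ p q, Continuous p → Continuous q → ∀ r, ∀ t ∈ Icc A S,
      (∀ s ∈ Icc A t, |k * volterra (1 - α) A p s - k * volterra (1 - α) A q s| ≤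
        (Λ + 1) * r * Real.exp (l * (s - A))) →
      |Y p t - Y q t| ≤ r / 4 * Real.exp (l * (t - A)) := by
    intro p q hp hq r t ht h
    have hr : 0 ≤ r := by
      have h1 := (abs_nonneg _).trans (h A ⟨le_rfl, ht.1⟩)
      simp only [sub_self, mul_zero, Real.exp_zero, mul_one] at h1
      exact nonneg_of_mul_nonneg_right h1 (by positivity)
    have h1 := hV A t ((Λ + 1) * r / |k|)
      (fun s => volterra (1 - α) A p s - volterra (1 - α) A q s) ht.1 (fun s hs => by
        have := h s hs
        rw [← mul_sub, abs_mul] at this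
        rw [div_mul_eq_mul_div, le_div_iff₀ hk', mul_comm]
        exact this)
    rw [hYdiff p q hp hq t ht, abs_div, abs_of_pos hB₂pos, div_le_iff₀ hB₂pos]
    refine h1.trans ?_
    calc ε₁ * ((Λ + 1) * r / |k|) * Real.exp (l * (t - A))
        = (Λ + 1) * ε₁ / |k| * (r * Real.exp (l * (t - A))) := by ring
      _ = b / 4 * (r * Real.exp (l * (t - A))) := by rw [hkey]; field_simp
      _ ≤ B₂ / 4 * (r * Real.exp (l * (t - A))) := by gcongr; exact min_le_right _ _
      _ = _ := by ring
  have hclose : ∀ n, ∀ t ∈ Icc A S, |Y (z n) t - Y ζ t| ≤ e * Real.exp (l * (t - A)) := by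
    intro n
    induction n with
    | zero => intro t _; simp only [hz, Function.iterate_zero, id, sub_self, abs_zero]; positivity
    | succ n ih =>
      intro t ht
      have h1 : |Y (z (n + 1)) t - Y ζ t| ≤ e / 4 * Real.exp (l * (t - A)) := by
        -- In the factor `Λ + 1`, the `Λ` comes from the Lipschitz bound at the previous primitive
        -- and the `1` from the residual of `ζ`.
        refine hYbound _ _ (hzc _) hζ e t ht fun s hs => ?_
        have hs' : s ∈ Icc A S := ⟨hs.1, hs.2.trans ht.2⟩
        rw [hzs, hVΦ _ (hzc n) s hs']
        have h2 := hLip s hs' (Y (z n) s) (Y ζ s)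
          ((ih s hs').trans ((by gcongr; exact hexp s hs' : _ ≤ e * E).trans (by linarith)))
          (by simp [hY])
        have h3 := hres s hs'
        rw [abs_sub_comm] at h3
        have h4 := abs_sub_le (F s (Y (z n) s)) (F s (Y ζ s)) (k * volterra (1 - α) A ζ s)
        have h5 : e ≤ e * Real.exp (l * (s - A)) := le_mul_of_one_le_right he0 (hexp1 s hs.1)
        have h6 : Λ * |Y (z n) s - Y ζ s| ≤ Λ * (e * Real.exp (l * (s - A))) := by
          gcongr; exact ih s hs'
        calc _ ≤ _ := h4
          _ ≤ Λ * (e * Real.exp (l * (s - A))) + e * Real.exp (l * (s - A)) :=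
            add_le_add (h2.trans h6) (h3.trans h5)
          _ = _ := by ring
      refine h1.trans ?_
      gcongr
      linarith
  have hclose' : ∀ n, ∀ t ∈ Icc A S, |Y (z n) t - Y ζ t| ≤ E * e := fun n t ht =>
    (hclose n t ht).trans (by rw [mul_comm E]; gcongr; exact hexp t ht)
  have htube : ∀ n, ∀ t ∈ Icc A S, |Y (z n) t - Y ζ t| ≤ 1 := fun n t ht =>
    (hclose' n t ht).trans he
  -- the primitives are uniformly Cauchy
  have hYcauchy : UnifCauchy A S (fun n => Y (z n)) := by
    refine unifCauchy_of_recursion (l := l) (R := 2 * e) hlpos.le ?_ ?_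
    · intro n m t ht
      have h1 := abs_sub_le (Y (z n) t) (Y ζ t) (Y (z m) t)
      have h2 := hclose n t ht
      have h3 := hclose m t ht
      rw [abs_sub_comm] at h3
      linarith
    · intro ε hε
      refine ⟨0, fun K _ r hr n hn m hm t ht => ?_⟩
      have hr0 : 0 ≤ r := by
        have := (abs_nonneg _).trans (hr K le_rfl K le_rfl A ⟨le_rfl, hAS⟩)
        simpa using this
      have h1 : |Y (z (n + 1)) t - Y (z (m + 1)) t| ≤ r / 4 * Real.exp (l * (t - A)) := by
        refine hYbound _ _ (hzc _) (hzc _) r t ht fun s hs => ?_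
        have hs' : s ∈ Icc A S := ⟨hs.1, hs.2.trans ht.2⟩
        rw [hzs, hzs, hVΦ _ (hzc n) s hs', hVΦ _ (hzc m) s hs']
        refine (hLip s hs' _ _ (htube n s hs') (htube m s hs')).trans ?_
        have h3 := hr n hn m hm s hs'
        calc Λ * |Y (z n) s - Y (z m) s| ≤ Λ * (r * Real.exp (l * (s - A))) := by gcongr
          _ ≤ (Λ + 1) * (r * Real.exp (l * (s - A))) := by gcongr; linarith
          _ = _ := by ring
      refine h1.trans ?_
      gcongr
      linarith
  -- bounds on the tube
  obtain ⟨m₀, hm₀⟩ := (isCompact_Icc (a := A) (b := S)).exists_bound_of_continuousOn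
    (hYc ζ hζ).continuousOn
  set m := m₀ + 1 with hm
  have hYm : ∀ n, ∀ t ∈ Icc A S, Y (z n) t ∈ Icc (-m) m := by
    intro n t ht
    have h1 := abs_le.1 (htube n t ht)
    have h2 := abs_le.1 (hm₀ t ht)
    constructor <;> linarith [h1.1, h1.2, h2.1, h2.2]
  obtain ⟨c₀, hc₀⟩ := (isCompact_Icc.prod isCompact_Icc :
    IsCompact (Icc A S ×ˢ Icc (-m) m)).exists_bound_of_continuousOn hFt.continuousOn
  obtain ⟨c₁, hc₁⟩ := (isCompact_Icc (a := A) (b := S)).exists_bound_of_continuousOn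
    hζ.continuousOn
  set R := max (max c₀ c₁) 0 with hR
  have hR0 : 0 ≤ R := le_max_right _ _
  have hΦbound : ∀ p q : ℝ → ℝ, ∀ r, 0 ≤ r → ∀ t ∈ Icc A S, Continuous p → Continuous q →
      (∀ s ∈ Icc A t, |p s - q s| ≤ (Λ + 1) * r * Real.exp (l * (s - A))) →
      |volterra α A p t / (k * B) - volterra α A q t / (k * B)| ≤
        r / 4 * Real.exp (l * (t - A)) := by
    intro p q r hr t ht hp hq h
    rw [← sub_div, ← volterra_sub hα.1 hp hq, abs_div, abs_mul, abs_of_pos hBpos,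
      div_le_iff₀ (by positivity)]
    refine (hV A t _ _ ht.1 h).trans ?_
    calc ε₁ * ((Λ + 1) * r) * Real.exp (l * (t - A))
        = ((Λ + 1) * ε₁) * (r * Real.exp (l * (t - A))) := by ring
      _ = (|k| * b / 4) * (r * Real.exp (l * (t - A))) := by rw [hkey]
      _ ≤ (|k| * B / 4) * (r * Real.exp (l * (t - A))) := by gcongr; exact min_le_left _ _
      _ = _ := by ring
  have hzbound : ∀ n, ∀ t ∈ Icc A S, |z n t| ≤ R * Real.exp (l * (t - A)) := by
    intro n
    induction n with
    | zero =>
      intro t ht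
      refine (hc₁ t ht).trans ?_
      exact ((le_max_right _ _).trans (le_max_left _ _)).trans
        (le_mul_of_one_le_right hR0 (hexp1 t ht.1))
    | succ n ih =>
      intro t ht
      have h1 := hΦbound (g (z n)) (fun _ => 0) R hR0 t ht (hgc _ (hzc n)) continuous_const (by
        intro s hs
        have hs' : s ∈ Icc A S := ⟨hs.1, hs.2.trans ht.2⟩
        have h2 : |Ft s (Y (z n) s)| ≤ R :=
          (hc₀ (s, Y (z n) s) ⟨hs', hYm n s hs'⟩).trans
            ((le_max_left _ _).trans (le_max_left _ _))
        have h3 := hΛη s hs' _ (htube n s hs')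
        have h4 := ih s hs'
        rw [sub_zero]
        calc |g (z n) s| ≤ |Ft s (Y (z n) s)| + |Fη s (Y (z n) s)| * |z n s| := by
              rw [← abs_mul]; exact abs_add_le _ _
          _ ≤ R * Real.exp (l * (s - A)) + Λ * (R * Real.exp (l * (s - A))) := by
              refine add_le_add (h2.trans (le_mul_of_one_le_right hR0 (hexp1 s hs.1))) ?_
              gcongr
          _ = _ := by ring)
      have h0 : volterra α A (fun _ => 0) t = 0 := by simp [volterra]
      rw [h0, zero_div, sub_zero] at h1
      rw [hzs]
      refine h1.trans ?_
      gcongr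
      linarith
  have hzcauchy : UnifCauchy A S z := by
    refine unifCauchy_of_recursion (l := l) (R := 2 * R) hlpos.le ?_ ?_
    · intro n m t ht
      have h1 := abs_sub (z n t) (z m t)
      linarith [hzbound n t ht, hzbound m t ht]
    · intro ε hε
      -- The partial derivatives of `F` are merely continuous, so `Φ` need not contract. Their
      -- increments are small because the primitives are already uniformly Cauchy: the additive
      -- error is `ε₂ + ε₂ R E = ε`, with `R E` bounding the iterates.
      set ε₂ := ε / (1 + R * E) with hε₂
      have hε₂pos : 0 < ε₂ := by positivity
      obtain ⟨δ₁, hδ₁, hmod₁⟩ := exists_unif_modulus hFt A S m hε₂pos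
      obtain ⟨δ₂, hδ₂, hmod₂⟩ := exists_unif_modulus hFη A S m hε₂pos
      obtain ⟨K₀, hK₀⟩ := hYcauchy (min δ₁ δ₂) (lt_min hδ₁ hδ₂)
      refine ⟨K₀, fun K hK r hr n hn j hj t ht => ?_⟩
      have hr0 : 0 ≤ r := by
        have := (abs_nonneg _).trans (hr K le_rfl K le_rfl A ⟨le_rfl, hAS⟩)
        simpa using this
      have h1 := hΦbound (g (z n)) (g (z j)) (ε + r) (by positivity) t ht (hgc _ (hzc n))
        (hgc _ (hzc j)) (by
        intro s hs
        have hs' : s ∈ Icc A S := ⟨hs.1, hs.2.trans ht.2⟩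
        have hd := hK₀ n (hK.trans hn) j (hK.trans hj) s hs'
        have h2 := hmod₁ s hs' _ (hYm n s hs') _ (hYm j s hs') (hd.trans (min_le_left _ _))
        have h3 := hmod₂ s hs' _ (hYm n s hs') _ (hYm j s hs') (hd.trans (min_le_right _ _))
        have h4 := hΛη s hs' _ (htube j s hs')
        have h5 := hr n hn j hj s hs'
        have h6 : |z n s| ≤ R * E :=
          (hzbound n s hs').trans (by gcongr; exact hexp s hs')
        have e1 : g (z n) s - g (z j) s = (Ft s (Y (z n) s) - Ft s (Y (z j) s)) +
            (Fη s (Y (z n) s) - Fη s (Y (z j) s)) * z n s +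
            Fη s (Y (z j) s) * (z n s - z j s) := by
          simp only [hg]; ring
        rw [e1]
        refine (abs_add_le _ _).trans ?_
        refine (add_le_add_left (abs_add_le _ _) _).trans ?_
        rw [abs_mul, abs_mul]
        calc _ ≤ ε₂ + ε₂ * (R * E) + Λ * (r * Real.exp (l * (s - A))) := by gcongr
          _ = ε + Λ * (r * Real.exp (l * (s - A))) := by rw [hε₂]; field_simp
          _ ≤ ε * Real.exp (l * (s - A)) + Λ * (r * Real.exp (l * (s - A))) := by
              gcongr; exact le_mul_of_one_le_right hε.le (hexp1 s hs.1)
          _ ≤ (Λ + 1) * (ε + r) * Real.exp (l * (s - A)) := by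
              have h7 : 0 ≤ ε * Real.exp (l * (s - A)) := by positivity
              have h8 : 0 ≤ r * Real.exp (l * (s - A)) := by positivity
              have h9 := mul_nonneg hΛ h7
              linarith)
      rw [hzs, hzs]
      refine h1.trans ?_
      gcongr
      linarith
  obtain ⟨w, hwc, hw⟩ := hzcauchy.exists_unifConv hAS hzc
  have hYlim : ∀ t ∈ Icc A S, Tendsto (fun n => Y (z n) t) atTop (𝓝 (Y w t)) := fun t ht =>
    (integral_tendsto hzc hwc hw ht).const_add c
  refine ⟨w, hwc, ?_, fun t ht => ?_, fun t ht => ?_⟩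
  -- Every iterate after `ζ` is a multiple of a Volterra integral, which vanishes at `A`; `ζ` itself
  -- need not.
  · have l1 : Tendsto (fun n => z (n + 1) A) atTop (𝓝 (w A)) :=
      (hw.tendsto ⟨le_rfl, hAS⟩).comp (tendsto_add_atTop_nat 1)
    have l2 : ∀ n, z (n + 1) A = 0 := fun n => by
      rw [hzs]; simp [hΦ, volterra_eq hα.1 le_rfl]
    simp only [l2] at l1
    exact tendsto_nhds_unique l1 tendsto_const_nhds
  · have l1 : Tendsto (fun n => k * volterra (1 - α) A (z (n + 1)) t) atTop
        (𝓝 (k * volterra (1 - α) A w t)) :=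
      ((volterra_tendsto hα'.1 hzc hwc hw ht).comp (tendsto_add_atTop_nat 1)).const_mul k
    have l2 : Tendsto (fun n => k * volterra (1 - α) A (z (n + 1)) t) atTop
        (𝓝 (F t (Y w t))) := by
      simp only [hzs]
      simp only [fun n => hVΦ (z n) (hzc n) t ht]
      exact (hF.tendsto (t, Y w t)).comp (tendsto_const_nhds.prodMk_nhds (hYlim t ht))
    exact tendsto_nhds_unique l1 l2
  · refine le_of_tendsto (((integral_tendsto hzc hwc hw ht).sub_const _).abs)
      (Eventually.of_forall fun n => ?_)
    have := hclose' n t ht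
    simpa only [hY, add_sub_add_left_eq_sub] using this

/-! ### Density of the history terms. -/

lemma abs_rpow_neg_sub_le {s η : ℝ} (hs : 0 ≤ s) (hη : 0 < η) {u v : ℝ} (hu : η ≤ u)
    (hv : η ≤ v) : |u ^ (-s) - v ^ (-s)| ≤ s * η ^ (-s - 1) * |u - v| := by
  refine Convex.norm_image_sub_le_of_norm_hasDerivWithin_le (s := Ici η)
    (f := fun x : ℝ => x ^ (-s)) (f' := fun x => -s * x ^ (-s - 1)) (fun x hx => ?_)
    (fun x hx => ?_) (convex_Ici η) hv hu
  · exact (Real.hasDerivAt_rpow_const (Or.inl (hη.trans_le hx).ne')).hasDerivWithinAt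
  · rw [norm_mul, norm_neg, Real.norm_of_nonneg hs,
      Real.norm_of_nonneg (Real.rpow_nonneg (hη.le.trans hx) _)]
    exact mul_le_mul_of_nonneg_left (Real.rpow_le_rpow_of_nonpos hη hx (by linarith)) hs

/-- Mean value inequality for the power with its linear part removed; the derivative is controlled
by the preceding lemma with exponent `s + 1`. -/
lemma abs_rpow_neg_taylor_le {s η : ℝ} (hs : 0 ≤ s) (hη : 0 < η) {u v : ℝ} (hu : η ≤ u)
    (hv : η ≤ v) :
    |v ^ (-s) - u ^ (-s) + s * u ^ (-s - 1) * (v - u)| ≤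
      s * ((s + 1) * η ^ (-s - 2)) * |v - u| ^ 2 := by
  have h := Convex.norm_image_sub_le_of_norm_hasDerivWithin_le (s := uIcc u v)
    (f := fun x : ℝ => x ^ (-s) + s * u ^ (-s - 1) * x)
    (f' := fun x => -s * x ^ (-s - 1) + s * u ^ (-s - 1))
    (C := s * ((s + 1) * η ^ (-s - 2) * |v - u|)) (fun x hx => ?_)
    (fun x hx => ?_) (convex_uIcc u v) left_mem_uIcc right_mem_uIcc
  · rw [Real.norm_eq_abs, Real.norm_eq_abs] at h
    calc _ = |v ^ (-s) + s * u ^ (-s - 1) * v - (u ^ (-s) + s * u ^ (-s - 1) * u)| := by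
          congr 1; ring
      _ ≤ _ := h
      _ = _ := by ring
  · have hx' : η ≤ x := (le_inf hu hv).trans hx.1
    have h1 := (Real.hasDerivAt_rpow_const (x := x) (p := -s)
      (Or.inl (hη.trans_le hx').ne')).add ((hasDerivAt_id x).const_mul (s * u ^ (-s - 1)))
    rw [mul_one] at h1
    exact h1.hasDerivWithinAt
  · have hx' : η ≤ x := (le_inf hu hv).trans hx.1
    have h1 := abs_rpow_neg_sub_le (s := s + 1) (by linarith) hη hx' hu
    rw [show -(s + 1) = -s - 1 by ring, show -s - 1 - 1 = -s - 2 by ring] at h1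
    have h2 : |x - u| ≤ |v - u| := abs_sub_left_of_mem_uIcc hx
    rw [show -s * x ^ (-s - 1) + s * u ^ (-s - 1) = -(s * (x ^ (-s - 1) - u ^ (-s - 1))) by ring,
      norm_neg, norm_mul, Real.norm_of_nonneg hs]
    refine mul_le_mul_of_nonneg_left (h1.trans ?_) hs
    gcongr

/-- The contribution to the Caputo derivative at `t ≥ A` of the history of the state on `[a,A]`. -/
noncomputable def historyTerm (α a A : ℝ) (z₀ : ℝ → ℝ) (t : ℝ) : ℝ :=
  ∫ τ in a..A, (t - τ) ^ (-α) * z₀ τ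

/-- `g` is a uniform limit on `[A,S]` of history terms of continuous histories that vanish near
`A`. -/
def HistoryApprox (α a A S : ℝ) (g : ℝ → ℝ) : Prop :=
  ∀ ε > 0, ∃ z₀ : ℝ → ℝ, Continuous z₀ ∧ (∃ η > 0, ∀ τ ≥ A - η, z₀ τ = 0) ∧
    ∀ t ∈ Icc A S, |historyTerm α a A z₀ t - g t| ≤ ε

section

variable {α a A S : ℝ}

lemma historyTerm_intervalIntegrable (hα : α < 1) {z₀ : ℝ → ℝ} (hz : Continuous z₀) (t : ℝ) :
    IntervalIntegrable (fun τ => (t - τ) ^ (-α) * z₀ τ) volume a A := by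
  have h := intervalIntegrable_kernel_mul (β := 1 - α) (by linarith) a A t hz.continuousOn
  rwa [show 1 - α - 1 = -α by ring] at h

lemma historyTerm_add (hα : α < 1) {z₀ z₁ : ℝ → ℝ} (h₀ : Continuous z₀) (h₁ : Continuous z₁)
    (t : ℝ) : historyTerm α a A (fun τ => z₀ τ + z₁ τ) t =
      historyTerm α a A z₀ t + historyTerm α a A z₁ t := by
  simp only [historyTerm, mul_add]
  exact intervalIntegral.integral_add (historyTerm_intervalIntegrable hα h₀ t)
    (historyTerm_intervalIntegrable hα h₁ t)

lemma historyTerm_const_mul (c : ℝ) (z₀ : ℝ → ℝ) (t : ℝ) :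
    historyTerm α a A (fun τ => c * z₀ τ) t = c * historyTerm α a A z₀ t := by
  simp only [historyTerm, mul_left_comm _ c, intervalIntegral.integral_const_mul]

/-- Together with `HistoryApprox.const_mul` and `HistoryApprox.of_close`, this says that the
approximable functions form a uniformly closed vector space. -/
lemma HistoryApprox.add (hα : α < 1) {g₀ g₁ : ℝ → ℝ} (h₀ : HistoryApprox α a A S g₀)
    (h₁ : HistoryApprox α a A S g₁) : HistoryApprox α a A S (fun t => g₀ t + g₁ t) := by
  intro ε hε
  obtain ⟨z₀, hz₀, ⟨η₀, hη₀, hv₀⟩, hb₀⟩ := h₀ (ε / 2) (half_pos hε)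
  obtain ⟨z₁, hz₁, ⟨η₁, hη₁, hv₁⟩, hb₁⟩ := h₁ (ε / 2) (half_pos hε)
  refine ⟨fun τ => z₀ τ + z₁ τ, hz₀.add hz₁, ⟨min η₀ η₁, lt_min hη₀ hη₁, fun τ hτ => ?_⟩,
    fun t ht => ?_⟩
  · beta_reduce
    rw [hv₀ τ (by linarith [min_le_left η₀ η₁]), hv₁ τ (by linarith [min_le_right η₀ η₁]),
      add_zero]
  · rw [historyTerm_add hα hz₀ hz₁, add_sub_add_comm]
    exact (abs_add_le _ _).trans (by linarith [hb₀ t ht, hb₁ t ht])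

lemma HistoryApprox.const_mul {g : ℝ → ℝ} (h : HistoryApprox α a A S g) (c : ℝ) :
    HistoryApprox α a A S (fun t => c * g t) := by
  intro ε hε
  obtain ⟨z₀, hz₀, ⟨η₀, hη₀, hv₀⟩, hb₀⟩ := h (ε / (|c| + 1)) (by positivity)
  refine ⟨fun τ => c * z₀ τ, hz₀.const_mul c, ⟨η₀, hη₀, fun τ hτ => ?_⟩, fun t ht => ?_⟩
  · beta_reduce
    rw [hv₀ τ hτ, mul_zero]
  · rw [historyTerm_const_mul, ← mul_sub, abs_mul]
    calc _ ≤ |c| * (ε / (|c| + 1)) := by gcongr; exact hb₀ t ht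
      _ ≤ (|c| + 1) * (ε / (|c| + 1)) := by gcongr; linarith
      _ = ε := by field_simp

lemma HistoryApprox.of_close {g : ℝ → ℝ}
    (h : ∀ ε > 0, ∃ g', HistoryApprox α a A S g' ∧ ∀ t ∈ Icc A S, |g' t - g t| ≤ ε) :
    HistoryApprox α a A S g := by
  intro ε hε
  obtain ⟨g', hg', hc⟩ := h (ε / 2) (half_pos hε)
  obtain ⟨z₀, hz₀, hv, hb⟩ := hg' (ε / 2) (half_pos hε)
  refine ⟨z₀, hz₀, hv, fun t ht => ?_⟩
  linarith [abs_sub_le (historyTerm α a A z₀ t) (g' t) (g t), hb t ht, hc t ht]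

lemma HistoryApprox.sum (hα : α < 1) {ι : Type*} (s : Finset ι) {g : ι → ℝ → ℝ}
    (h : ∀ i ∈ s, HistoryApprox α a A S (g i)) :
    HistoryApprox α a A S (fun t => ∑ i ∈ s, g i t) := by
  classical
  induction s using Finset.induction_on with
  | empty =>
    intro ε hε
    exact ⟨fun _ => 0, continuous_const, ⟨1, one_pos, fun _ _ => rfl⟩, fun t _ => by
      simp [historyTerm, hε.le]⟩
  | insert i s hi ih =>
    simp only [Finset.sum_insert hi]
    exact (h i (Finset.mem_insert_self _ _)).add hα
      (ih fun j hj => h j (Finset.mem_insert_of_mem hj))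

/-- A normalised bump shrinking to `τ₀` acts as a Dirac mass. As `τ₀ < A`, the kernel is Lipschitz
in `τ` near `τ₀`, uniformly in `t ≥ A`. -/
lemma historyApprox_kernel (hα : α ∈ Ioo (0 : ℝ) 1) {τ₀ : ℝ} (hτ₀ : τ₀ ∈ Ioo a A) :
    HistoryApprox α a A S (fun t => (t - τ₀) ^ (-α)) := by
  intro ε hε
  set η := min (τ₀ - a) (A - τ₀) / 2 with hη
  have hηpos : 0 < η := half_pos (lt_min (by linarith [hτ₀.1]) (by linarith [hτ₀.2]))
  have hη1 : 2 * η ≤ τ₀ - a := by rw [hη]; linarith [min_le_left (τ₀ - a) (A - τ₀)]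
  have hη2 : 2 * η ≤ A - τ₀ := by rw [hη]; linarith [min_le_right (τ₀ - a) (A - τ₀)]
  set Λ := α * η ^ (-α - 1) with hΛ
  have hΛ0 : 0 ≤ Λ := mul_nonneg hα.1.le (Real.rpow_nonneg hηpos.le _)
  set ρ := min η (ε / (Λ + 1)) with hρ
  have hρpos : 0 < ρ := lt_min hηpos (by positivity)
  let b : ContDiffBump τ₀ := ⟨ρ / 2, ρ, half_pos hρpos, by linarith⟩
  have hsupp : ∀ τ, b.normed volume τ ≠ 0 → |τ - τ₀| < ρ := by
    intro τ hτ
    have : τ ∈ Function.support (b.normed volume) := hτ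
    rw [b.support_normed_eq] at this
    simpa [Real.dist_eq] using this
  have hcont : Continuous (b.normed volume) := (b.contDiff_normed (n := 0)).continuous
  have hint : ∫ τ in a..A, b.normed volume τ = 1 := by
    rw [intervalIntegral.integral_eq_integral_of_support_subset, b.integral_normed]
    intro τ hτ
    have h1 := abs_lt.1 (hsupp τ hτ)
    have h2 : ρ ≤ η := min_le_left _ _
    constructor <;> linarith [h1.1, h1.2]
  refine ⟨b.normed volume, hcont, ⟨η, hηpos, fun τ hτ => ?_⟩, fun t ht => ?_⟩
  · by_contra hne
    have h1 := abs_lt.1 (hsupp τ hne)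
    have h2 : ρ ≤ η := min_le_left _ _
    linarith [h1.2]
  · have haA : a ≤ A := (hτ₀.1.trans hτ₀.2).le
    have e1 : historyTerm α a A (b.normed volume) t - (t - τ₀) ^ (-α) =
        ∫ τ in a..A, ((t - τ) ^ (-α) - (t - τ₀) ^ (-α)) * b.normed volume τ := by
      simp only [sub_mul]
      rw [intervalIntegral.integral_sub (historyTerm_intervalIntegrable hα.2 hcont t)
        ((hcont.const_mul _).intervalIntegrable _ _), intervalIntegral.integral_const_mul, hint,
        mul_one]
      rfl
    rw [e1, ← Real.norm_eq_abs]
    have h3 : ∫ τ in a..A, ε * b.normed volume τ = ε := by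
      rw [intervalIntegral.integral_const_mul, hint, mul_one]
    rw [← h3]
    refine intervalIntegral.norm_integral_le_of_norm_le haA (Eventually.of_forall fun τ _ => ?_)
      ((hcont.const_mul _).intervalIntegrable _ _)
    rw [norm_mul, Real.norm_of_nonneg (b.nonneg_normed τ)]
    by_cases hne : b.normed volume τ = 0
    · simp [hne]
    · refine mul_le_mul_of_nonneg_right ?_ (b.nonneg_normed τ)
      have h1 := hsupp τ hne
      have h1' := abs_lt.1 h1
      have h2 : ρ ≤ η := min_le_left _ _
      have h4 := abs_rpow_neg_sub_le hα.1.le hηpos (u := t - τ) (v := t - τ₀)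
        (by linarith [ht.1, h1'.2]) (by linarith [ht.1])
      rw [sub_sub_sub_cancel_left, abs_sub_comm τ₀] at h4
      calc _ ≤ Λ * |τ - τ₀| := h4
        _ ≤ Λ * (ε / (Λ + 1)) := by gcongr; exact h1.le.trans (min_le_right _ _)
        _ ≤ (Λ + 1) * (ε / (Λ + 1)) := by gcongr; linarith
        _ = ε := by field_simp

/-- The quotient `((t-τ-d)^(-s) - (t-τ)^(-s)) / (s d)` is approximable and tends uniformly to
`(t-τ)^(-s-1)` as `d → 0`. Iteration reaches all exponents `-(α+n)`. -/
lemma historyApprox_deriv (hα : α < 1) {s : ℝ} (hs : 0 < s)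
    (h : ∀ τ ∈ Ioo a A, HistoryApprox α a A S (fun t => (t - τ) ^ (-s))) :
    ∀ τ ∈ Ioo a A, HistoryApprox α a A S (fun t => (t - τ) ^ (-s - 1)) := by
  intro τ hτ
  refine HistoryApprox.of_close fun ε hε => ?_
  set η := (A - τ) / 2 with hη
  have hηpos : 0 < η := half_pos (by linarith [hτ.2])
  set Λ := (s + 1) * η ^ (-s - 2) with hΛ
  have hΛ0 : 0 ≤ Λ := mul_nonneg (by linarith) (Real.rpow_nonneg hηpos.le _)
  set d := min η (ε / (Λ + 1)) with hd
  have hdpos : 0 < d := lt_min hηpos (by positivity)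
  have hdη : d ≤ η := min_le_left _ _
  have hτd : τ + d ∈ Ioo a A := ⟨by linarith [hτ.1], by linarith⟩
  refine ⟨fun t => 1 / (s * d) * (t - (τ + d)) ^ (-s) + -(1 / (s * d)) * (t - τ) ^ (-s),
    ((h _ hτd).const_mul _).add hα ((h _ hτ).const_mul _), fun t ht => ?_⟩
  have h1 := abs_rpow_neg_taylor_le hs.le hηpos (u := t - τ) (v := t - (τ + d))
    (by linarith [ht.1]) (by linarith [ht.1])
  rw [show t - (τ + d) - (t - τ) = -d by ring, abs_neg, abs_of_pos hdpos] at h1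
  have e1 : 1 / (s * d) * (t - (τ + d)) ^ (-s) + -(1 / (s * d)) * (t - τ) ^ (-s) -
      (t - τ) ^ (-s - 1) = ((t - (τ + d)) ^ (-s) - (t - τ) ^ (-s) +
        s * (t - τ) ^ (-s - 1) * -d) / (s * d) := by
    field_simp; ring
  rw [e1, abs_div, abs_of_pos (mul_pos hs hdpos), div_le_iff₀ (mul_pos hs hdpos)]
  refine h1.trans ?_
  calc s * Λ * d ^ 2 = (Λ * d) * (s * d) := by ring
    _ ≤ ((Λ + 1) * (ε / (Λ + 1))) * (s * d) := by
        gcongr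
        · linarith
        · exact min_le_right _ _
    _ = ε * (s * d) := by field_simp

lemma historyApprox_kernel_pow (hα : α ∈ Ioo (0 : ℝ) 1) (n : ℕ) :
    ∀ τ ∈ Ioo a A, HistoryApprox α a A S (fun t => (t - τ) ^ (-(α + n))) := by
  induction n with
  | zero => intro τ hτ; simpa using historyApprox_kernel hα hτ
  | succ n ih =>
    have h := historyApprox_deriv hα.2 (s := α + n) (by have := hα.1; positivity) ih
    intro τ hτ
    have := h τ hτ
    rwa [show -(α + n) - 1 = -(α + ((n + 1 : ℕ) : ℝ)) by push_cast; ring] at this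

/-- Every continuous function on `[A,S]` is a uniform limit of history terms. -/
lemma historyApprox_of_continuous (hα : α ∈ Ioo (0 : ℝ) 1) (haA : a < A) (hAS : A ≤ S)
    {r : ℝ → ℝ} (hr : Continuous r) : HistoryApprox α a A S r := by
  obtain ⟨τ, hτ⟩ := nonempty_Ioo.2 haA
  have hA : 0 < A - τ := by linarith [hτ.2]
  have hS : 0 < S - τ := by linarith
  refine HistoryApprox.of_close fun ε hε => ?_
  obtain ⟨c, hc⟩ : ∃ c, ∀ t ∈ Icc A S, |(t - τ) ^ (-α)| ≤ c := by
    refine ⟨(A - τ) ^ (-α), fun t ht => ?_⟩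
    rw [abs_of_nonneg (Real.rpow_nonneg (by linarith [ht.1]) _)]
    exact Real.rpow_le_rpow_of_nonpos hA (by linarith [ht.1]) (by linarith [hα.1])
  have hc0 : 0 ≤ c := (abs_nonneg _).trans (hc A ⟨le_rfl, hAS⟩)
  -- In the variable `s = 1/(t-τ)`, combinations of the `(t-τ)^(-α-n)` are `s^α p(s)` with `p` a
  -- polynomial, so Weierstrass is applied to `s^(-α) r(τ + 1/s)`.
  have hcont : ContinuousOn (fun s : ℝ => r (τ + s⁻¹) * s ^ (-α))
      (Icc (S - τ)⁻¹ (A - τ)⁻¹) := by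
    have hne : ∀ s ∈ Icc (S - τ)⁻¹ (A - τ)⁻¹, s ≠ 0 := fun s hs =>
      ((inv_pos.2 hS).trans_le hs.1).ne'
    exact (hr.comp_continuousOn (continuousOn_const.add (continuousOn_id.inv₀ hne))).mul
      (continuousOn_id.rpow_const fun s hs => Or.inl (hne s hs))
  obtain ⟨p, hp⟩ := exists_polynomial_near_of_continuousOn _ _ _ hcont (ε / (c + 1))
    (by positivity)
  refine ⟨fun t => ∑ n ∈ Finset.range (p.natDegree + 1), p.coeff n * (t - τ) ^ (-(α + n)),
    HistoryApprox.sum hα.2 _ fun n _ => (historyApprox_kernel_pow hα n τ hτ).const_mul _,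
    fun t ht => ?_⟩
  have ht0 : 0 < t - τ := by linarith [ht.1]
  have h1 := hp (t - τ)⁻¹ ⟨inv_anti₀ ht0 (by linarith [ht.2]),
    inv_anti₀ hA (by linarith [ht.1])⟩
  have e1 : ∑ n ∈ Finset.range (p.natDegree + 1), p.coeff n * (t - τ) ^ (-(α + n)) =
      (t - τ) ^ (-α) * p.eval (t - τ)⁻¹ := by
    rw [Polynomial.eval_eq_sum_range, Finset.mul_sum]
    refine Finset.sum_congr rfl fun n _ => ?_
    rw [neg_add, Real.rpow_add ht0, Real.rpow_neg ht0.le (n : ℝ), Real.rpow_natCast, inv_pow]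
    ring
  have e2 : r t = (t - τ) ^ (-α) * (r (τ + (t - τ)⁻¹⁻¹) * ((t - τ)⁻¹) ^ (-α)) := by
    rw [inv_inv, Real.inv_rpow ht0.le, show τ + (t - τ) = t by ring, mul_left_comm,
      mul_inv_cancel₀ (Real.rpow_pos_of_pos ht0 _).ne', mul_one]
  simp only
  rw [e1, e2, ← mul_sub, abs_mul]
  calc _ ≤ c * (ε / (c + 1)) := by gcongr; exact hc t ht
    _ ≤ (c + 1) * (ε / (c + 1)) := by gcongr; linarith
    _ = ε := by field_simp

/-- Approximation of `r` by a history term with the exact value at `A`. -/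
lemma exists_history (hα : α ∈ Ioo (0 : ℝ) 1) (haA : a < A) (hAS : A ≤ S)
    {r : ℝ → ℝ} (hr : Continuous r) {ε : ℝ} (hε : 0 < ε) :
    ∃ z₀ : ℝ → ℝ, Continuous z₀ ∧ (∃ η > 0, ∀ τ ≥ A - η, z₀ τ = 0) ∧
      historyTerm α a A z₀ A = r A ∧
      ∀ t ∈ Icc A S, |historyTerm α a A z₀ t - r t| ≤ ε := by
  obtain ⟨z₁, hz₁, ⟨η₁, hη₁, hv₁⟩, hb₁⟩ :=
    historyApprox_of_continuous hα haA hAS (r := fun _ => 1) continuous_const (1 / 2) (by norm_num)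
  obtain ⟨z₂, hz₂, ⟨η₂, hη₂, hv₂⟩, hb₂⟩ :=
    historyApprox_of_continuous hα haA hAS hr (ε / 4) (by positivity)
  have hA : A ∈ Icc A S := ⟨le_rfl, hAS⟩
  have h1 := abs_le.1 (hb₁ A hA)
  have hpos : 1 / 2 ≤ historyTerm α a A z₁ A := by linarith [h1.1]
  -- A multiple of `z₁`, whose history term lies within `1/2` of `1`, corrects the value at `A`.
  -- Here `|c| ≤ (ε/4)/(1/2)`, so the error is at most `ε/4 + (ε/2)(3/2) = ε`.
  set c := (r A - historyTerm α a A z₂ A) / historyTerm α a A z₁ A with hc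
  have hcb : |c| ≤ ε / 2 := by
    rw [hc, abs_div, abs_of_pos (by linarith : 0 < historyTerm α a A z₁ A),
      div_le_iff₀ (by linarith), abs_sub_comm]
    nlinarith [hb₂ A hA]
  have hcz : Continuous fun τ => c * z₁ τ := hz₁.const_mul c
  refine ⟨fun τ => z₂ τ + c * z₁ τ, hz₂.add hcz,
    ⟨min η₁ η₂, lt_min hη₁ hη₂, fun τ hτ => ?_⟩, ?_, fun t ht => ?_⟩
  · simp only
    rw [hv₁ τ (by linarith [min_le_left η₁ η₂]), hv₂ τ (by linarith [min_le_right η₁ η₂])]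
    ring
  · rw [historyTerm_add hα.2 hz₂ hcz, historyTerm_const_mul, hc,
      div_mul_cancel₀ _ (by linarith)]
    ring
  · rw [historyTerm_add hα.2 hz₂ hcz, historyTerm_const_mul, add_sub_right_comm]
    have h2 := abs_le.1 (hb₁ t ht)
    have h3 : |historyTerm α a A z₁ t| ≤ 3 / 2 :=
      abs_le.2 ⟨by linarith [h2.1], by linarith [h2.2]⟩
    refine (abs_add_le _ _).trans ?_
    rw [abs_mul]
    have h4 : |c| * |historyTerm α a A z₁ t| ≤ ε / 2 * (3 / 2) := by gcongr
    linarith [hb₂ t ht]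

end

/-- As the history vanishes within `η` of `A`, replacing `t-τ` by `max (t-τ) η` removes the
singularity without changing the integral for `t ≥ A`. The primitive formula follows by exchanging
integrals and integrating in `s` for each fixed `τ`. -/
lemma exists_primitive_historyTerm {α a A : ℝ} (haA : a ≤ A) {z₀ : ℝ → ℝ}
    (hz₀ : Continuous z₀) {η : ℝ} (hη : 0 < η) (hv : ∀ τ ≥ A - η, z₀ τ = 0) :
    ∃ κ κ' : ℝ → ℝ, Continuous κ ∧ Continuous κ' ∧
      (∀ t ≥ A, κ t = historyTerm α a A z₀ t) ∧
      ∀ t ≥ A, κ t - κ A = ∫ s in A..t, κ' s := by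
  have hne : ∀ x : ℝ, max x η ≠ 0 := fun x => (lt_max_of_lt_right hη).ne'
  have hc : ∀ p : ℝ, Continuous fun q : ℝ × ℝ => (max (q.1 - q.2) η) ^ p * z₀ q.2 := fun p =>
    (Continuous.rpow_const (by fun_prop) fun q => Or.inl (hne _)).mul (hz₀.comp continuous_snd)
  have hκ : ∀ t ≥ A, ∀ τ ∈ Icc a A, 
      (max (t - τ) η) ^ (-α) * z₀ τ = (t - τ) ^ (-α) * z₀ τ := by
    intro t ht τ hτ
    by_cases h : A - η ≤ τ
    · simp [hv τ h]
    · rw [max_eq_left (by linarith)]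
  have hκe : ∀ t ≥ A, (∫ τ in a..A, (max (t - τ) η) ^ (-α) * z₀ τ) = historyTerm α a A z₀ t := by
    intro t ht
    refine intervalIntegral.integral_congr fun τ hτ => ?_
    rw [uIcc_of_le haA] at hτ
    exact hκ t ht τ hτ
  refine ⟨fun t => ∫ τ in a..A, (max (t - τ) η) ^ (-α) * z₀ τ,
    fun t => ∫ τ in a..A, -α * ((max (t - τ) η) ^ (-α - 1) * z₀ τ), ?_, ?_, hκe, ?_⟩
  · exact intervalIntegral.continuous_parametric_intervalIntegral_of_continuous' (hc _) _ _
  · exact intervalIntegral.continuous_parametric_intervalIntegral_of_continuous'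
      (f := fun t τ => -α * ((max (t - τ) η) ^ (-α - 1) * z₀ τ)) ((hc _).const_mul _) _ _
  · intro t ht
    have hsw := intervalIntegral_integral_swap (a := A) (b := t)
      (f := fun s τ => -α * ((max (s - τ) η) ^ (-α - 1) * z₀ τ))
      (μ := volume.restrict (Ioc a A)) (by
        rw [uIoc_of_le ht, Measure.prod_restrict]
        refine (ContinuousOn.integrableOn_compact (isCompact_Icc.prod isCompact_Icc)
          ((hc (-α - 1)).const_mul (-α)).continuousOn).mono_set
          (prod_mono Ioc_subset_Icc_self Ioc_subset_Icc_self))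
    simp only [intervalIntegral.integral_of_le haA] at hsw ⊢
    rw [hsw, ← MeasureTheory.integral_sub]
    · refine setIntegral_congr_fun measurableSet_Ioc fun τ hτ => ?_
      have hτ' : τ ∈ Icc a A := ⟨hτ.1.le, hτ.2⟩
      simp only [hκ t ht τ hτ', hκ A le_rfl τ hτ']
      by_cases h : A - η ≤ τ
      · simp [hv τ h]
      · push Not at h
        have hd : ∀ s ∈ uIcc A t, HasDerivAt (fun s => (s - τ) ^ (-α) * z₀ τ)
            (-α * ((max (s - τ) η) ^ (-α - 1) * z₀ τ)) s := by
          intro s hs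
          rw [uIcc_of_le ht] at hs
          have h0 : s - τ ≠ 0 := by linarith [hs.1]
          rw [max_eq_left (by linarith [hs.1])]
          have := (((hasDerivAt_id s).sub_const τ).rpow_const (p := -α) (Or.inl h0)).mul_const
            (z₀ τ)
          refine this.congr_deriv ?_
          simp only [id_eq]; ring
        rw [intervalIntegral.integral_eq_sub_of_hasDerivAt hd]
        exact Continuous.intervalIntegrable
          (((hc (-α - 1)).comp (continuous_id.prodMk continuous_const)).const_mul _) _ _
    · exact ((hc (-α)).comp (continuous_const.prodMk continuous_id)).integrableOn_Ioc
    · exact ((hc (-α)).comp (continuous_const.prodMk continuous_id)).integrableOn_Ioc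

/-! ### Primitives as admissible states, and partial derivatives along a path. -/

lemma hasDerivAt_primitive {z : ℝ → ℝ} (hz : Continuous z) (A c t : ℝ) :
    HasDerivAt (fun t => c + ∫ s in A..t, z s) (z t) t :=
  (intervalIntegral.integral_hasDerivAt_right (hz.intervalIntegrable _ _)
    (hz.stronglyMeasurableAtFilter _ _) hz.continuousAt).const_add c

lemma contDiff_primitive {z : ℝ → ℝ} (hz : Continuous z) (A c : ℝ) :
    ContDiff ℝ 1 (fun t => c + ∫ s in A..t, z s) := by
  rw [contDiff_one_iff_deriv]
  refine ⟨fun t => (hasDerivAt_primitive hz A c t).differentiableAt, ?_⟩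
  rw [funext fun t => (hasDerivAt_primitive hz A c t).deriv]
  exact hz

lemma caputoLeft_primitive {α a A c : ℝ} {z : ℝ → ℝ} (hz : Continuous z) (t : ℝ) :
    caputoLeft α a (fun t => c + ∫ s in A..t, z s) t =
      1 / Real.Gamma (1 - α) * ∫ τ in a..t, (t - τ) ^ (-α) * z τ := by
  simp only [caputoLeft, fun t => (hasDerivAt_primitive hz A c t).deriv]

/-- The primitive of a continuous function is an admissible state once the dynamics hold. -/
lemma isAdmissible_primitive {α a A xA M N S : ℝ} {f : ℝ → ℝ → ℝ → ℝ} {z v : ℝ → ℝ}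
    (haA : a < A) (hAS : A < S) (hz : Continuous z) (hv : ContinuousOn v (Icc A S))
    (hdyn : ∀ t ∈ Icc A S, M * z t +
      N * (1 / Real.Gamma (1 - α) * ∫ τ in a..t, (t - τ) ^ (-α) * z τ) =
        f t (xA + ∫ s in A..t, z s) (v t)) :
    IsAdmissible α a A xA M N f (fun t => xA + ∫ s in A..t, z s) v S where
  lt_final := hAS
  state := (contDiff_primitive hz A xA).contDiffOn
  control := hv
  start := by simp
  dynamics := by
    intro t ht
    rw [caputoLeft_primitive hz, (hasDerivAt_primitive hz A xA t).hasDerivWithinAt.derivWithin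
      (uniqueDiffOn_Icc (haA.trans hAS) t ⟨haA.le.trans ht.1, ht.2⟩)]
    exact hdyn t ht

/-- Partial derivative in the first (time) variable. -/
noncomputable def partialT (G : ℝ × ℝ × ℝ → ℝ) (q : ℝ × ℝ × ℝ) : ℝ := fderiv ℝ G q (1, 0, 0)

/-- Partial derivative in the second (state) variable. -/
noncomputable def partialX (G : ℝ × ℝ × ℝ → ℝ) (q : ℝ × ℝ × ℝ) : ℝ := fderiv ℝ G q (0, 1, 0)

/-- Partial derivative in the third (control) variable. -/
noncomputable def partialU (G : ℝ × ℝ × ℝ → ℝ) (q : ℝ × ℝ × ℝ) : ℝ := fderiv ℝ G q (0, 0, 1)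

section

variable {G : ℝ × ℝ × ℝ → ℝ}

lemma continuous_partialT (hG : ContDiff ℝ 1 G) : Continuous (partialT G) :=
  (hG.continuous_fderiv one_ne_zero).clm_apply continuous_const

lemma continuous_partialX (hG : ContDiff ℝ 1 G) : Continuous (partialX G) :=
  (hG.continuous_fderiv one_ne_zero).clm_apply continuous_const

lemma continuous_partialU (hG : ContDiff ℝ 1 G) : Continuous (partialU G) :=
  (hG.continuous_fderiv one_ne_zero).clm_apply continuous_const

lemma fderiv_apply_eq (q : ℝ × ℝ × ℝ) (b c d : ℝ) :
    fderiv ℝ G q (b, c, d) = b * partialT G q + c * partialX G q + d * partialU G q := by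
  have e : ((b, c, d) : ℝ × ℝ × ℝ) = b • (1, 0, 0) + c • (0, 1, 0) + d • (0, 0, 1) := by
    simp
  rw [e, map_add, map_add, map_smul, map_smul, map_smul]
  rfl

lemma hasDerivAt_along (hG : ContDiff ℝ 1 G) {τ y v : ℝ → ℝ} {τ' y' v' s : ℝ}
    (hτ : HasDerivAt τ τ' s) (hy : HasDerivAt y y' s) (hv : HasDerivAt v v' s) :
    HasDerivAt (fun s => G (τ s, y s, v s)) (τ' * partialT G (τ s, y s, v s) +
      y' * partialX G (τ s, y s, v s) + v' * partialU G (τ s, y s, v s)) s := by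
  have h1 : HasFDerivAt G (fderiv ℝ G (τ s, y s, v s)) (τ s, y s, v s) :=
    ((hG.differentiable one_ne_zero) _).hasFDerivAt
  have h2 := h1.comp_hasDerivAt s (hτ.prodMk (hy.prodMk hv))
  rw [fderiv_apply_eq] at h2
  exact h2

lemma hasDerivAt_partialX (hG : ContDiff ℝ 1 G) (t y v : ℝ) :
    HasDerivAt (fun y => G (t, y, v)) (partialX G (t, y, v)) y := by
  simpa using hasDerivAt_along hG (hasDerivAt_const y t) (hasDerivAt_id y) (hasDerivAt_const y v)

lemma hasDerivAt_partialU (hG : ContDiff ℝ 1 G) (t y v : ℝ) :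
    HasDerivAt (fun v => G (t, y, v)) (partialU G (t, y, v)) v := by
  simpa using hasDerivAt_along hG (hasDerivAt_const v t) (hasDerivAt_const v y) (hasDerivAt_id v)

/-- The unit tube around the path is the region in which the solvability lemmas require a Lipschitz
constant. -/
lemma exists_bound_partialX (hG : ContDiff ℝ 1 G) {A S : ℝ} {y u : ℝ → ℝ}
    (hy : ContinuousOn y (Icc A S)) (hu : ContinuousOn u (Icc A S)) :
    ∃ Λ ≥ 0, ∀ t ∈ Icc A S, ∀ η w, |η - y t| ≤ 1 → |w - u t| ≤ 1 →
      |partialX G (t, η, w)| ≤ Λ := by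
  obtain ⟨m, hm⟩ := isCompact_Icc.exists_bound_of_continuousOn hy
  obtain ⟨m', hm'⟩ := isCompact_Icc.exists_bound_of_continuousOn hu
  obtain ⟨Λ, hΛ⟩ := (isCompact_Icc.prod (isCompact_Icc.prod isCompact_Icc) :
    IsCompact (Icc A S ×ˢ Icc (-(m + 1)) (m + 1) ×ˢ Icc (-(m' + 1)) (m' + 1))
    ).exists_bound_of_continuousOn (continuous_partialX hG).continuousOn
  refine ⟨max Λ 0, le_max_right _ _, fun t ht η w hη hw => ?_⟩
  refine (hΛ (t, η, w) ⟨ht, ?_, ?_⟩).trans (le_max_left _ _)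
  · have h1 := abs_le.1 hη
    have h2 := abs_le.1 (hm t ht)
    constructor <;> simp only <;> linarith [h1.1, h1.2, h2.1, h2.2]
  · have h1 := abs_le.1 hw
    have h2 := abs_le.1 (hm' t ht)
    constructor <;> simp only <;> linarith [h1.1, h1.2, h2.1, h2.2]

lemma abs_sub_le_of_partialX (hG : ContDiff ℝ 1 G) {t y w Λ : ℝ}
    (h : ∀ η, |η - y| ≤ 1 → |partialX G (t, η, w)| ≤ Λ) {η η' : ℝ} (hη : |η - y| ≤ 1)
    (hη' : |η' - y| ≤ 1) : |G (t, η, w) - G (t, η', w)| ≤ Λ * |η - η'| := by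
  refine Convex.norm_image_sub_le_of_norm_hasDerivWithin_le (s := Metric.closedBall y 1)
    (f := fun η => G (t, η, w)) (f' := fun η => partialX G (t, η, w))
    (fun x _ => (hasDerivAt_partialX hG t x w).hasDerivWithinAt) (fun x hx => ?_)
    (convex_closedBall y 1) ?_ ?_
  · exact h x (by simpa [Real.dist_eq] using hx)
  · simpa [Real.dist_eq] using hη'
  · simpa [Real.dist_eq] using hη

end

/-! ### Density of the admissible pairs. -/

/-- The condition `Z A = 0` makes `Z (max τ A)` vanish before `A`, so history and later derivative
are glued continuously and the Caputo integral splits between them. -/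
lemma integral_history_add {α a A t : ℝ} (hα : α < 1) (hAt : A ≤ t)
    {z₀ Z : ℝ → ℝ} (hz₀ : Continuous z₀) (hv : ∀ τ ≥ A, z₀ τ = 0) (hZ : Continuous Z)
    (hZA : Z A = 0) (haA : a ≤ A) :
    ∫ τ in a..t, (t - τ) ^ (-α) * (z₀ τ + Z (max τ A)) =
      historyTerm α a A z₀ t + volterra (1 - α) A Z t := by
  have hZc : Continuous fun τ => Z (max τ A) := hZ.comp (continuous_id.max continuous_const)
  have hint : ∀ b c, IntervalIntegrable
      (fun τ => (t - τ) ^ (-α) * (z₀ τ + Z (max τ A))) volume b c := fun b c => by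
    have h := intervalIntegrable_kernel_mul (β := 1 - α) (by linarith) b c t
      (hz₀.add hZc).continuousOn
    rwa [show 1 - α - 1 = -α by ring] at h
  rw [← intervalIntegral.integral_add_adjacent_intervals (hint a A) (hint A t),
    volterra_eq (by linarith) hAt, historyTerm]
  congr 1
  · refine intervalIntegral.integral_congr fun τ hτ => ?_
    rw [uIcc_of_le haA] at hτ
    simp only [max_eq_right hτ.2, hZA, add_zero]
  · refine intervalIntegral.integral_congr fun τ hτ => ?_
    rw [uIcc_of_le hAt] at hτ
    simp only [max_eq_left hτ.1, hv τ hτ.1, zero_add]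
    rw [show 1 - α - 1 = -α by ring]

/-- If `N ≠ 0`, every `C¹` state with `ẏ(A) = 0` is, for every `C¹` control, a uniform limit on
`[A,S]` of admissible states: the history of the state before `A` acts as a control with dense
range. -/
lemma exists_admissible_near {α a A xA M N S : ℝ} (hα : α ∈ Ioo (0 : ℝ) 1) (haA : a < A)
    (hN : N ≠ 0) (hAS : A < S) {G : ℝ × ℝ × ℝ → ℝ} (hG : ContDiff ℝ 1 G) {ζ v : ℝ → ℝ}
    (hζ : Continuous ζ) (hζA : ζ A = 0) (hv : ContDiff ℝ 1 v) {ε : ℝ} (hε : 0 < ε) :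
    ∃ y, IsAdmissible α a A xA M N (fun t x u => G (t, x, u)) y v S ∧
      ∀ t ∈ Icc A S, |y t - (xA + ∫ s in A..t, ζ s)| ≤ ε := by
  have hα' : 0 < 1 - α := by linarith [hα.2]
  have hΓ : 0 < Real.Gamma (1 - α) := Real.Gamma_pos_of_pos hα'
  set k := N * (1 / Real.Gamma (1 - α)) with hk
  have hk0 : k ≠ 0 := mul_ne_zero hN (by positivity)
  have hk' : 0 < |k| := abs_pos.2 hk0
  set y₀ : ℝ → ℝ := fun t => xA + ∫ s in A..t, ζ s with hy₀
  have hy₀c : Continuous y₀ := continuous_primitive' hζ A xA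
  have hvc : Continuous v := hv.continuous
  obtain ⟨Λ, hΛ, hbd⟩ := exists_bound_partialX hG (A := A) (S := S) hy₀c.continuousOn
    hvc.continuousOn
  have hbd' : ∀ t ∈ Icc A S, ∀ η, |η - y₀ t| ≤ 1 → |partialX G (t, η, v t)| ≤ Λ :=
    fun t ht η hη => hbd t ht η (v t) hη (by simp)
  -- This is the history term for which `ζ` would satisfy the dynamics exactly. An approximating
  -- history leaves a small residual; matching `r` exactly at `A` makes the right-hand side vanish
  -- there, whence `Z A = 0`.
  set r : ℝ → ℝ := fun t => (G (t, y₀ t, v t) - M * ζ t - k * volterra (1 - α) A ζ t) / k with hr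
  have hGv : Continuous fun q : ℝ × ℝ => G (q.1, q.2, v q.1) :=
    hG.continuous.comp (continuous_fst.prodMk (continuous_snd.prodMk (hvc.comp continuous_fst)))
  have hrc : Continuous r :=
    (((hGv.comp (continuous_id.prodMk hy₀c)).sub (hζ.const_mul M)).sub
      ((continuous_volterra hα' A hζ).const_mul k)).div_const k
  have hrA : k * r A = G (A, xA, v A) := by
    simp only [hr, hy₀, hζA, volterra_eq hα' le_rfl, intervalIntegral.integral_same]
    field_simp; ring_nf
  -- it suffices to solve the equation on `[A,S]` for a suitable history
  suffices hmain : ∃ z₀ Z : ℝ → ℝ, Continuous z₀ ∧ (∀ τ ≥ A, z₀ τ = 0) ∧ Continuous Z ∧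
      Z A = 0 ∧ (∀ t ∈ Icc A S, M * Z t + k * volterra (1 - α) A Z t =
        G (t, xA + ∫ s in A..t, Z s, v t) - k * historyTerm α a A z₀ t) ∧
      ∀ t ∈ Icc A S, |(∫ s in A..t, Z s) - ∫ s in A..t, ζ s| ≤ ε by
    obtain ⟨z₀, Z, hz₀, hv₀, hZ, hZA, heq, hcl⟩ := hmain
    have hzc : Continuous fun τ => z₀ τ + Z (max τ A) :=
      hz₀.add (hZ.comp (continuous_id.max continuous_const))
    have hzt : ∀ t ∈ Icc A S, z₀ t + Z (max t A) = Z t := fun t ht => by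
      rw [hv₀ t ht.1, max_eq_left ht.1, zero_add]
    have hyt : ∀ t ∈ Icc A S, (∫ s in A..t, (z₀ s + Z (max s A))) = ∫ s in A..t, Z s := by
      intro t ht
      refine intervalIntegral.integral_congr fun s hs => ?_
      rw [uIcc_of_le ht.1] at hs
      exact hzt s ⟨hs.1, hs.2.trans ht.2⟩
    refine ⟨fun t => xA + ∫ s in A..t, (z₀ s + Z (max s A)),
      isAdmissible_primitive haA hAS hzc hvc.continuousOn fun t ht => ?_, fun t ht => ?_⟩
    · rw [integral_history_add hα.2 ht.1 hz₀ hv₀ hZ hZA haA.le, hzt t ht, hyt t ht,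
        ← mul_assoc, ← hk]
      linarith [heq t ht]
    · beta_reduce
      rw [hyt t ht, add_sub_add_left_eq_sub]
      exact hcl t ht
  by_cases hM : M = 0
  · subst hM
    -- For `M = 0` the right-hand side must be differentiated along the path; this is where the `C¹`
    -- control and the density `κ'` of the history term enter.
    obtain ⟨C, hC, hsol⟩ := exists_solution_of_kernel (S := S) hk0 hα hAS.le hΛ
    set e := min 1 ε / C with he
    have hepos : 0 < e := by positivity
    have hCe : C * e = min 1 ε := by rw [he]; field_simp
    obtain ⟨z₀, hz₀, ⟨η, hη, hv₀⟩, hhA, hh⟩ := exists_history hα haA hAS.le hrc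
      (show 0 < e / |k| by positivity)
    obtain ⟨κ, κ', hκ, hκ', hκe, hκd⟩ := exists_primitive_historyTerm (α := α) haA.le hz₀ hη hv₀
    have hres : ∀ t ∈ Icc A S, |k * volterra (1 - α) A ζ t - (G (t, y₀ t, v t) - k * κ t)| ≤ e := by
      intro t ht
      have h1 := hh t ht
      rw [le_div_iff₀ hk', ← abs_mul, mul_comm] at h1
      refine le_trans (le_of_eq ?_) h1
      congr 1
      rw [hκe t ht.1]; simp only [hr]; field_simp; ring
    have hFTC : ∀ z : ℝ → ℝ, Continuous z → ∀ t ∈ Icc A S,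
        (G (t, xA + ∫ s in A..t, z s, v t) - k * κ t) - (G (A, xA, v A) - k * κ A) =
        ∫ s in A..t, ((partialT G (s, xA + ∫ r in A..s, z r, v s) +
          deriv v s * partialU G (s, xA + ∫ r in A..s, z r, v s) - k * κ' s) +
          partialX G (s, xA + ∫ r in A..s, z r, v s) * z s) := by
      intro z hz t ht
      set Y : ℝ → ℝ := fun t => xA + ∫ s in A..t, z s with hY
      have hYc : Continuous Y := continuous_primitive' hz A xA
      have hd : ∀ s ∈ uIcc A t, HasDerivAt (fun s => G (s, Y s, v s))
          (partialT G (s, Y s, v s) + deriv v s * partialU G (s, Y s, v s) +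
            partialX G (s, Y s, v s) * z s) s := by
        intro s _
        refine (hasDerivAt_along hG (hasDerivAt_id s) (hasDerivAt_primitive hz A xA s)
          ((hv.differentiable one_ne_zero) s).hasDerivAt).congr_deriv ?_
        simp only [id, hY]; ring
      have hpath : Continuous fun s => (s, Y s, v s) :=
        continuous_id.prodMk (hYc.prodMk hvc)
      have hc1 : Continuous fun s => partialT G (s, Y s, v s) +
          deriv v s * partialU G (s, Y s, v s) + partialX G (s, Y s, v s) * z s :=
        (((continuous_partialT hG).comp hpath).add ((hv.continuous_deriv le_rfl).mul
          ((continuous_partialU hG).comp hpath))).add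
          (((continuous_partialX hG).comp hpath).mul hz)
      have h1 := intervalIntegral.integral_eq_sub_of_hasDerivAt hd (hc1.intervalIntegrable _ _)
      have h2 := hκd t ht.1
      have hYA : Y A = xA := by simp [hY]
      rw [hYA] at h1
      have e1 : ∀ s, (partialT G (s, Y s, v s) + deriv v s * partialU G (s, Y s, v s) - k * κ' s) +
          partialX G (s, Y s, v s) * z s = (partialT G (s, Y s, v s) +
          deriv v s * partialU G (s, Y s, v s) + partialX G (s, Y s, v s) * z s) - k * κ' s :=
        fun s => by ring
      have e2 : ∫ s in A..t, ((partialT G (s, Y s, v s) + deriv v s * partialU G (s, Y s, v s) -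
          k * κ' s) + partialX G (s, Y s, v s) * z s) =
          (G (t, Y t, v t) - G (A, xA, v A)) - k * (κ t - κ A) := by
        simp only [e1]
        rw [intervalIntegral.integral_sub (hc1.intervalIntegrable _ _)
          ((hκ'.const_mul k).intervalIntegrable _ _), intervalIntegral.integral_const_mul, ← h2, h1]
      refine Eq.trans ?_ e2.symm
      ring
    obtain ⟨Z, hZ, hZA, heq, hcl⟩ := hsol (fun t η => G (t, η, v t) - k * κ t)
      (fun t η => partialT G (t, η, v t) + deriv v t * partialU G (t, η, v t) - k * κ' t)
      (fun t η => partialX G (t, η, v t)) ζ xA e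
      (hGv.sub ((hκ.comp continuous_fst).const_mul k))
      ((((continuous_partialT hG).comp (continuous_fst.prodMk (continuous_snd.prodMk
        (hvc.comp continuous_fst)))).add (((hv.continuous_deriv le_rfl).comp continuous_fst).mul
        ((continuous_partialU hG).comp (continuous_fst.prodMk (continuous_snd.prodMk
        (hvc.comp continuous_fst)))))).sub ((hκ'.comp continuous_fst).const_mul k))
      ((continuous_partialX hG).comp (continuous_fst.prodMk (continuous_snd.prodMk
        (hvc.comp continuous_fst))))
      hζ (by rw [hκe A le_rfl, hhA, hrA, sub_self]) hFTC
      (fun t ht η η' h1 h2 => by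
        rw [sub_sub_sub_cancel_right]
        exact abs_sub_le_of_partialX hG (hbd' t ht) h1 h2)
      hbd' hres (by rw [hCe]; exact min_le_left _ _)
    refine ⟨z₀, Z, hz₀, fun τ hτ => hv₀ τ (by linarith), hZ, hZA, fun t ht => ?_, fun t ht => ?_⟩
    · rw [zero_mul, zero_add, heq t ht, hκe t ht.1]
    · exact (hcl t ht).trans (by rw [hCe]; exact min_le_right _ _)
  · obtain ⟨C, hC, hsol⟩ := exists_solution_of_ne_zero (A := A) (S₀ := S) (k := k) hM hα' hΛ
    set e := min 1 ε / C with he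
    have hepos : 0 < e := by positivity
    have hCe : C * e = min 1 ε := by rw [he]; field_simp
    obtain ⟨z₀, hz₀, ⟨η, hη, hv₀⟩, hhA, hh⟩ := exists_history hα haA hAS.le hrc
      (show 0 < e / |k| by positivity)
    obtain ⟨κ, -, hκ, -, hκe, -⟩ := exists_primitive_historyTerm (α := α) haA.le hz₀ hη hv₀
    obtain ⟨Z, hZ, heq, -, hcl⟩ := hsol S hAS.le le_rfl (fun t η => G (t, η, v t) - k * κ t) ζ xA e
      (hGv.sub ((hκ.comp continuous_fst).const_mul k)) hζ
      (fun t ht η η' h1 h2 => by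
        rw [sub_sub_sub_cancel_right]
        exact abs_sub_le_of_partialX hG (hbd' t ht) h1 h2)
      (fun t ht => by
        have h1 := hh t ht
        rw [le_div_iff₀ hk', ← abs_mul, mul_comm] at h1
        refine le_trans (le_of_eq ?_) h1
        congr 1
        rw [hκe t ht.1]; simp only [hr, hy₀]; field_simp; ring)
      (by rw [hCe]; exact min_le_left _ _)
    refine ⟨z₀, Z, hz₀, fun τ hτ => hv₀ τ (by linarith), hZ, ?_, fun t ht => ?_, fun t ht => ?_⟩
    · have h1 := heq A ⟨le_rfl, hAS.le⟩
      simp only [volterra_eq hα' le_rfl, intervalIntegral.integral_same, mul_zero, add_zero] at h1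
      rw [hκe A le_rfl, hhA, hrA, sub_self] at h1
      exact (mul_eq_zero.1 h1).resolve_left hM
    · rw [heq t ht, hκe t ht.1]
    · exact (hcl t ht).trans (by rw [hCe]; exact min_le_right _ _)

/-- Continuity is uniform near the compact path, and only one of the two compared points has to lie
on it. -/
lemma exists_path_modulus {H : ℝ × ℝ × ℝ → ℝ} (hH : Continuous H) {A S : ℝ} {y v : ℝ → ℝ}
    (hy : ContinuousOn y (Icc A S)) (hv : ContinuousOn v (Icc A S)) {ε : ℝ} (hε : 0 < ε) :
    ∃ δ > 0, ∀ t ∈ Icc A S, ∀ η w, |η - y t| ≤ δ → |w - v t| ≤ δ →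
      |H (t, η, w) - H (t, y t, v t)| ≤ ε := by
  have hK : IsCompact ((fun t => (t, y t, v t)) '' Icc A S) :=
    isCompact_Icc.image_of_continuousOn (continuousOn_id.prodMk (hy.prodMk hv))
  have h := hK.uniformContinuousAt_of_continuousAt H (fun _ _ => hH.continuousAt)
    (Metric.dist_mem_uniformity hε)
  obtain ⟨δ, hδ, hsub⟩ := Metric.mem_uniformity_dist.1 h
  refine ⟨δ / 2, half_pos hδ, fun t ht η w hη hw => ?_⟩
  have h1 : dist (t, y t, v t) (t, η, w) < δ := by
    rw [Prod.dist_eq, Prod.dist_eq, dist_self, Real.dist_eq, Real.dist_eq, abs_sub_comm,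
      abs_sub_comm (v t)]
    exact max_lt hδ (max_lt (by linarith) (by linarith))
  have h2 := hsub h1 ⟨t, ht, rfl⟩
  simp only [mem_ofPred_eq, Real.dist_eq] at h2
  rw [abs_sub_comm]
  exact h2.le

lemma intervalIntegrable_path {H : ℝ × ℝ × ℝ → ℝ} (hH : Continuous H) {A S : ℝ} (hAS : A ≤ S)
    {y v : ℝ → ℝ} (hy : ContinuousOn y (Icc A S)) (hv : ContinuousOn v (Icc A S)) :
    IntervalIntegrable (fun t => H (t, y t, v t)) volume A S := by
  refine ContinuousOn.intervalIntegrable ?_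
  rw [uIcc_of_le hAS]
  exact hH.comp_continuousOn (continuousOn_id.prodMk (hy.prodMk hv))

lemma abs_integral_le_of_forall {A S c : ℝ} (hAS : A ≤ S) {g : ℝ → ℝ}
    (h : ∀ t ∈ Icc A S, |g t| ≤ c) : |∫ t in A..S, g t| ≤ c * (S - A) := by
  have h1 := intervalIntegral.norm_integral_le_of_norm_le_const (a := A) (b := S) (C := c)
    (f := g) (fun t ht => by
      rw [uIoc_of_le hAS] at ht
      exact h t ⟨ht.1.le, ht.2⟩)
  rwa [abs_of_nonneg (sub_nonneg.2 hAS)] at h1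

lemma mul_exp_neg_mul_le {m s : ℝ} (hm : 0 < m) : s * Real.exp (-(m * s)) ≤ 1 / m := by
  have h1 : m * s ≤ Real.exp (m * s) := by linarith [Real.add_one_le_exp (m * s)]
  rw [Real.exp_neg, ← div_eq_mul_inv, div_le_div_iff₀ (Real.exp_pos _) hm]
  linarith

/-- Density: for `N ≠ 0` any continuous pair (state, control) with the right initial value is a
uniform limit of admissible ones. -/
lemma exists_admissible_near_continuous {α a A xA M N S : ℝ} (hα : α ∈ Ioo (0 : ℝ) 1)
    (haA : a < A) (hN : N ≠ 0) (hAS : A < S) {G : ℝ × ℝ × ℝ → ℝ} (hG : ContDiff ℝ 1 G)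
    {y v : ℝ → ℝ} (hy : ContinuousOn y (Icc A S)) (hv : ContinuousOn v (Icc A S))
    (hyA : y A = xA) {δ : ℝ} (hδ : 0 < δ) :
    ∃ y' v', IsAdmissible α a A xA M N (fun t x u => G (t, x, u)) y' v' S ∧
      ∀ t ∈ Icc A S, |y' t - y t| ≤ δ ∧ |v' t - v t| ≤ δ := by
  obtain ⟨q, hq⟩ := exists_polynomial_near_of_continuousOn A S y hy (δ / 4) (by positivity)
  obtain ⟨w, hw⟩ := exists_polynomial_near_of_continuousOn A S v hv δ hδ
  set d := q.derivative.eval A with hd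
  set m := 4 * (|d| + 1) / δ with hm
  have hm0 : 0 < m := by positivity
  -- This is the derivative of `q - d (t-A) exp(-m(t-A))`. The correction cancels the slope of `q`
  -- at `A` and has size at most `|d|/m ≤ δ/4`; the errors of `q` at `t` and at `A` and of the
  -- admissible state take the other three quarters.
  set ζ : ℝ → ℝ := fun t => q.derivative.eval t -
    d * (Real.exp (-(m * (t - A))) - (t - A) * (m * Real.exp (-(m * (t - A))))) with hζ
  have hζc : Continuous ζ := by
    have := q.derivative.continuous
    fun_prop
  have hζA : ζ A = 0 := by simp [hζ, hd]
  have hint : ∀ t, ∫ s in A..t, ζ s =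
      (q.eval t - d * ((t - A) * Real.exp (-(m * (t - A))))) - q.eval A := by
    intro t
    have h1 : ∀ s ∈ uIcc A t, HasDerivAt
        (fun s => q.eval s - d * ((s - A) * Real.exp (-(m * (s - A))))) (ζ s) s := by
      intro s _
      have h2 : HasDerivAt (fun s => s - A) 1 s := (hasDerivAt_id s).sub_const A
      have h3 : HasDerivAt (fun s => Real.exp (-(m * (s - A))))
          (Real.exp (-(m * (s - A))) * -(m * 1)) s := (h2.const_mul m).neg.exp
      refine ((q.hasDerivAt s).sub ((h2.mul h3).const_mul d)).congr_deriv ?_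
      simp only [hζ]; ring
    rw [intervalIntegral.integral_eq_sub_of_hasDerivAt h1 (hζc.intervalIntegrable _ _)]
    simp
  obtain ⟨y', hadm, hy'⟩ := exists_admissible_near (xA := xA) (M := M) hα haA hN hAS hG hζc hζA
    (v := fun t => w.eval t) (by simpa using w.contDiff_aeval (𝕜 := ℝ) 1) (show 0 < δ / 4 by positivity)
  refine ⟨y', fun t => w.eval t, hadm, fun t ht => ⟨?_, (hw t ht).le⟩⟩
  have h1 := abs_le.1 (hy' t ht)
  have h2 := abs_lt.1 (hq t ht)
  have h3 := abs_lt.1 (hq A ⟨le_rfl, hAS.le⟩)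
  have h4 : |d * ((t - A) * Real.exp (-(m * (t - A))))| ≤ δ / 4 := by
    rw [abs_mul, abs_of_nonneg (mul_nonneg (by linarith [ht.1]) (Real.exp_pos _).le)]
    calc _ ≤ |d| * (1 / m) := by gcongr; exact mul_exp_neg_mul_le hm0
      _ ≤ (|d| + 1) * (1 / m) := by gcongr; linarith
      _ = δ / 4 := by rw [hm]; field_simp
  have h5 := abs_le.1 h4
  rw [hint] at h1
  rw [hyA] at h3
  rw [abs_le]
  constructor <;> linarith [h1.1, h1.2, h2.1, h2.2, h3.1, h3.2, h5.1, h5.2]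

/-- For `N ≠ 0`, a minimizer over the admissible triplets also minimizes over all continuous
pairs with the right initial value, whether or not they satisfy the dynamics. -/
lemma cost_le_of_continuous {α a A xA M N : ℝ} (hα : α ∈ Ioo (0 : ℝ) 1)
    (haA : a < A) (hN : N ≠ 0) {G K : ℝ × ℝ × ℝ → ℝ} (hG : ContDiff ℝ 1 G) (hK : Continuous K)
    {φ : ℝ → ℝ → ℝ} {x u : ℝ → ℝ} {T : ℝ}
    (hmin : IsMinimizer α a A xA M N (fun t x u => K (t, x, u)) (fun t x u => G (t, x, u))
      φ x u T) {S : ℝ} (hAS : A < S)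
    {y v : ℝ → ℝ} (hy : ContinuousOn y (Icc A S)) (hv : ContinuousOn v (Icc A S))
    (hyA : y A = xA) (hφ : ContinuousAt (φ S) (y S)) :
    cost A (fun t x u => K (t, x, u)) φ x u T ≤ cost A (fun t x u => K (t, x, u)) φ y v S := by
  refine le_of_forall_pos_le_add fun ε hε => ?_
  have hSA : 0 < S - A := sub_pos.2 hAS
  obtain ⟨δ₁, hδ₁, h₁⟩ := exists_path_modulus hK hy hv (show 0 < ε / (2 * (S - A)) by positivity)
  obtain ⟨δ₂, hδ₂, h₂⟩ := Metric.continuousAt_iff.1 hφ (ε / 2) (half_pos hε)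
  obtain ⟨y', v', hadm, hcl⟩ := exists_admissible_near_continuous (M := M) hα haA hN hAS hG hy hv
    hyA (δ := min δ₁ (δ₂ / 2)) (lt_min hδ₁ (half_pos hδ₂))
  refine (hmin.2 y' v' S hadm).trans ?_
  have hS : S ∈ Icc A S := ⟨hAS.le, le_rfl⟩
  have h3 : φ S (y' S) ≤ φ S (y S) + ε / 2 := by
    have := h₂ (x := y' S) (by
      rw [Real.dist_eq]
      have := (hcl S hS).1.trans (min_le_right _ _)
      linarith)
    rw [Real.dist_eq] at this
    linarith [(abs_lt.1 this).2]
  have hy'c : ContinuousOn y' (Icc A S) :=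
    hadm.state.continuousOn.mono (Icc_subset_Icc_left haA.le)
  have h4 : |∫ t in A..S, (K (t, y' t, v' t) - K (t, y t, v t))| ≤
      ε / (2 * (S - A)) * (S - A) :=
    abs_integral_le_of_forall hAS.le fun t ht =>
      h₁ t ht _ _ ((hcl t ht).1.trans (min_le_left _ _)) ((hcl t ht).2.trans (min_le_left _ _))
  rw [intervalIntegral.integral_sub (intervalIntegrable_path hK hAS.le hy'c hadm.control)
    (intervalIntegrable_path hK hAS.le hy hv)] at h4
  have h5 : ε / (2 * (S - A)) * (S - A) = ε / 2 := by field_simp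
  rw [h5] at h4
  have h6 := (abs_le.1 h4).2
  simp only [cost]
  linarith

/-! ### First variation and stationarity of the final time. -/

lemma exists_remainder_modulus {G : ℝ × ℝ × ℝ → ℝ} (hG : ContDiff ℝ 1 G) {A S : ℝ} {y v : ℝ → ℝ}
    (hy : ContinuousOn y (Icc A S)) (hv : ContinuousOn v (Icc A S)) {ε : ℝ} (hε : 0 < ε) :
    ∃ δ > 0, ∀ t ∈ Icc A S, ∀ h w, |h| ≤ δ → |w| ≤ δ →
      |G (t, y t + h, v t + w) - G (t, y t, v t) -
        (h * partialX G (t, y t, v t) + w * partialU G (t, y t, v t))| ≤ ε * (|h| + |w|) := by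
  obtain ⟨δ₁, hδ₁, h₁⟩ := exists_path_modulus (continuous_partialX hG) hy hv hε
  obtain ⟨δ₂, hδ₂, h₂⟩ := exists_path_modulus (continuous_partialU hG) hy hv hε
  refine ⟨min δ₁ δ₂, lt_min hδ₁ hδ₂, fun t ht h w hh hw => ?_⟩
  set X := partialX G (t, y t, v t)
  set U := partialU G (t, y t, v t)
  have hd : ∀ s ∈ Icc (0 : ℝ) 1, HasDerivWithinAt
      (fun s => G (t, y t + s * h, v t + s * w) - s * (h * X + w * U))
      (h * (partialX G (t, y t + s * h, v t + s * w) - X) +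
        w * (partialU G (t, y t + s * h, v t + s * w) - U)) (Icc 0 1) s := by
    intro s _
    have h3 := hasDerivAt_along hG (hasDerivAt_const s t)
      (((hasDerivAt_id s).mul_const h).const_add (y t))
      (((hasDerivAt_id s).mul_const w).const_add (v t))
    refine ((h3.sub ((hasDerivAt_id s).mul_const (h * X + w * U))).congr_deriv ?_).hasDerivWithinAt
    simp only [id]; ring
  have hb : ∀ s ∈ Ico (0 : ℝ) 1, ‖h * (partialX G (t, y t + s * h, v t + s * w) - X) +
      w * (partialU G (t, y t + s * h, v t + s * w) - U)‖ ≤ ε * (|h| + |w|) := by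
    intro s hs
    have hs' : ∀ p : ℝ, |s * p| ≤ |p| := fun p => by
      rw [abs_mul, abs_of_nonneg hs.1]
      exact mul_le_of_le_one_left (abs_nonneg _) hs.2.le
    have e : ∀ p q : ℝ, p + q - p = q := fun p q => by ring
    have i1 := h₁ t ht (y t + s * h) (v t + s * w)
      (by rw [e]; exact (hs' h).trans (hh.trans (min_le_left _ _)))
      (by rw [e]; exact (hs' w).trans (hw.trans (min_le_left _ _)))
    have i2 := h₂ t ht (y t + s * h) (v t + s * w)
      (by rw [e]; exact (hs' h).trans (hh.trans (min_le_right _ _)))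
      (by rw [e]; exact (hs' w).trans (hw.trans (min_le_right _ _)))
    refine (norm_add_le _ _).trans ?_
    rw [norm_mul, norm_mul, Real.norm_eq_abs, Real.norm_eq_abs, Real.norm_eq_abs, Real.norm_eq_abs]
    calc _ ≤ |h| * ε + |w| * ε := by gcongr
      _ = _ := by ring
  have h4 := norm_image_sub_le_of_norm_deriv_le_segment_01' hd hb
  rw [Real.norm_eq_abs] at h4
  refine le_trans (le_of_eq ?_) h4
  congr 1
  simp
  ring

/-- First order expansion of the integral cost, uniform over variations of size `O(ε)`. -/
lemma exists_integral_remainder_le {G : ℝ × ℝ × ℝ → ℝ} (hG : ContDiff ℝ 1 G) {A S : ℝ}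
    (hAS : A ≤ S) {y v : ℝ → ℝ} (hy : ContinuousOn y (Icc A S)) (hv : ContinuousOn v (Icc A S))
    {C η : ℝ} (hC : 0 ≤ C) (hη : 0 < η) :
    ∃ ε₁ > 0, ∀ ε, |ε| < ε₁ → ∀ h w : ℝ → ℝ, (∀ t ∈ Icc A S, |h t| ≤ C * |ε|) →
      (∀ t ∈ Icc A S, |w t| ≤ C * |ε|) →
      |∫ t in A..S, (G (t, y t + h t, v t + w t) - G (t, y t, v t) -
        (h t * partialX G (t, y t, v t) + w t * partialU G (t, y t, v t)))| ≤ η * |ε| := by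
  obtain ⟨δ, hδ, hmod⟩ := exists_remainder_modulus hG hy hv
    (show 0 < η / (2 * (C + 1) * (S - A + 1)) by
      have : 0 < S - A + 1 := by linarith
      positivity)
  have hS : 0 < S - A + 1 := by linarith
  refine ⟨δ / (C + 1), by positivity, fun ε hε h w hh hw => ?_⟩
  have hCε : C * |ε| ≤ δ := by
    rw [lt_div_iff₀ (by positivity)] at hε
    nlinarith [abs_nonneg ε]
  have h1 : ∀ t ∈ Icc A S, |G (t, y t + h t, v t + w t) - G (t, y t, v t) -
        (h t * partialX G (t, y t, v t) + w t * partialU G (t, y t, v t))| ≤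
        η / (2 * (C + 1) * (S - A + 1)) * (C * |ε| + C * |ε|) := fun t ht =>
    (hmod t ht _ _ ((hh t ht).trans hCε) ((hw t ht).trans hCε)).trans (by
      gcongr
      · exact hh t ht
      · exact hw t ht)
  refine (abs_integral_le_of_forall hAS h1).trans ?_
  have h2 : C * |ε| ≤ (C + 1) * |ε| := by gcongr; linarith
  calc _ ≤ η / (2 * (C + 1) * (S - A + 1)) * ((C + 1) * |ε| + (C + 1) * |ε|) * (S - A + 1) := by
        gcongr; linarith
    _ = _ := by field_simp; ring

/-- The weight may vanish at the end points, which permits test variations vanishing there;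
continuity recovers the end points. -/
lemma eq_zero_of_integral_sq_weight {A S : ℝ} (hAS : A < S) {ρ g : ℝ → ℝ}
    (hρ : ContinuousOn ρ (Icc A S)) (hg : ContinuousOn g (Icc A S))
    (hpos : ∀ t ∈ Ioo A S, 0 < ρ t) (hnn : ∀ t ∈ Icc A S, 0 ≤ ρ t)
    (h : ∫ t in A..S, ρ t * (g t * g t) ≤ 0) : ∀ t ∈ Icc A S, g t = 0 := by
  have h0 : EqOn g (fun _ => 0) (Ioo A S) := by
    intro t ht
    by_contra hne
    refine absurd h (not_le.2 (intervalIntegral.integral_pos hAS (hρ.mul (hg.mul hg))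
      (fun s hs => mul_nonneg (hnn s ⟨hs.1.le, hs.2⟩) (mul_self_nonneg _))
      ⟨t, ⟨ht.1.le, ht.2.le⟩, mul_pos (hpos t ht) (mul_self_pos.2 hne)⟩))
  exact fun t ht => h0.of_subset_closure hg continuousOn_const Ioo_subset_Icc_self
    (by rw [closure_Ioo hAS.ne]) ht

/-- A function minimizing an integral cost with end point term over all continuous variations
vanishing at `A` annihilates the first variation. -/
lemma first_variation_eq_zero {K : ℝ × ℝ × ℝ → ℝ} (hK : ContDiff ℝ 1 K) {A S : ℝ}
    (hAS : A ≤ S) {y v h w : ℝ → ℝ} (hy : ContinuousOn y (Icc A S))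
    (hv : ContinuousOn v (Icc A S)) (hh : ContinuousOn h (Icc A S)) (hw : ContinuousOn w (Icc A S))
    {ψ : ℝ → ℝ} {c : ℝ} (hψ : HasDerivAt ψ c (y S))
    (hmin : ∀ ε : ℝ, (∫ t in A..S, K (t, y t, v t)) + ψ (y S) ≤
      (∫ t in A..S, K (t, y t + ε * h t, v t + ε * w t)) + ψ (y S + ε * h S)) :
    (∫ t in A..S, (h t * partialX K (t, y t, v t) + w t * partialU K (t, y t, v t))) +
      c * h S = 0 := by
  set I := ∫ t in A..S, (h t * partialX K (t, y t, v t) + w t * partialU K (t, y t, v t)) with hI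
  have hpath : ContinuousOn (fun t => (t, y t, v t)) (Icc A S) :=
    continuousOn_id.prodMk (hy.prodMk hv)
  have hIint : IntervalIntegrable (fun t => h t * partialX K (t, y t, v t) +
      w t * partialU K (t, y t, v t)) volume A S := by
    refine ContinuousOn.intervalIntegrable ?_
    rw [uIcc_of_le hAS]
    exact (hh.mul ((continuous_partialX hK).comp_continuousOn hpath)).add
      (hw.mul ((continuous_partialU hK).comp_continuousOn hpath))
  have hd1 : HasDerivAt (fun ε : ℝ => ∫ t in A..S, K (t, y t + ε * h t, v t + ε * w t)) I 0 := by
    rw [hasDerivAt_iff_isLittleO_nhds_zero, Asymptotics.isLittleO_iff]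
    intro η hη
    obtain ⟨m₁, hm₁⟩ := isCompact_Icc.exists_bound_of_continuousOn hh
    obtain ⟨m₂, hm₂⟩ := isCompact_Icc.exists_bound_of_continuousOn hw
    set C := max (max m₁ m₂) 0 with hC
    obtain ⟨ε₁, hε₁, hrem⟩ := exists_integral_remainder_le hK hAS hy hv (le_max_right _ _ : 0 ≤ C) hη
    filter_upwards [Metric.ball_mem_nhds (0 : ℝ) hε₁] with ε hε
    have hε' : |ε| < ε₁ := by simpa using hε
    have h1 := hrem ε hε' (fun t => ε * h t) (fun t => ε * w t)
      (fun t ht => by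
        rw [abs_mul, mul_comm]
        gcongr
        exact (hm₁ t ht).trans ((le_max_left _ _).trans (le_max_left _ _)))
      (fun t ht => by
        rw [abs_mul, mul_comm]
        gcongr
        exact (hm₂ t ht).trans ((le_max_right _ _).trans (le_max_left _ _)))
    have e : ∀ t, ε * h t * partialX K (t, y t, v t) + ε * w t * partialU K (t, y t, v t) =
        ε * (h t * partialX K (t, y t, v t) + w t * partialU K (t, y t, v t)) := fun t => by ring
    have hi1 : IntervalIntegrable (fun t => K (t, y t + ε * h t, v t + ε * w t)) volume A S :=
      intervalIntegrable_path hK.continuous hAS (hy.add (hh.const_mul ε)) (hv.add (hw.const_mul ε))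
    have hi2 := intervalIntegrable_path hK.continuous hAS hy hv
    simp only [e] at h1
    rw [intervalIntegral.integral_sub (hi1.sub hi2) (hIint.const_mul ε),
      intervalIntegral.integral_sub hi1 hi2, intervalIntegral.integral_const_mul, ← hI] at h1
    simpa using h1
  have hd2 : HasDerivAt (fun ε : ℝ => ψ (y S + ε * h S)) (c * h S) 0 := by
    have h1 : HasDerivAt (fun ε : ℝ => y S + ε * h S) (h S) 0 := by
      simpa using ((hasDerivAt_id (0 : ℝ)).mul_const (h S)).const_add (y S)
    have h2 : HasDerivAt ψ c (y S + 0 * h S) := by simpa using hψ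
    exact h2.comp 0 h1
  have hloc : IsLocalMin (fun ε : ℝ => (∫ t in A..S, K (t, y t + ε * h t, v t + ε * w t)) +
      ψ (y S + ε * h S)) 0 :=
    Eventually.of_forall fun ε => by simpa using hmin ε
  exact hloc.hasDerivAt_eq_zero (hd1.add hd2)

/-- Stationarity of the cost with respect to the final time. -/
lemma final_time_stationary {K : ℝ × ℝ × ℝ → ℝ} (hK : Continuous K) {φ : ℝ → ℝ → ℝ} {A T : ℝ}
    {y v : ℝ → ℝ} {y' : ℝ} (hy : Continuous y) (hv : Continuous v) (hy' : HasDerivAt y y' T)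
    (hφ : DifferentiableAt ℝ (fun q : ℝ × ℝ => φ q.1 q.2) (T, y T))
    (hmin : ∀ᶠ S in 𝓝 T, cost A (fun t x u => K (t, x, u)) φ y v T ≤
      cost A (fun t x u => K (t, x, u)) φ y v S) :
    K (T, y T, v T) + deriv (fun s => φ s (y T)) T + y' * deriv (fun η => φ T η) (y T) = 0 := by
  set D := fderiv ℝ (fun q : ℝ × ℝ => φ q.1 q.2) (T, y T) with hD
  have hf := hφ.hasFDerivAt
  rw [← hD] at hf
  have h1 : HasDerivAt (fun s => φ s (y T)) (D (1, 0)) T :=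
    HasFDerivAt.comp_hasDerivAt (f := fun s => (s, y T)) T hf
      ((hasDerivAt_id T).prodMk (hasDerivAt_const T (y T)))
  have h2 : HasDerivAt (fun η => φ T η) (D (0, 1)) (y T) :=
    HasFDerivAt.comp_hasDerivAt (f := fun η => (T, η)) (y T) hf ((hasDerivAt_const (y T) T).prodMk (hasDerivAt_id (y T)))
  have h3 : HasDerivAt (fun s => φ s (y s)) (D (1, y')) T :=
    HasFDerivAt.comp_hasDerivAt (f := fun s => (s, y s)) T hf ((hasDerivAt_id T).prodMk hy')
  have e : D (1, y') = D (1, 0) + y' * D (0, 1) := by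
    rw [← smul_eq_mul, ← map_smul, ← map_add]; simp
  have hKc : Continuous fun t => K (t, y t, v t) :=
    hK.comp (continuous_id.prodMk (hy.prodMk hv))
  have h4 := hasDerivAt_primitive hKc A 0 T
  have hloc : IsLocalMin (fun S => (0 + ∫ t in A..S, K (t, y t, v t)) + φ S (y S)) T := by
    filter_upwards [hmin] with S hS
    simpa [cost] using hS
  have h5 := hloc.hasDerivAt_eq_zero (h4.add h3)
  rw [h1.deriv, h2.deriv]
  linarith

/-- An admissible state is, on its interval, the primitive of a function continuous on the line. -/
lemma IsAdmissible.exists_primitive {α a A xA M N : ℝ} {f : ℝ → ℝ → ℝ → ℝ} {x u : ℝ → ℝ} {T : ℝ}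
    (h : IsAdmissible α a A xA M N f x u T) (haA : a < A) :
    ∃ z : ℝ → ℝ, Continuous z ∧ (∀ t ∈ Icc a T, derivWithin x (Icc a T) t = z t) ∧
      ∀ t ∈ Icc a T, x t = xA + ∫ s in A..t, z s := by
  have haT : a < T := haA.trans h.lt_final
  have hd : ContinuousOn (derivWithin x (Icc a T)) (Icc a T) :=
    h.state.continuousOn_derivWithin (uniqueDiffOn_Icc haT) le_rfl
  set z := IccExtend haT.le ((Icc a T).domRestrict (derivWithin x (Icc a T))) with hz
  have hzc : Continuous z := (continuousOn_iff_continuous_domRestrict.1 hd).Icc_extend'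
  have hzt : ∀ t ∈ Icc a T, derivWithin x (Icc a T) t = z t := fun t ht => by
    rw [hz, IccExtend_of_mem haT.le _ ht]; rfl
  refine ⟨z, hzc, hzt, fun t ht => ?_⟩
  have hA : A ∈ Icc a T := ⟨haA.le, h.lt_final.le⟩
  have hsub : uIcc A t ⊆ Icc a T := uIcc_subset_Icc hA ht
  have h1 : ∫ s in A..t, z s = x t - x A := by
    refine intervalIntegral.integral_eq_sub_of_hasDeriv_right
      (h.state.continuousOn.mono hsub) (fun s hs => ?_) (hzc.intervalIntegrable _ _)
    have hs' : s ∈ Ioo a T := ⟨(le_min hA.1 ht.1).trans_lt hs.1, hs.2.trans_le (max_le hA.2 ht.2)⟩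
    have hsI : s ∈ Icc a T := Ioo_subset_Icc_self hs'
    have h2 := (h.state.differentiableOn one_ne_zero s hsI).hasDerivWithinAt
    rw [hzt s hsI] at h2
    exact (h2.hasDerivAt (Icc_mem_nhds hs'.1 hs'.2)).hasDerivWithinAt
  rw [h1, h.start]; ring

lemma ContinuousOn.exists_continuous_extension {A T : ℝ} (hAT : A ≤ T) {u : ℝ → ℝ}
    (hu : ContinuousOn u (Icc A T)) : ∃ v : ℝ → ℝ, Continuous v ∧ ∀ t ∈ Icc A T, u t = v t :=
  ⟨IccExtend hAT ((Icc A T).domRestrict u),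
    (continuousOn_iff_continuous_domRestrict.1 hu).Icc_extend',
    fun t ht => by rw [IccExtend_of_mem hAT _ ht]; rfl⟩

lemma cost_congr {A T : ℝ} (hAT : A ≤ T) (L : ℝ → ℝ → ℝ → ℝ) (φ : ℝ → ℝ → ℝ)
    {x u y v : ℝ → ℝ} (hx : ∀ t ∈ Icc A T, x t = y t) (hu : ∀ t ∈ Icc A T, u t = v t) :
    cost A L φ x u T = cost A L φ y v T := by
  unfold cost
  rw [hx T ⟨hAT, le_rfl⟩]
  congr 1
  refine intervalIntegral.integral_congr fun t ht => ?_
  rw [uIcc_of_le hAT] at ht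
  simp only [hx t ht, hu t ht]

lemma differentiableAt_of_interior {φ : ℝ → ℝ → ℝ} {a S : ℝ} (haS : a < S)
    (hφ : DifferentiableOn ℝ (fun q : ℝ × ℝ => φ q.1 q.2) (Ici a ×ˢ univ)) (η : ℝ) :
    DifferentiableAt ℝ (fun q : ℝ × ℝ => φ q.1 q.2) (S, η) :=
  (hφ (S, η) ⟨haS.le, mem_univ _⟩).differentiableAt
    (prod_mem_nhds (Ici_mem_nhds haS) univ_mem)

lemma differentiableAt_snd_of_interior {φ : ℝ → ℝ → ℝ} {a S : ℝ} (haS : a < S)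
    (hφ : DifferentiableOn ℝ (fun q : ℝ × ℝ => φ q.1 q.2) (Ici a ×ˢ univ)) (η : ℝ) :
    DifferentiableAt ℝ (φ S) η :=
  DifferentiableAt.comp (g := fun q : ℝ × ℝ => φ q.1 q.2) (f := fun η => (S, η)) η
    (differentiableAt_of_interior haS hφ η) ((differentiableAt_const S).prodMk differentiableAt_id)

/-! ### The fractional case. -/

/-- For `N ≠ 0` the running cost, the end point cost and the end time are separately stationary
along a minimizer: the free history of the state on `[a,A]` acts through the Caputo derivative as
a forcing term with dense range on `[A,T]`, so the dynamics impose no effective constraint.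
Consequently the multiplier vanishes, in accordance with the condition on `[a,A]`, by which
`∫_A^T (τ-t)^(-α) p(τ) dτ` is zero for all `t ∈ [a,A]`. -/
lemma stationary_of_frac {α a A xA M N : ℝ} (hα : α ∈ Ioo (0 : ℝ) 1)
    (haA : a < A) (hN : N ≠ 0) {G K : ℝ × ℝ × ℝ → ℝ} (hG : ContDiff ℝ 1 G) (hK : ContDiff ℝ 1 K)
    {φ : ℝ → ℝ → ℝ} (hφ : DifferentiableOn ℝ (fun q : ℝ × ℝ => φ q.1 q.2) (Ici a ×ˢ univ))
    {x u : ℝ → ℝ} {T : ℝ}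
    (hmin : IsMinimizer α a A xA M N (fun t x u => K (t, x, u)) (fun t x u => G (t, x, u))
      φ x u T) :
    (∀ t ∈ Icc A T, partialX K (t, x t, u t) = 0) ∧
    (∀ t ∈ Icc A T, partialU K (t, x t, u t) = 0) ∧
    deriv (fun η => φ T η) (x T) = 0 ∧
    K (T, x T, u T) + deriv (fun s => φ s (x T)) T = 0 := by
  have hAT : A < T := hmin.1.lt_final
  have haT : a < T := haA.trans hAT
  have hT : T ∈ Icc A T := ⟨hAT.le, le_rfl⟩
  have hx : ContinuousOn x (Icc A T) := hmin.1.state.continuousOn.mono (Icc_subset_Icc_left haA.le)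
  have hu : ContinuousOn u (Icc A T) := hmin.1.control
  have hpath : ContinuousOn (fun t => (t, x t, u t)) (Icc A T) :=
    continuousOn_id.prodMk (hx.prodMk hu)
  have hKx : ContinuousOn (fun t => partialX K (t, x t, u t)) (Icc A T) :=
    (continuous_partialX hK).comp_continuousOn hpath
  have hKu : ContinuousOn (fun t => partialU K (t, x t, u t)) (Icc A T) :=
    (continuous_partialU hK).comp_continuousOn hpath
  have hvar : ∀ h w : ℝ → ℝ, ContinuousOn h (Icc A T) → ContinuousOn w (Icc A T) → h A = 0 →
      (∫ t in A..T, (h t * partialX K (t, x t, u t) + w t * partialU K (t, x t, u t))) +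
        deriv (fun η => φ T η) (x T) * h T = 0 := by
    intro h w hh hw hhA
    refine first_variation_eq_zero hK hAT.le hx hu hh hw
      (differentiableAt_snd_of_interior haT hφ (x T)).hasDerivAt fun ε => ?_
    exact cost_le_of_continuous (M := M) hα haA hN hG hK.continuous hmin hAT
      (y := fun t => x t + ε * h t) (v := fun t => u t + ε * w t)
      (hx.add (hh.const_mul ε)) (hu.add (hw.const_mul ε))
      (by simp [hhA, hmin.1.start]) (differentiableAt_snd_of_interior haT hφ _).continuousAt
  have hU : ∀ t ∈ Icc A T, partialU K (t, x t, u t) = 0 := by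
    have h1 := hvar (fun _ => 0) (fun t => partialU K (t, x t, u t)) continuousOn_const hKu rfl
    refine eq_zero_of_integral_sq_weight hAT (ρ := fun _ => 1) continuousOn_const hKu
      (fun _ _ => one_pos) (fun _ _ => zero_le_one) (le_of_eq ?_)
    simpa using h1
  have hX : ∀ t ∈ Icc A T, partialX K (t, x t, u t) = 0 := by
    -- The weight makes the variation vanish at `A`, as required, and at `T`, so that the end cost
    -- does not contribute.
    have hρ : ContinuousOn (fun t => (t - A) * (T - t)) (Icc A T) := by fun_prop
    have h1 := hvar (fun t => (t - A) * (T - t) * partialX K (t, x t, u t)) (fun _ => 0)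
      (hρ.mul hKx) continuousOn_const (by simp)
    refine eq_zero_of_integral_sq_weight hAT hρ hKx
      (fun t ht => mul_pos (by linarith [ht.1]) (by linarith [ht.2]))
      (fun t ht => mul_nonneg (by linarith [ht.1]) (by linarith [ht.2])) (le_of_eq ?_)
    simpa [mul_assoc] using h1
  have hφx : deriv (fun η => φ T η) (x T) = 0 := by
    have h1 := hvar (fun t => t - A) (fun _ => 0) (by fun_prop) continuousOn_const (by simp)
    have h2 : ∫ t in A..T, ((t - A) * partialX K (t, x t, u t) +
        0 * partialU K (t, x t, u t)) = ∫ _t in A..T, (0 : ℝ) := by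
      refine intervalIntegral.integral_congr fun t ht => ?_
      rw [uIcc_of_le hAT.le] at ht
      simp [hX t ht]
    rw [h2] at h1
    simp only [intervalIntegral.integral_zero, zero_add] at h1
    exact (mul_eq_zero.1 h1).resolve_right (sub_pos.2 hAT).ne'
  refine ⟨hX, hU, hφx, ?_⟩
  -- State and control are extended past `T` and held fixed while the final time varies; the
  -- extension need not satisfy the dynamics. The term in `x'(T)` drops because `φ_x = 0`.
  obtain ⟨z, hz, -, hxz⟩ := hmin.1.exists_primitive haA
  obtain ⟨v, hv, huv⟩ := ContinuousOn.exists_continuous_extension hAT.le hu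
  have hTa : T ∈ Icc a T := ⟨haT.le, le_rfl⟩
  have hxT := hxz T hTa
  have h1 := final_time_stationary hK.continuous (continuous_primitive' hz A xA) hv
    (hasDerivAt_primitive hz A xA T) (φ := φ) (A := A)
    (differentiableAt_of_interior haT hφ _) (by
      filter_upwards [Ioi_mem_nhds hAT] with S hS
      rw [← cost_congr hAT.le (fun t x u => K (t, x, u)) φ
        (fun t ht => hxz t ⟨haA.le.trans ht.1, ht.2⟩) huv]
      exact cost_le_of_continuous (M := M) hα haA hN hG hK.continuous hmin hS
        (continuous_primitive' hz A xA).continuousOn hv.continuousOn (by simp)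
        (differentiableAt_snd_of_interior (haA.trans hS) hφ _).continuousAt)
  rw [← hxT, ← huv T hT, hφx, mul_zero, add_zero] at h1
  exact h1

/-! ### The case of an ordinary differential equation. -/

/-- Scalar linear equations with prescribed value at `T`, by an integrating factor. -/
lemma exists_linear_solution {b c : ℝ → ℝ} (hb : Continuous b) (hc : Continuous c) (T p₀ : ℝ) :
    ∃ p : ℝ → ℝ, (∀ t, HasDerivAt p (-c t - b t * p t) t) ∧ p T = p₀ := by
  set B : ℝ → ℝ := fun t => 0 + ∫ s in T..t, b s with hB
  have hBd : ∀ t, HasDerivAt B (b t) t := hasDerivAt_primitive hb T 0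
  have hBc : Continuous B := continuous_primitive' hb T 0
  have hcc : Continuous fun s => -c s * Real.exp (B s) := by fun_prop
  refine ⟨fun t => Real.exp (-B t) * (p₀ + ∫ s in T..t, -c s * Real.exp (B s)), fun t => ?_, ?_⟩
  · have h1 : HasDerivAt (fun t => Real.exp (-B t)) (Real.exp (-B t) * -b t) t := (hBd t).neg.exp
    refine (h1.mul (hasDerivAt_primitive hcc T p₀ t)).congr_deriv ?_
    have h2 : Real.exp (-B t) * Real.exp (B t) = 1 := by rw [← Real.exp_add]; simp
    linear_combination (-c t) * h2
  · simp [hB]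

lemma partialX_add_mul {K G : ℝ × ℝ × ℝ → ℝ} {p : ℝ → ℝ} (hK : ContDiff ℝ 1 K)
    (hG : ContDiff ℝ 1 G) (hp : ContDiff ℝ 1 p) (q : ℝ × ℝ × ℝ) :
    partialX (fun q => K q + p q.1 * G q) q = partialX K q + p q.1 * partialX G q := by
  obtain ⟨t, y, v⟩ := q
  have hH : ContDiff ℝ 1 (fun q : ℝ × ℝ × ℝ => K q + p q.1 * G q) :=
    hK.add ((hp.comp contDiff_fst).mul hG)
  exact (hasDerivAt_partialX hH t y v).unique
    ((hasDerivAt_partialX hK t y v).add ((hasDerivAt_partialX hG t y v).const_mul (p t)))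

lemma partialU_add_mul {K G : ℝ × ℝ × ℝ → ℝ} {p : ℝ → ℝ} (hK : ContDiff ℝ 1 K)
    (hG : ContDiff ℝ 1 G) (hp : ContDiff ℝ 1 p) (q : ℝ × ℝ × ℝ) :
    partialU (fun q => K q + p q.1 * G q) q = partialU K q + p q.1 * partialU G q := by
  obtain ⟨t, y, v⟩ := q
  have hH : ContDiff ℝ 1 (fun q : ℝ × ℝ × ℝ => K q + p q.1 * G q) :=
    hK.add ((hp.comp contDiff_fst).mul hG)
  exact (hasDerivAt_partialU hH t y v).unique
    ((hasDerivAt_partialU hK t y v).add ((hasDerivAt_partialU hG t y v).const_mul (p t)))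

/-- Perturbing the control of the ordinary differential equation `M ẋ = G(t,x,u)` by `O(ε)` moves
the solution by `O(ε)`. -/
lemma exists_perturbed_solution {M A T xA : ℝ} (hM : M ≠ 0) (hAT : A ≤ T) {G : ℝ × ℝ × ℝ → ℝ}
    (hG : ContDiff ℝ 1 G) {z v w : ℝ → ℝ} (hz : Continuous z) (hv : Continuous v)
    (hw : Continuous w)
    (hdyn : ∀ t ∈ Icc A T, M * z t = G (t, xA + ∫ s in A..t, z s, v t)) :
    ∃ C ≥ 0, ∃ ε₀ > 0, ∀ ε, |ε| < ε₀ → ∃ z' : ℝ → ℝ, Continuous z' ∧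
      (∀ t ∈ Icc A T, M * z' t = G (t, xA + ∫ s in A..t, z' s, v t + ε * w t)) ∧
      ∀ t ∈ Icc A T, |(∫ s in A..t, z' s) - ∫ s in A..t, z s| ≤ C * |ε| := by
  set y : ℝ → ℝ := fun t => xA + ∫ s in A..t, z s with hy
  have hyc : Continuous y := continuous_primitive' hz A xA
  obtain ⟨Λ, hΛ, hbd⟩ := exists_bound_partialX hG (A := A) (S := T) hyc.continuousOn
    hv.continuousOn
  obtain ⟨C, hC, hsol⟩ := exists_solution_of_ne_zero (A := A) (S₀ := T) (k := 0) hM one_pos hΛ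
  obtain ⟨δ, hδ, hrem⟩ := exists_remainder_modulus hG (A := A) (S := T) hyc.continuousOn
    hv.continuousOn one_pos
  obtain ⟨m₀, hm₀⟩ := (isCompact_Icc (a := A) (b := T)).exists_bound_of_continuousOn
    hw.continuousOn
  obtain ⟨g₀, hg₀⟩ := (isCompact_Icc (a := A) (b := T)).exists_bound_of_continuousOn
    (f := fun t => partialU G (t, y t, v t))
    ((continuous_partialU hG).comp (continuous_id.prodMk (hyc.prodMk hv))).continuousOn
  set m := max m₀ 0 with hm
  set g := max g₀ 0 with hg
  have hm0 : 0 ≤ m := le_max_right _ _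
  have hg0 : 0 ≤ g := le_max_right _ _
  have hmb : ∀ t ∈ Icc A T, |w t| ≤ m := fun t ht => (hm₀ t ht).trans (le_max_left _ _)
  have hgb : ∀ t ∈ Icc A T, |partialU G (t, y t, v t)| ≤ g :=
    fun t ht => (hg₀ t ht).trans (le_max_left _ _)
  -- Under the perturbed control the old solution has residual at most `C₀ |ε|`: `m |ε|` from the
  -- Taylor remainder with modulus `1`, and `m g |ε|` from the first order term.
  set C₀ := m * (1 + g) with hC₀
  have hC₀0 : 0 ≤ C₀ := by positivity
  refine ⟨C * C₀, by positivity, min (min 1 δ / (m + 1)) (1 / (C * C₀ + 1)), by positivity,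
    fun ε hε => ?_⟩
  have hε1 : |ε| * (m + 1) < min 1 δ :=
    (lt_div_iff₀ (by positivity)).1 (hε.trans_le (min_le_left _ _))
  have hε2 : |ε| * (C * C₀ + 1) < 1 :=
    (lt_div_iff₀ (by positivity)).1 (hε.trans_le (min_le_right _ _))
  have hεw : ∀ t ∈ Icc A T, |ε * w t| ≤ min 1 δ := fun t ht => by
    rw [abs_mul]
    calc _ ≤ |ε| * m := by gcongr; exact hmb t ht
      _ ≤ |ε| * (m + 1) := by gcongr; linarith
      _ ≤ _ := hε1.le
  have hvc : Continuous fun t => v t + ε * w t := hv.add (hw.const_mul ε)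
  obtain ⟨z', hz', heq, -, hcl⟩ := hsol T hAT le_rfl (fun t η => G (t, η, v t + ε * w t)) z xA
    (C₀ * |ε|)
    (hG.continuous.comp (continuous_fst.prodMk (continuous_snd.prodMk (hvc.comp continuous_fst))))
    hz
    (fun t ht η η' h1 h2 => abs_sub_le_of_partialX hG (y := y t)
      (fun η hη => hbd t ht η _ hη (by
        rw [add_sub_cancel_left]; exact (hεw t ht).trans (min_le_left _ _))) h1 h2)
    (fun t ht => by
      have h1 := hrem t ht 0 (ε * w t) (by simpa using hδ.le) ((hεw t ht).trans (min_le_right _ _))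
      simp only [add_zero, zero_mul, zero_add, abs_zero, one_mul] at h1
      have h2 : |ε * w t * partialU G (t, y t, v t)| ≤ |ε| * m * g := by
        rw [abs_mul, abs_mul]; gcongr
        · exact hmb t ht
        · exact hgb t ht
      have h3 : |ε * w t| ≤ |ε| * m := by
        rw [abs_mul]; gcongr; exact hmb t ht
      rw [zero_mul, add_zero, hdyn t ht, abs_sub_comm]
      have h4 := abs_add_le (G (t, y t, v t + ε * w t) - G (t, y t, v t) -
        ε * w t * partialU G (t, y t, v t)) (ε * w t * partialU G (t, y t, v t))
      rw [sub_add_cancel] at h4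
      calc _ ≤ |ε| * m + |ε| * m * g := h4.trans (add_le_add (h1.trans h3) h2)
        _ = C₀ * |ε| := by rw [hC₀]; ring)
    (by nlinarith [abs_nonneg ε])
  refine ⟨z', hz', fun t ht => by simpa using heq t ht, fun t ht => ?_⟩
  rw [mul_assoc]; exact hcl t ht

/-- Continuation of a solution of `M ẋ = G(t,x,u)` beyond the final time. -/
lemma exists_continuation {M A T xA : ℝ} (hM : M ≠ 0) (hAT : A ≤ T) {G : ℝ × ℝ × ℝ → ℝ}
    (hG : ContDiff ℝ 1 G) {z v : ℝ → ℝ} (hz : Continuous z) (hv : Continuous v)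
    (hdyn : ∀ t ∈ Icc A T, M * z t = G (t, xA + ∫ s in A..t, z s, v t)) :
    ∃ z' : ℝ → ℝ, Continuous z' ∧ (∀ t ≤ T, z' t = z t) ∧ ∃ T' > T,
      ∀ t ∈ Icc A T', M * z' t = G (t, xA + ∫ s in A..t, z' s, v t) := by
  set xT := xA + ∫ s in A..T, z s with hxT
  set y : ℝ → ℝ := fun t => xT + ∫ _s in T..t, z T with hy
  have hyc : Continuous y := continuous_primitive' continuous_const T xT
  obtain ⟨Λ, hΛ, hbd⟩ := exists_bound_partialX hG (A := T) (S := T + 1) hyc.continuousOn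
    hv.continuousOn
  obtain ⟨C, hC, hsol⟩ := exists_solution_of_ne_zero (A := T) (S₀ := T + 1) (k := 0) hM one_pos hΛ
  have hyT : y T = xT := by simp [hy]
  have hzT : M * z T = G (T, xT, v T) := hdyn T ⟨hAT, le_rfl⟩
  have hres : Continuous fun t => M * z T - G (t, y t, v t) :=
    continuous_const.sub (hG.continuous.comp (continuous_id.prodMk (hyc.prodMk hv)))
  -- The constant derivative `z T` solves the equation at `T` exactly, so its residual is at most
  -- `1/C` shortly after `T`, which is all that the solvability lemma demands.
  obtain ⟨δ, hδ, hδres⟩ := Metric.continuousAt_iff.1 (hres.continuousAt (x := T)) (1 / C)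
    (by positivity)
  set T' := T + min 1 (δ / 2) with hT'
  have hTT' : T < T' := by
    have : 0 < min 1 (δ / 2) := lt_min one_pos (half_pos hδ)
    linarith
  obtain ⟨z₂, hz₂, heq, -, -⟩ := hsol T' hTT'.le (by rw [hT']; gcongr; exact min_le_left _ _)
    (fun t η => G (t, η, v t)) (fun _ => z T) xT (1 / C)
    (hG.continuous.comp (continuous_fst.prodMk (continuous_snd.prodMk (hv.comp continuous_fst))))
    continuous_const
    (fun t ht η η' h1 h2 => abs_sub_le_of_partialX hG (y := y t)
      (fun η hη => hbd t ⟨ht.1, ht.2.trans (by rw [hT']; gcongr; exact min_le_left _ _)⟩ η _ hη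
        (by simp)) h1 h2)
    (fun t ht => by
      have h1 := hδres (x := t) (by
        rw [Real.dist_eq, abs_of_nonneg (by linarith [ht.1])]
        have h2 := ht.2
        have h3 : min 1 (δ / 2) ≤ δ / 2 := min_le_right _ _
        rw [hT'] at h2
        linarith)
      rw [Real.dist_eq, hyT, hzT, sub_self, sub_zero, ← hzT] at h1
      rw [zero_mul, add_zero]
      exact h1.le)
    (by rw [mul_one_div_cancel hC.ne'])
  have hz₂T : z₂ T = z T := by
    have h1 := heq T ⟨le_rfl, hTT'.le⟩
    simp only [intervalIntegral.integral_same, add_zero, zero_mul] at h1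
    exact mul_left_cancel₀ hM (h1.trans hzT.symm)
  set z' : ℝ → ℝ := fun t => z (min t T) + z₂ (max t T) - z T with hz'
  have hz'c : Continuous z' := by fun_prop
  have hle : ∀ t ≤ T, z' t = z t := fun t ht => by
    simp only [hz', min_eq_left ht, max_eq_right ht, hz₂T]; ring
  have hge : ∀ t, T ≤ t → z' t = z₂ t := fun t ht => by
    simp only [hz', min_eq_right ht, max_eq_left ht]; ring
  have hint : ∀ t ∈ Icc A T, ∫ s in A..t, z' s = ∫ s in A..t, z s := by
    intro t ht
    refine intervalIntegral.integral_congr fun s hs => ?_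
    rw [uIcc_of_le ht.1] at hs
    exact hle s (hs.2.trans ht.2)
  refine ⟨z', hz'c, hle, T', hTT', fun t ht => ?_⟩
  rcases le_total t T with h | h
  · rw [hle t h, hint t ⟨ht.1, h⟩]
    exact hdyn t ⟨ht.1, h⟩
  · have h1 := heq t ⟨h, ht.2⟩
    have h2 : ∫ s in T..t, z' s = ∫ s in T..t, z₂ s := by
      refine intervalIntegral.integral_congr fun s hs => ?_
      rw [uIcc_of_le h] at hs
      exact hge s hs.1
    rw [hge t h, ← intervalIntegral.integral_add_adjacent_intervals
      (hz'c.intervalIntegrable A T) (hz'c.intervalIntegrable T t), h2, hint T ⟨hAT, le_rfl⟩,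
      ← add_assoc, ← hxT]
    simpa using h1

/-- Maximum principle for the minimization of a cost under `M ẋ = G(t,x,u)`. -/
lemma pontryagin_of_ode {α a A xA M : ℝ} (haA : a < A) (hM : M ≠ 0)
    {G K : ℝ × ℝ × ℝ → ℝ} (hG : ContDiff ℝ 1 G) (hK : ContDiff ℝ 1 K)
    {φ : ℝ → ℝ → ℝ} (hφ : DifferentiableOn ℝ (fun q : ℝ × ℝ => φ q.1 q.2) (Ici a ×ˢ univ))
    {x u : ℝ → ℝ} {T : ℝ}
    (hmin : IsMinimizer α a A xA M 0 (fun t x u => K (t, x, u)) (fun t x u => G (t, x, u))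
      φ x u T) :
    ∃ p p' : ℝ → ℝ, (∀ t, HasDerivAt p (p' t) t) ∧
      (∀ t ∈ Icc A T, M * p' t =
        -(partialX K (t, x t, u t) + p t * partialX G (t, x t, u t))) ∧
      (∀ t ∈ Icc A T, partialU K (t, x t, u t) + p t * partialU G (t, x t, u t) = 0) ∧
      M * p T = deriv (fun η => φ T η) (x T) ∧
      K (T, x T, u T) + p T * G (T, x T, u T) + deriv (fun s => φ s (x T)) T = 0 := by
  have hAT : A < T := hmin.1.lt_final
  have haT : a < T := haA.trans hAT
  obtain ⟨z, hz, hzd, hxz⟩ := hmin.1.exists_primitive haA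
  obtain ⟨v, hv, huv⟩ := ContinuousOn.exists_continuous_extension hAT.le hmin.1.control
  set y : ℝ → ℝ := fun t => xA + ∫ s in A..t, z s with hy
  have hyc : Continuous y := continuous_primitive' hz A xA
  have hxy : ∀ t ∈ Icc A T, x t = y t := fun t ht => hxz t ⟨haA.le.trans ht.1, ht.2⟩
  have hT : T ∈ Icc A T := ⟨hAT.le, le_rfl⟩
  have hcost : cost A (fun t x u => K (t, x, u)) φ x u T =
      cost A (fun t x u => K (t, x, u)) φ y v T := cost_congr hAT.le _ φ hxy huv
  have hdyn : ∀ t ∈ Icc A T, M * z t = G (t, y t, v t) := by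
    intro t ht
    have h1 := hmin.1.dynamics t ht
    rw [zero_mul, add_zero, hzd t ⟨haA.le.trans ht.1, ht.2⟩] at h1
    simpa only [hxy t ht, huv t ht] using h1
  have hadm : ∀ S, A < S → ∀ z' v' : ℝ → ℝ, Continuous z' → Continuous v' →
      (∀ t ∈ Icc A S, M * z' t = G (t, xA + ∫ s in A..t, z' s, v' t)) →
      cost A (fun t x u => K (t, x, u)) φ y v T ≤
        cost A (fun t x u => K (t, x, u)) φ (fun t => xA + ∫ s in A..t, z' s) v' S := by
    intro S hS z' v' hz' hv' h
    rw [← hcost]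
    exact hmin.2 _ _ _ (isAdmissible_primitive haA hS hz' hv'.continuousOn fun t ht => by
      rw [zero_mul, add_zero]; exact h t ht)
  have hpath : Continuous fun t => (t, y t, v t) := continuous_id.prodMk (hyc.prodMk hv)
  set c := deriv (fun η => φ T η) (y T) with hc
  have hφT : HasDerivAt (φ T) c (y T) :=
    (differentiableAt_snd_of_interior haT hφ (y T)).hasDerivAt
  obtain ⟨p, hp, hpT⟩ := exists_linear_solution
    (b := fun t => partialX G (t, y t, v t) / M) (c := fun t => partialX K (t, y t, v t) / M)
    (((continuous_partialX hG).comp hpath).div_const M)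
    (((continuous_partialX hK).comp hpath).div_const M) T (c / M)
  set p' : ℝ → ℝ := fun t => -(partialX K (t, y t, v t) / M) - partialX G (t, y t, v t) / M * p t
    with hp'
  have hpc : Continuous p := continuous_iff_continuousAt.2 fun t => (hp t).continuousAt
  have hp'c : Continuous p' :=
    (((continuous_partialX hK).comp hpath).div_const M).neg.sub
      ((((continuous_partialX hG).comp hpath).div_const M).mul hpc)
  have hp1 : ContDiff ℝ 1 p := by
    rw [contDiff_one_iff_deriv, funext fun t => (hp t).deriv]
    exact ⟨fun t => (hp t).differentiableAt, hp'c⟩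
  have hMp' : ∀ t, M * p' t = -(partialX K (t, y t, v t) + p t * partialX G (t, y t, v t)) :=
    fun t => by simp only [hp']; field_simp; ring
  have hMpT : M * p T = c := by rw [hpT]; field_simp
  -- the Hamiltonian along the multiplier
  set H : ℝ × ℝ × ℝ → ℝ := fun q => K q + p q.1 * G q with hH
  have hHc : ContDiff ℝ 1 H := hK.add ((hp1.comp contDiff_fst).mul hG)
  have hHX : ∀ t, M * p' t = -partialX H (t, y t, v t) := fun t => by
    rw [hMp', hH, partialX_add_mul hK hG hp1]
  -- Steepest descent direction: the first order change of the cost is `-ε ∫ w²`, so minimality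
  -- forces `w = 0`.
  set w : ℝ → ℝ := fun t => -partialU H (t, y t, v t) with hw
  have hwc : Continuous w := ((continuous_partialU hHc).comp hpath).neg
  have hsq : ∫ t in A..T, (1 : ℝ) * (w t * w t) ≤ 0 := by
    obtain ⟨C, hC, ε₀, hε₀, hsol⟩ := exists_perturbed_solution hM hAT.le hG hz hv hwc hdyn
    refine le_of_forall_pos_le_add fun η hη => ?_
    obtain ⟨m, hm⟩ := (isCompact_Icc (a := A) (b := T)).exists_bound_of_continuousOn
      hwc.continuousOn
    have hm0 : 0 ≤ m := (norm_nonneg _).trans (hm T hT)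
    obtain ⟨ε₁, hε₁, hrem⟩ := exists_integral_remainder_le hHc hAT.le (y := y) (v := v)
      hyc.continuousOn hv.continuousOn (C := max C m) (le_max_of_le_left hC) (half_pos hη)
    have hlo := (hasDerivAt_iff_isLittleO_nhds_zero.1 hφT)
    rw [Asymptotics.isLittleO_iff] at hlo
    obtain ⟨ε₂, hε₂, hlo'⟩ := Metric.eventually_nhds_iff.1
      (hlo (show 0 < η / (2 * (C + 1)) by positivity))
    obtain ⟨ε, hε, hεlt⟩ := exists_between
      (show 0 < min ε₀ (min ε₁ (ε₂ / (C + 1))) by positivity)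
    have hεabs : |ε| = ε := abs_of_pos hε
    obtain ⟨z', hz', heq, hcl⟩ := hsol ε (by rw [hεabs]; exact hεlt.trans_le (min_le_left _ _))
    rw [hεabs] at hcl
    set y' : ℝ → ℝ := fun t => xA + ∫ s in A..t, z' s with hy'
    have hy'c : Continuous y' := continuous_primitive' hz' A xA
    set h : ℝ → ℝ := fun t => y' t - y t with hh
    have hhb : ∀ t ∈ Icc A T, |h t| ≤ C * ε := fun t ht => by
      simp only [hh, hy', hy, add_sub_add_left_eq_sub]; exact hcl t ht
    have hyh : ∀ t, y t + h t = y' t := fun t => by simp only [hh]; ring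
    have hhc : Continuous h := hy'c.sub hyc
    have hJ := hadm T hAT z' (fun t => v t + ε * w t) hz' (hv.add (hwc.const_mul ε)) heq
    -- integration by parts
    have hparts : ∫ t in A..T, (-(partialX H (t, y t, v t)) * h t +
        p t * (G (t, y' t, v t + ε * w t) - G (t, y t, v t))) = c * h T := by
      have h1 : ∀ t ∈ uIcc A T, HasDerivAt (fun t => M * (p t * h t))
          (M * (p' t * h t + p t * (z' t - z t))) t := fun t _ =>
        ((hp t).mul ((hasDerivAt_primitive hz' A xA t).sub
          (hasDerivAt_primitive hz A xA t))).const_mul M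
      have h2 := intervalIntegral.integral_eq_sub_of_hasDerivAt h1
        ((((hp'c.mul hhc).add (hpc.mul (hz'.sub hz))).const_mul M).intervalIntegrable _ _)
      have h3 : h A = 0 := by simp [hh, hy', hy]
      rw [h3, mul_zero, mul_zero, sub_zero, ← mul_assoc, hMpT] at h2
      rw [← h2]
      refine intervalIntegral.integral_congr fun t ht => ?_
      rw [uIcc_of_le hAT.le] at ht
      rw [← hHX t, ← heq t ht, ← hdyn t ht]
      ring
    -- expansion of the Hamiltonian
    have hr := hrem ε (by rw [hεabs]; exact hεlt.trans_le ((min_le_right _ _).trans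
      (min_le_left _ _))) h (fun t => ε * w t)
      (fun t ht => by
        rw [hεabs]
        exact (hhb t ht).trans (mul_le_mul_of_nonneg_right (le_max_left _ _) hε.le))
      (fun t ht => by
        rw [abs_mul, hεabs, mul_comm]
        exact mul_le_mul_of_nonneg_right ((hm t ht).trans (le_max_right _ _)) hε.le)
    rw [hεabs] at hr
    simp only [hyh] at hr
    have hpath' : Continuous fun t => (t, y' t, v t + ε * w t) :=
      continuous_id.prodMk (hy'c.prodMk (hv.add (hwc.const_mul ε)))
    have hXc : Continuous fun t => partialX H (t, y t, v t) :=
      (continuous_partialX hHc).comp hpath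
    have hGc : Continuous fun t => G (t, y t, v t) := hG.continuous.comp hpath
    have hGc' : Continuous fun t => G (t, y' t, v t + ε * w t) := hG.continuous.comp hpath'
    have hKc : Continuous fun t => K (t, y t, v t) := hK.continuous.comp hpath
    have hKc' : Continuous fun t => K (t, y' t, v t + ε * w t) := hK.continuous.comp hpath'
    -- The two middle terms integrate to `c h(T)`, the linear part of the change of the end cost.
    -- Hence the change of the whole cost plus `ε ∫ w²` is at most `η ε`, half from each remainder,
    -- and the former is nonnegative.
    have hsplit : ∫ t in A..T, (H (t, y' t, v t + ε * w t) - H (t, y t, v t) -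
        (h t * partialX H (t, y t, v t) + ε * w t * partialU H (t, y t, v t))) =
        ((∫ t in A..T, K (t, y' t, v t + ε * w t)) - ∫ t in A..T, K (t, y t, v t)) +
        (∫ t in A..T, (-(partialX H (t, y t, v t)) * h t +
          p t * (G (t, y' t, v t + ε * w t) - G (t, y t, v t)))) +
        ε * ∫ t in A..T, 1 * (w t * w t) := by
      have i1 : Continuous fun t => K (t, y' t, v t + ε * w t) - K (t, y t, v t) := hKc'.sub hKc
      have i2 : Continuous fun t => -(partialX H (t, y t, v t)) * h t +
          p t * (G (t, y' t, v t + ε * w t) - G (t, y t, v t)) :=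
        (hXc.neg.mul hhc).add (hpc.mul (hGc'.sub hGc))
      have i12 : Continuous fun t => K (t, y' t, v t + ε * w t) - K (t, y t, v t) +
          (-(partialX H (t, y t, v t)) * h t +
            p t * (G (t, y' t, v t + ε * w t) - G (t, y t, v t))) := i1.add i2
      have i3 : Continuous fun t => ε * (1 * (w t * w t)) := by fun_prop
      rw [← intervalIntegral.integral_const_mul, ← intervalIntegral.integral_sub
        (hKc'.intervalIntegrable _ _) (hKc.intervalIntegrable _ _),
        ← intervalIntegral.integral_add (i1.intervalIntegrable _ _) (i2.intervalIntegrable _ _),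
        ← intervalIntegral.integral_add (i12.intervalIntegrable _ _)
          (i3.intervalIntegrable _ _)]
      refine intervalIntegral.integral_congr fun t _ => ?_
      simp only [hw, hH]
      ring
    rw [hsplit, hparts] at hr
    have hhT := hhb T hT
    have hlo2 := hlo' (y := h T) (by
      rw [dist_zero_right, Real.norm_eq_abs]
      have h1 : ε < ε₂ / (C + 1) :=
        hεlt.trans_le ((min_le_right _ _).trans (min_le_right _ _))
      rw [lt_div_iff₀ (by positivity)] at h1
      nlinarith)
    rw [Real.norm_eq_abs, Real.norm_eq_abs, hyh, smul_eq_mul] at hlo2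
    have h5 : η / (2 * (C + 1)) * |h T| ≤ η / 2 * ε := by
      calc _ ≤ η / (2 * (C + 1)) * ((C + 1) * ε) := by
            gcongr
            exact hhT.trans (by gcongr; linarith)
        _ = _ := by field_simp
    have h6 := (abs_le.1 (hlo2.trans h5)).2
    have h7 := (abs_le.1 hr).2
    simp only [cost] at hJ
    rw [zero_add]
    refine le_of_mul_le_mul_left (a := ε) ?_ hε
    have h8 : y' T = xA + ∫ s in A..T, z' s := rfl
    rw [← h8] at hJ
    linarith
  have hw0 : ∀ t ∈ Icc A T, w t = 0 :=
    eq_zero_of_integral_sq_weight hAT continuousOn_const hwc.continuousOn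
      (fun _ _ => one_pos) (fun _ _ => zero_le_one) hsq
  -- stationarity of the final time
  obtain ⟨z', hz', hzz, T', hTT', heq⟩ := exists_continuation hM hAT.le hG hz hv hdyn
  have hyy : ∀ t ∈ Icc A T, y t = xA + ∫ s in A..t, z' s := by
    intro t ht
    simp only [hy]
    congr 1
    refine intervalIntegral.integral_congr fun s hs => ?_
    rw [uIcc_of_le ht.1] at hs
    exact (hzz s (hs.2.trans ht.2)).symm
  have hfin := final_time_stationary hK.continuous (continuous_primitive' hz' A xA) hv
    (hasDerivAt_primitive hz' A xA T) (φ := φ) (A := A) (differentiableAt_of_interior haT hφ _) (by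
      filter_upwards [Ioo_mem_nhds hAT hTT'] with S hS
      rw [← cost_congr hAT.le (fun t x u => K (t, x, u)) φ hyy fun _ _ => rfl]
      exact hadm S hS.1 z' v hz' hv fun t ht => heq t ⟨ht.1, ht.2.trans hS.2.le⟩)
  -- Here `φ_x x'(T)` becomes `M p(T) x'(T)`, which the dynamics turn into `p(T) G` at `T`.
  rw [← hyy T hT, hzz T le_rfl, ← hc, ← hMpT] at hfin
  refine ⟨p, p', hp, fun t ht => ?_, fun t ht => ?_, ?_, ?_⟩
  · rw [hxy t ht, huv t ht]; exact hMp' t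
  · have h1 := hw0 t ht
    simp only [hw, hH, neg_eq_zero] at h1
    rw [partialU_add_mul hK hG hp1] at h1
    rw [hxy t ht, huv t ht]; exact h1
  · rw [hxy T hT]; exact hMpT
  · rw [hxy T hT, huv T hT, ← hdyn T hT]
    linarith

/-! ### Extension of the data to the line, and conclusion. -/

/-- A `C¹` map of the line into `[a,∞)` that is the identity on `[A,∞)`. -/
lemma exists_time_change {a A : ℝ} (haA : a < A) :
    ∃ θ : ℝ → ℝ, ContDiff ℝ 1 θ ∧ (∀ t ≥ A, θ t = t) ∧ ∀ t, a ≤ θ t := by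
  have hc : 0 < A - a := sub_pos.2 haA
  -- As derivative of `θ`, this equals `1` after `A` and decays exponentially before it, with total
  -- mass `A - a` on `(-∞,A]`; so `θ` never falls below `a`.
  set ρ : ℝ → ℝ := fun s => Real.exp (min 0 ((s - A) / (A - a))) with hρ
  have hρc : Continuous ρ := by fun_prop
  have h1 : ∀ t ≥ A, A + ∫ s in A..t, ρ s = t := by
    intro t ht
    have h2 : ∫ s in A..t, ρ s = ∫ _s in A..t, (1 : ℝ) := by
      refine intervalIntegral.integral_congr fun s hs => ?_
      rw [uIcc_of_le ht] at hs
      simp [hρ, min_eq_left (div_nonneg (sub_nonneg.2 hs.1) hc.le)]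
    rw [h2]; simp
  refine ⟨fun t => A + ∫ s in A..t, ρ s, contDiff_primitive hρc A A, h1, fun t => ?_⟩
  beta_reduce
  rcases le_total A t with ht | ht
  · rw [h1 t ht]; linarith
  · have h2 : ∫ s in A..t, ρ s = ∫ s in A..t, Real.exp ((s - A) / (A - a)) := by
      refine intervalIntegral.integral_congr fun s hs => ?_
      rw [uIcc_of_ge ht] at hs
      simp only [hρ]
      rw [min_eq_right (div_nonpos_of_nonpos_of_nonneg (by linarith [hs.2]) hc.le)]
    have h3 : ∀ s ∈ uIcc A t, HasDerivAt (fun s => (A - a) * Real.exp ((s - A) / (A - a)))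
        (Real.exp ((s - A) / (A - a))) s := by
      intro s _
      have h4 : HasDerivAt (fun s => Real.exp ((s - A) / (A - a)))
          (Real.exp ((s - A) / (A - a)) * (1 / (A - a))) s :=
        (((hasDerivAt_id s).sub_const A).div_const (A - a)).exp
      refine (h4.const_mul (A - a)).congr_deriv ?_
      field_simp
    rw [h2, intervalIntegral.integral_eq_sub_of_hasDerivAt h3
      (Continuous.intervalIntegrable (by fun_prop) _ _)]
    simp only [sub_self, zero_div, Real.exp_zero, mul_one]
    have := mul_pos hc (Real.exp_pos ((t - A) / (A - a)))
    linarith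

lemma IsAdmissible.congr {α a A xA M N : ℝ} {f g : ℝ → ℝ → ℝ → ℝ}
    (hfg : ∀ t ≥ A, ∀ y v, f t y v = g t y v) {x u : ℝ → ℝ} {T : ℝ}
    (h : IsAdmissible α a A xA M N f x u T) : IsAdmissible α a A xA M N g x u T where
  lt_final := h.lt_final
  state := h.state
  control := h.control
  start := h.start
  dynamics := fun t ht => by rw [← hfg t ht.1]; exact h.dynamics t ht

lemma cost_congr_lagrangian {A T : ℝ} (hAT : A ≤ T) {L K : ℝ → ℝ → ℝ → ℝ}
    (hLK : ∀ t ≥ A, ∀ y v, L t y v = K t y v) (φ : ℝ → ℝ → ℝ) (x u : ℝ → ℝ) :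
    cost A L φ x u T = cost A K φ x u T := by
  unfold cost
  congr 1
  refine intervalIntegral.integral_congr fun t ht => ?_
  rw [uIcc_of_le hAT] at ht
  exact hLK t ht.1 _ _

lemma IsMinimizer.congr {α a A xA M N : ℝ} {L K f g : ℝ → ℝ → ℝ → ℝ}
    (hLK : ∀ t ≥ A, ∀ y v, L t y v = K t y v) (hfg : ∀ t ≥ A, ∀ y v, f t y v = g t y v)
    {φ : ℝ → ℝ → ℝ} {x u : ℝ → ℝ} {T : ℝ} (h : IsMinimizer α a A xA M N L f φ x u T) :
    IsMinimizer α a A xA M N K g φ x u T := by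
  refine ⟨h.1.congr hfg, fun y v S hS => ?_⟩
  have h1 := h.2 y v S (hS.congr fun t ht y v => (hfg t ht y v).symm)
  rwa [cost_congr_lagrangian h.1.lt_final.le hLK, cost_congr_lagrangian hS.lt_final.le hLK] at h1

lemma rightRLI_zero (β b : ℝ) : rightRLI β b (fun _ => 0) = fun _ => 0 := by
  funext t
  simp [rightRLI]

lemma rightRLD_zero (α a b t : ℝ) : rightRLD α a b (fun _ => 0) t = 0 := by
  simp [rightRLD, rightRLI_zero]

lemma hasRightRLDOn_zero (α a b : ℝ) : HasRightRLDOn α a b (fun _ => 0) := by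
  rw [HasRightRLDOn, rightRLI_zero]
  exact differentiableOn_const 0

end FracOC

theorem theorem4 (α a A xA M N : ℝ) (hα : α ∈ Ioo (0 : ℝ) 1) (haA : a < A)
    (hMN : (M, N) ≠ (0, 0))
    (L f : ℝ → ℝ → ℝ → ℝ) (φ : ℝ → ℝ → ℝ)
    (hL : ContDiffOn ℝ 1 (fun q : ℝ × ℝ × ℝ => L q.1 q.2.1 q.2.2) (Ici a ×ˢ univ))
    (hf : ContDiffOn ℝ 1 (fun q : ℝ × ℝ × ℝ => f q.1 q.2.1 q.2.2) (Ici a ×ˢ univ))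
    (hφ : DifferentiableOn ℝ (fun q : ℝ × ℝ => φ q.1 q.2) (Ici a ×ˢ univ))
    (x u : ℝ → ℝ) (T : ℝ)
    (hmin : FracOC.IsMinimizer α a A xA M N L f φ x u T) :
    ∃ p : ℝ → ℝ,
      -- regularity of the multiplier: all operators below are applied where they exist
      ContinuousOn p (Icc a T) ∧
      (M ≠ 0 → DifferentiableOn ℝ p (Icc A T)) ∧
      (N ≠ 0 → FracOC.HasRightRLDOn α a T p ∧ FracOC.HasRightRLDOn α a A p) ∧
      -- Hamiltonian system on [A,T]
      (∀ t ∈ Icc A T,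
        M * derivWithin p (Icc A T) t - N * FracOC.rightRLD α a T p t
            = -deriv (fun y => FracOC.hamiltonian L f t y (u t) (p t)) (x t) ∧
        M * derivWithin x (Icc a T) t + N * FracOC.caputoLeft α a x t
            = deriv (fun q => FracOC.hamiltonian L f t (x t) (u t) q) (p t)) ∧
      -- condition on [a,A]
      (N ≠ 0 → ∀ t ∈ Icc a A, FracOC.rightRLD α a T p t - FracOC.rightRLD α a A p t = 0) ∧
      -- stationary condition on [A,T]
      (∀ t ∈ Icc A T, deriv (fun v => FracOC.hamiltonian L f t (x t) v (p t)) (u t) = 0) ∧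
      -- transversality conditions at t = T
      FracOC.hamiltonian L f T (x T) (u T) (p T) - N * p T * FracOC.caputoLeft α a x T
          + N * derivWithin x (Icc a T) T * FracOC.rightRLI (1 - α) T p T
          + deriv (fun s => φ s (x T)) T = 0 ∧
      M * p T + N * FracOC.rightRLI (1 - α) T p T - deriv (fun y => φ T y) (x T) = 0 ∧
      -- transversality condition at t = a
      (N ≠ 0 → FracOC.rightRLI (1 - α) T p a - FracOC.rightRLI (1 - α) A p a = 0) := by
  open FracOC in
  -- Precomposition with `θ` extends `L` and `f` to `C¹` functions on the whole space without
  -- changing them for `t ≥ A`, the only times the problem sees.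
  obtain ⟨θ, hθ, hθA, hθa⟩ := exists_time_change haA
  have hpath : ContDiff ℝ 1 fun q : ℝ × ℝ × ℝ => (θ q.1, q.2) :=
    (hθ.comp contDiff_fst).prodMk contDiff_snd
  set K : ℝ × ℝ × ℝ → ℝ := fun q => L (θ q.1) q.2.1 q.2.2 with hKdef
  set G : ℝ × ℝ × ℝ → ℝ := fun q => f (θ q.1) q.2.1 q.2.2 with hGdef
  have hK : ContDiff ℝ 1 K := hL.comp_contDiff hpath fun q => ⟨hθa q.1, mem_univ _⟩
  have hG : ContDiff ℝ 1 G := hf.comp_contDiff hpath fun q => ⟨hθa q.1, mem_univ _⟩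
  have hLK : ∀ t ≥ A, ∀ y v, L t y v = K (t, y, v) := fun t ht y v => by
    simp only [hKdef, hθA t ht]
  have hfG : ∀ t ≥ A, ∀ y v, f t y v = G (t, y, v) := fun t ht y v => by
    simp only [hGdef, hθA t ht]
  have hmin' := hmin.congr (K := fun t y v => K (t, y, v)) (g := fun t y v => G (t, y, v)) hLK hfG
  have hAT : A < T := hmin.1.lt_final
  have hT : T ∈ Icc A T := ⟨hAT.le, le_rfl⟩
  have hHp : ∀ t : ℝ, ∀ q : ℝ,
      deriv (fun q => FracOC.hamiltonian L f t (x t) (u t) q) q = f t (x t) (u t) := fun t q => by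
    simp [FracOC.hamiltonian]
  have hHx : ∀ t ∈ Icc A T, ∀ q : ℝ, deriv (fun y => FracOC.hamiltonian L f t y (u t) q) (x t) =
      FracOC.partialX K (t, x t, u t) + q * FracOC.partialX G (t, x t, u t) := fun t ht q => by
    simp only [FracOC.hamiltonian, hLK t ht.1, hfG t ht.1]
    exact ((hasDerivAt_partialX hK _ _ _).add
      ((hasDerivAt_partialX hG _ _ _).const_mul q)).deriv
  have hHu : ∀ t ∈ Icc A T, ∀ q : ℝ, deriv (fun v => FracOC.hamiltonian L f t (x t) v q) (u t) =
      FracOC.partialU K (t, x t, u t) + q * FracOC.partialU G (t, x t, u t) := fun t ht q => by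
    simp only [FracOC.hamiltonian, hLK t ht.1, hfG t ht.1]
    exact ((hasDerivAt_partialU hK _ _ _).add
      ((hasDerivAt_partialU hG _ _ _).const_mul q)).deriv
  by_cases hN : N = 0
  · subst hN
    have hM : M ≠ 0 := fun h => hMN (by rw [h])
    obtain ⟨p, p', hp, hadj, hstat, hpT, hfin⟩ := pontryagin_of_ode haA hM hG hK hφ hmin'
    refine ⟨p, fun t _ => (hp t).continuousAt.continuousWithinAt,
      fun _ t _ => (hp t).differentiableAt.differentiableWithinAt, fun h => absurd rfl h,
      fun t ht => ⟨?_, ?_⟩, fun h => absurd rfl h, fun t ht => ?_, ?_, ?_, fun h => absurd rfl h⟩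
    · rw [hHx t ht, (hp t).hasDerivWithinAt.derivWithin (uniqueDiffOn_Icc hAT t ht), zero_mul,
        sub_zero]
      exact hadj t ht
    · rw [hHp]; exact hmin.1.dynamics t ht
    · rw [hHu t ht]; exact hstat t ht
    · simp only [FracOC.hamiltonian, hLK T hAT.le, hfG T hAT.le, zero_mul, sub_zero, add_zero]
      exact hfin
    · rw [zero_mul, add_zero, hpT, sub_self]
  · obtain ⟨hX, hU, hφx, hfin⟩ := stationary_of_frac hα haA hN hG hK hφ hmin'
    refine ⟨fun _ => 0, continuousOn_const, fun _ => differentiableOn_const 0,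
      fun _ => ⟨hasRightRLDOn_zero _ _ _, hasRightRLDOn_zero _ _ _⟩,
      fun t ht => ⟨?_, ?_⟩, fun _ t _ => by simp [rightRLD_zero], fun t ht => ?_, ?_, ?_,
      fun _ => by simp [rightRLI_zero]⟩
    · rw [hHx t ht, hX t ht, rightRLD_zero]
      simp
    · rw [hHp]; exact hmin.1.dynamics t ht
    · rw [hHu t ht, hU t ht, zero_mul, add_zero]
    · simp only [FracOC.hamiltonian, hLK T hAT.le, rightRLI_zero, zero_mul, mul_zero, add_zero,
        sub_zero]
      exact hfin
    · simp only [rightRLI_zero, mul_zero, add_zero]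
      rw [hφx, sub_zero]
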